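/- **Setting.** Let $d\ge 2$ and fix $\mathfrak w\in\mathbb R^d\setminus\{0\}$. Put $\mathbb T^d=(\mathbb R/2\pi\mathbb Z)^d$, $e_k(x)=(2\pi)^{-d/2}e^{\iota k\cdot x}$, $\iota=\sqrt{-1}$, and let $\hat f$ denote the corresponding Fourier coefficients. Let $\Gamma L^2=\bigoplus_{n\ge0}\Gamma L^2_n$ be the Fock space, where $\Gamma L^2_n$ is the space of symmetric functions in $L^2(\mathbb T^{dn})$ with zero average in each of the $n$ variables, with norm $\|f\|^2=\sum_n n!\,\|f_n\|^2_{L^2(\mathbb T^{dn})}$. For $0<\varepsilon<1$ let $\lambda_\varepsilon=(\log\varepsilon^{-2})^{-1/2}$ if $d=2$ and $\lambda_\varepsilon=\varepsilon^{d/2-1}$ if $d\ge3$. Let $\mathbb J^\varepsilon_{\ell,m}=\mathbf 1\{0<\varepsilon|\ell|\le1,\ 0<\varepsilon|m|\le 1,\ 0<\varepsilon|\ell+m|\le1\}$, where $|\cdot|$ is here the Euclidean norm if $d=2$ and the sup-norm if $d\ge3$; if $d\ge3$, $\varepsilon$ is restricted to the values with $1/\varepsilon\in\mathbb N+\frac12$.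 With $|k_{1:n}|^2=\sum_a|k_a|^2$ (Euclidean norms), define for $f\in\Gamma L^2_n$ $$\widehat{\mathcal L_0f}(k_{1:n})=-\tfrac12|k_{1:n}|^2\hat f(k_{1:n}),$$ $$\widehat{\mathcal A^\varepsilon_+f}(k_{1:n+1})=-\frac{2\iota}{(2\pi)^{d/2}}\frac{\lambda_\varepsilon}{n+1}\sum_{1\le a<b\le n+1}[\mathfrak w\cdot(k_a+k_b)]\,\mathbb J^\varepsilon_{k_a,k_b}\,\hat f\big(k_a+k_b,(k_c)_{c\ne a,b}\big),$$ and let $\mathcal A^\varepsilon_-=-(\mathcal A^\varepsilon_+)^*$, that is $$\widehat{\mathcal A^\varepsilon_-f}(k_{1:n-1})=-\frac{\iota}{(2\pi)^{d/2}}\,n\lambda_\varepsilon\sum_{a=1}^{n-1}(\mathfrak w\cdot k_a)\sum_{\ell+m=k_a}\mathbb J^\varepsilon_{\ell,m}\,\hat f\big(\ell,m,(k_c)_{c\neq a}\big).$$ Put $\mathcal A^\varepsilon=\mathcal A^\varepsilon_++\mathcal A^\varepsilon_-$ and $\mathcal L^\varepsilon=\mathcal L_0+\mathcal A^\varepsilon$.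 Let $P_i^n$ be the projection onto $\bigoplus_{j=i}^n\Gamma L^2_j$ (so $P_i^{i-1}=0$). For $d=2$ let $\mathcal S^\varepsilon=(-\mathcal L_0-\mathcal L_0^{\mathfrak w}\mathcal G^\varepsilon)^{-1}$ be the Fourier multiplier $$\Big(\tfrac12|k_{1:n}|^2+\tfrac12\sum_{a}(\mathfrak w\cdot k_a)^2\,G\big(L^\varepsilon(\tfrac12|k_{1:n}|^2)\big)\Big)^{-1},$$ where $$L^\varepsilon(x)=\lambda_\varepsilon^2\log\Big(1+\frac1{\varepsilon^2x}\Big),\qquad G(x)=\frac1{|\mathfrak w|^2}\Big[\Big(\frac{3|\mathfrak w|^2}{2\pi}x+1\Big)^{2/3}-1\Big].$$ **Theorem 2.8.** There are thresholds $\varepsilon_d(n)>0$, $n\in\mathbb N$, with $\varepsilon_d(n)=1$ if $d\ge3$, such that for every $k\in\mathbb N$ there is a constant $C>0$, depending only on $k$, $d$ and $\mathfrak w$, with the following property. Let $\phi,\psi$ be smooth functions on $\mathbb T^d$ with zero average, and let $f_1=\phi$, $f_2=\frac12(\phi\otimes\psi+\psi\otimes\phi)$. Let $i\in\{2,3\}$,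 $n\ge i$ and $0<\varepsilon<\varepsilon_d(n)$ (with $1/\varepsilon\in\mathbb N+\frac12$ if $d\ge3$). Then there is a unique $w^{\varepsilon,n}\in\bigoplus_{j=i}^n\Gamma L^2_j$ which solves the truncated generator equation $$-\big(\mathcal L_0+P_i^n\mathcal A^\varepsilon P_i^n\big)w^{\varepsilon,n}=\mathcal A^\varepsilon_+f_{i-1}\qquad\text{if }d\ge3,$$ respectively the ansatz equation $$w^{\varepsilon,n}=\mathcal S^\varepsilon\mathcal A^\varepsilon_+P_i^{n-1}w^{\varepsilon,n}+\mathcal S^\varepsilon\mathcal A^\varepsilon_+f_{i-1}\qquad\text{if }d=2,$$ and, writing $w^{\varepsilon,n}_i$ for its component in $\Gamma L^2_i$, it satisfies $$\big\|(-\mathcal L_0)^{-1/2}\big(-\mathcal L^\varepsilon w^{\varepsilon,n}-\mathcal A^\varepsilon_+f_{i-1}+\mathcal A^\varepsilon_-w^{\varepsilon,n}_i\big)\big\|\le\frac C{n^k}\,\big\|(-\mathcal L_0)^{1/2}f_{i-1}\big\|.$$ -/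

import Mathlib

open scoped ENNReal

noncomputable section

namespace Burgers

/-! Functions on the torus of side length `2π` and their Fourier coefficients. -/

/-- The Fourier basis function `e_k(x) = (2π)^(-d/2) exp(i k·x)`. -/
def basisFun {d : ℕ} (k : Fin d → ℤ) (x : Fin d → ℝ) : ℂ :=
  (((2 * Real.pi) ^ (-(d : ℝ) / 2) : ℝ) : ℂ) *
    Complex.exp (Complex.I * ((∑ b, (k b : ℝ) * x b : ℝ) : ℂ))

/-- Fourier coefficient at `k = (k_1, …, k_n)` of a function `F(x_1, …, x_n)` on the `n`-fold
product of the `d`-dimensional torus (a function of `x_1, …, x_n` that is `2π`-periodic in all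
coordinates): the integral of `F` against `∏ e_{-k_a}(x_a)` over a fundamental domain. -/
def fourierCoefficient {d n : ℕ} (F : (Fin n → Fin d → ℝ) → ℂ) (k : Fin n → Fin d → ℤ) : ℂ :=
  ∫ x in Set.univ.pi (fun _ : Fin n => Set.univ.pi fun _ : Fin d => Set.Ico 0 (2 * Real.pi)),
    F x * ∏ a, basisFun (-(k a)) (x a)

/-- Smooth functions on the `d`-dimensional torus of side `2π` with zero average. -/
structure IsTestFunction {d : ℕ} (φ : (Fin d → ℝ) → ℂ) : Prop where
  smooth : ContDiff ℝ (⊤ : ℕ∞) φ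
  periodic : ∀ (x : Fin d → ℝ) (m : Fin d → ℤ), φ (fun b => x b + 2 * Real.pi * m b) = φ x
  mean_zero : ∫ x in Set.univ.pi (fun _ : Fin d => Set.Ico 0 (2 * Real.pi)), φ x = 0

/-! The Fock space, in Fourier variables. -/

/-- A sequence `(f_n)` of kernels, `f_n` being given by its Fourier coefficients
`f_n(k_1, …, k_n)`, `k_a ∈ ℤ^d`. -/
abbrev Kernels (d : ℕ) : Type := (n : ℕ) → (Fin n → Fin d → ℤ) → ℂ

/-- The Fock norm `‖f‖ = (∑_n n! ‖f_n‖²_{L²})^(1/2)`, with values in `[0, ∞]`; by Parseval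
`‖f_n‖²_{L²}` is the sum of the squares of the Fourier coefficients. -/
def fockNorm {d : ℕ} (f : Kernels d) : ℝ≥0∞ :=
  (∑' n, (n.factorial : ℝ≥0∞) * ∑' k, ‖f n k‖ₑ ^ 2) ^ (1 / 2 : ℝ)

/-- The (complex) Fock space: symmetric kernels, with zero average in each variable, and of finite
Fock norm. -/
structure InFock {d : ℕ} (f : Kernels d) : Prop where
  symm : ∀ (n : ℕ) (σ : Equiv.Perm (Fin n)) (k : Fin n → Fin d → ℤ), f n (k ∘ σ) = f n k
  mean_zero : ∀ (n : ℕ) (k : Fin n → Fin d → ℤ), (∃ a, k a = 0) → f n k = 0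
  norm_lt_top : fockNorm f < ⊤

/-- Projection onto the chaoses of order `i, i + 1, …, n` (the zero map if `n < i`). In particular
`chaosProj i i f` is the component of `f` in the `i`-th chaos. -/
def chaosProj {d : ℕ} (i n : ℕ) (f : Kernels d) : Kernels d :=
  fun m k => if i ≤ m ∧ m ≤ n then f m k else 0

/-- The functions `f_1 = φ` and `f_2 = (φ ⊗ ψ + ψ ⊗ φ) / 2`. -/
def testKernel {d : ℕ} (φ ψ : (Fin d → ℝ) → ℂ) : (m : ℕ) → (Fin m → Fin d → ℝ) → ℂ
  | 1, x => φ (x 0)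
  | 2, x => (φ (x 0) * ψ (x 1) + ψ (x 0) * φ (x 1)) / 2
  | _, _ => 0

/-- For `m = 1, 2`, the function `f_m` as an element of the `m`-th chaos. -/
def testInput {d : ℕ} (φ ψ : (Fin d → ℝ) → ℂ) (m : ℕ) : Kernels d :=
  fun n k => if n = m then fourierCoefficient (testKernel φ ψ n) k else 0

/-! The generator. -/

/-- `|k_{1:n}|² = |k_1|² + … + |k_n|²`, Euclidean norms. -/
def modeSq {d n : ℕ} (k : Fin n → Fin d → ℤ) : ℝ := ∑ a, ∑ b, (k a b : ℝ) ^ 2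

/-- `w · k`. -/
def dot {d : ℕ} (w : Fin d → ℝ) (k : Fin d → ℤ) : ℝ := ∑ b, w b * (k b : ℝ)

/-- The coupling constant `λ_ε`. -/
def coupling (d : ℕ) (ε : ℝ) : ℝ :=
  if d = 2 then 1 / Real.sqrt (Real.log (ε ^ (-2 : ℤ))) else ε ^ ((d : ℝ) / 2 - 1)

/-- The norm in the Fourier cut-off: Euclidean if `d = 2`, the sup-norm if `d ≥ 3`. -/
def cutoffNorm {d : ℕ} (k : Fin d → ℤ) : ℝ :=
  if d = 2 then Real.sqrt (∑ b, (k b : ℝ) ^ 2) else ‖fun b => (k b : ℝ)‖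

open Classical in
/-- The indicator function of
`0 < ε|l| ≤ 1`, `0 < ε|m| ≤ 1`, `0 < ε|l + m| ≤ 1`. -/
def cutoff {d : ℕ} (ε : ℝ) (l m : Fin d → ℤ) : ℝ :=
  if (0 < ε * cutoffNorm l ∧ ε * cutoffNorm l ≤ 1) ∧
      (0 < ε * cutoffNorm m ∧ ε * cutoffNorm m ≤ 1) ∧
      (0 < ε * cutoffNorm (l + m) ∧ ε * cutoffNorm (l + m) ≤ 1) then 1 else 0

/-- The admissible scales: no restriction if `d = 2`, and `1/ε ∈ ℕ + 1/2` if `d ≥ 3`. -/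
def AdmissibleScale (d : ℕ) (ε : ℝ) : Prop :=
  d = 2 ∨ ∃ N : ℕ, 1 / ε = (N : ℝ) + 1 / 2

/-- `𝓛₀`, the Fourier multiplier `-|k_{1:n}|²/2`. -/
def symGen {d : ℕ} (f : Kernels d) : Kernels d :=
  fun n k => ((-(1 / 2) * modeSq k : ℝ) : ℂ) * f n k

/-- `(-𝓛₀)^s`, the Fourier multiplier `(|k_{1:n}|²/2)^s`; it is used on elements without component
of order `0`. -/
def negSymGenPow {d : ℕ} (s : ℝ) (f : Kernels d) : Kernels d :=
  fun n k => (((1 / 2 * modeSq k) ^ s : ℝ) : ℂ) * f n k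

/-- The creation part `𝓐₊` of the antisymmetric part of the generator. For `f` in the `n`-th chaos,
`(𝓐₊ f)(k_1, …, k_{n+1})` is `-(2i/(2π)^(d/2)) λ_ε/(n+1)` times the sum over `a < b` of
`w·(k_a + k_b)` times the cut-off indicator of `(k_a, k_b)` times
`f(k_a + k_b, (k_c)_{c ≠ a, b})`. As `f` is symmetric, the order of its arguments is immaterial:
here `k_a` is replaced by `k_a + k_b`, and `k_b` is removed. -/
def creation {d : ℕ} (w : Fin d → ℝ) (ε : ℝ) (f : Kernels d) : Kernels d
  | 0, _ => 0
  | n + 1, k =>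
      -(2 * Complex.I / (((2 * Real.pi) ^ ((d : ℝ) / 2) : ℝ) : ℂ)) *
        ((coupling d ε / ((n : ℝ) + 1) : ℝ) : ℂ) *
        ∑ a : Fin (n + 1), ∑ b ∈ Finset.Ioi a,
          ((dot w (k a + k b) * cutoff ε (k a) (k b) : ℝ) : ℂ) *
            f n ((Function.update k a (k a + k b)) ∘ b.succAbove)

/-- The annihilation part `𝓐₋ = -(𝓐₊)^*` of the antisymmetric part of the generator (adjoint with
respect to the Fock scalar product). For `f` in the chaos of order `N = n + 1`,
`(𝓐₋ f)(k_1, …, k_n)` is `-(i/(2π)^(d/2)) N λ_ε` times the sum over `a` of `w·k_a` times the sum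
over `l + m = k_a` of the cut-off indicator of `(l, m)` times `f(l, m, (k_c)_{c ≠ a})`; the inner
sum has finitely many non-zero terms. Again the order of the arguments of `f` is immaterial. -/
def annihilation {d : ℕ} (w : Fin d → ℝ) (ε : ℝ) (f : Kernels d) : Kernels d :=
  fun n k =>
    -(Complex.I / (((2 * Real.pi) ^ ((d : ℝ) / 2) : ℝ) : ℂ)) *
      ((((n : ℝ) + 1) * coupling d ε : ℝ) : ℂ) *
      ∑ a : Fin n, ((dot w (k a) : ℝ) : ℂ) *
        ∑' l : Fin d → ℤ, ((cutoff ε l (k a - l) : ℝ) : ℂ) *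
          f (n + 1) (Fin.cons l (Function.update k a (k a - l)))

/-- `𝓐 = 𝓐₊ + 𝓐₋`. -/
def antisymGen {d : ℕ} (w : Fin d → ℝ) (ε : ℝ) (f : Kernels d) : Kernels d :=
  creation w ε f + annihilation w ε f

/-- The generator `𝓛 = 𝓛₀ + 𝓐`. -/
def generator {d : ℕ} (w : Fin d → ℝ) (ε : ℝ) (f : Kernels d) : Kernels d :=
  symGen f + antisymGen w ε f

/-- The truncated generator `𝓛_{i,n} = 𝓛₀ + P_i^n 𝓐 P_i^n`. -/
def truncGenerator {d : ℕ} (w : Fin d → ℝ) (ε : ℝ) (i n : ℕ) (f : Kernels d) : Kernels d :=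
  symGen f + chaosProj i n (antisymGen w ε (chaosProj i n f))

/-! The two-dimensional ansatz. -/

/-- `L^ε(x) = λ_ε² log(1 + 1/(ε² x))`. -/
def logScale (d : ℕ) (ε x : ℝ) : ℝ := coupling d ε ^ 2 * Real.log (1 + 1 / (ε ^ 2 * x))

/-- `G(x) = |w|⁻² ((3|w|²x/(2π) + 1)^(2/3) - 1)`, with the Euclidean norm of `w`. -/
def diffusivityG {d : ℕ} (w : Fin d → ℝ) (x : ℝ) : ℝ :=
  1 / (∑ b, w b ^ 2) * ((3 * (∑ b, w b ^ 2) / (2 * Real.pi) * x + 1) ^ (2 / 3 : ℝ) - 1)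

/-- `(-𝓛₀ - 𝓛₀^w 𝓖^ε)⁻¹`, where `𝓛₀^w` is the multiplier `-∑_a (w·k_a)²/2` and
`𝓖^ε = G(L^ε(-𝓛₀))` is the multiplier `G(L^ε(|k_{1:n}|²/2))`; it is used on elements without
component of order `0`. -/
def ansatzInv {d : ℕ} (w : Fin d → ℝ) (ε : ℝ) (f : Kernels d) : Kernels d :=
  fun n k =>
    (((1 / 2 * modeSq k + 1 / 2 * (∑ a, dot w (k a) ^ 2) *
      diffusivityG w (logScale d ε (1 / 2 * modeSq k)))⁻¹ : ℝ) : ℂ) * f n k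

/-! The two equations. -/

/-- `v` is an element of the sum of the chaoses of order `i, …, n` of the Fock space. -/
def InTruncatedFock {d : ℕ} (i n : ℕ) (v : Kernels d) : Prop :=
  InFock v ∧ chaosProj i n v = v

/-- `v` solves the truncated generator equation `-𝓛_{i,n} v = 𝓐₊ f`. -/
def IsTruncatedSolution {d : ℕ} (w : Fin d → ℝ) (ε : ℝ) (i n : ℕ) (f v : Kernels d) : Prop :=
  InTruncatedFock i n v ∧ -truncGenerator w ε i n v = creation w ε f

/-- `v` solves the ansatz equation
`v = (-𝓛₀ - 𝓛₀^w 𝓖^ε)⁻¹ 𝓐₊ P_i^{n-1} v + (-𝓛₀ - 𝓛₀^w 𝓖^ε)⁻¹ 𝓐₊ f`. -/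
def IsAnsatzSolution {d : ℕ} (w : Fin d → ℝ) (ε : ℝ) (i n : ℕ) (f v : Kernels d) : Prop :=
  InTruncatedFock i n v ∧
    v = ansatzInv w ε (creation w ε (chaosProj i (n - 1) v)) + ansatzInv w ε (creation w ε f)

/-- The approximate solution of the generator equation: that of the truncated generator equation if
`d ≥ 3`, that of the ansatz equation if `d = 2`. -/
def IsApproxSolution {d : ℕ} (w : Fin d → ℝ) (ε : ℝ) (i n : ℕ) (f v : Kernels d) : Prop :=
  if d = 2 then IsAnsatzSolution w ε i n f v else IsTruncatedSolution w ε i n f v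

end Burgers

end

/-!
All estimates are made in coordinates in which the Fock norm of `(-𝓛₀)^(1/2) f` is an `ℓ²` norm
(`nrm`, `dualNrm`). There `𝓐₊` becomes, from the `m`-th chaos to the next, a bounded operator `T`
(`exists_creation_clm`), and `-𝓐₋` its adjoint `T†`. The graded sector condition
`‖T‖² ≤ M m`, uniformly in the scale (`sqNorm_pairOp_hinv_le`), follows from the Cauchy-Schwarz
inequality: the coupling constant is chosen so that it compensates the divergence of `∑ 1/|l|²` over
the modes that the cut-off allows (`exists_coupling_sum_le`).

*Dimension at least three.* The truncated equation is the tridiagonal system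
`x_{m+1} + T† x_{m+2} = T x_m` with the right-hand side `T f` in the lowest chaos. It is solved by
elimination from the top (`exists_tridiagonal`); each step inverts an operator `1 + T† R T` with
`R ≥ 0`. The residual is `-T x_n`, which lives in chaos `n + 1`. Since `‖T‖` grows only like `√m`,
the energy estimate survives the weights `(m + A)^(2q+2)` for a large constant `A`
(`tridiagonal_energy`, `weight_condition`), so that `‖x_n‖` decays faster than any power of `n`.

*Dimension two.* The ansatz equation is the recursion `(1 + g) x_{m+1} = T x_m`, where the multiplier
`g` (`gain`) is the ratio of `-𝓛₀^w 𝓖` and `-𝓛₀`; so existence and uniqueness are immediate. The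
residual is `-T x_n` in chaos `n + 1`, `-g x_n` in chaos `n`, and `(T† (1 + g)⁻¹ T - g) x_m` in the
chaoses `m < n`. The main point is that `T† (1 + g)⁻¹ T - g` has norm at most `C_m λ²`
(`exists_selfEnergy_sub_gain_le`). Expanded, the operator is a sum over the ways to split a mode into
a pair and to merge a pair of the resulting modes.

* If the two pairs differ, Schur's test with the weights `|k_β| / |k_ξ|` bounds the term by a
  multiple of `λ²` (`tsum_split_fuse_sq_le`).
* If they agree, the term is a multiplier, namely `λ²` times a lattice sum over the split mode. The
  sum is compared with an integral in the plane. The angular integral is explicit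
  (`integral_angular`), and the radial one is then the integral of an exact derivative, because the
  differential equation for `G` is just the self-consistency of the ansatz
  (`hasDerivAt_diffusivity`). This gives `g` up to an error of order `λ²`
  (`exists_abs_sum_pairSymbol_sub_le`).

As `0 ≤ g ≤ γ` with `γ = |w|²`, the recursion contracts the energy `‖x‖² + ⟨x, g x⟩` by the factor
`γ / (1 + γ) + C_m λ²` (`energy_contraction`). As `λ` vanishes with the scale, below a threshold
depending on `n` the solution decays geometrically in the order of the chaos, and the replacement
errors in the chaoses `m < n` are smaller than `θ^n` with some `θ < 1`.
-/


noncomputable section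

namespace Burgers

/-! ### Merging and splitting of modes -/

section FuseSplit

variable {G : Type*} [AddCommGroup G] {n : ℕ}

/-- Remove the entry `b` of a tuple, and add it to the entry which has index `a` afterwards. -/
def fuse (b : Fin (n + 1)) (a : Fin n) (k : Fin (n + 1) → G) : Fin n → G :=
  Function.update (fun j => k (b.succAbove j)) a (k (b.succAbove a) + k b)

/-- Split the entry `a` of a tuple into `l`, inserted at position `b`, and the remainder. -/
def split (b : Fin (n + 1)) (a : Fin n) (l : G) (k : Fin n → G) : Fin (n + 1) → G :=
  b.insertNth l (Function.update k a (k a - l))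

@[simp] lemma split_apply_same (b : Fin (n + 1)) (a : Fin n) (l : G) (k : Fin n → G) :
    split b a l k b = l := by simp [split]

@[simp] lemma split_apply_succAbove (b : Fin (n + 1)) (a : Fin n) (l : G) (k : Fin n → G)
    (j : Fin n) : split b a l k (b.succAbove j) = Function.update k a (k a - l) j := by
  simp [split]

lemma fuse_split (b : Fin (n + 1)) (a : Fin n) (l : G) (k : Fin n → G) :
    fuse b a (split b a l k) = k := by
  funext j
  by_cases h : j = a
  · subst h; simp [fuse]
  · simp [fuse, h]

lemma split_fuse (b : Fin (n + 1)) (a : Fin n) (k : Fin (n + 1) → G) :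
    split b a (k b) (fuse b a k) = k := by
  funext j
  rcases Fin.eq_self_or_eq_succAbove b j with rfl | ⟨j, rfl⟩
  · simp
  · by_cases h : j = a
    · subst h; simp [fuse]
    · simp [fuse, h]

/-- A tuple is determined by its entry `b` and the tuple in which this entry is merged into
another one. -/
@[simps] def splitEquiv (b : Fin (n + 1)) (a : Fin n) : G × (Fin n → G) ≃ (Fin (n + 1) → G) where
  toFun p := split b a p.1 p.2
  invFun k := (k b, fuse b a k)
  left_inv p := by simp [fuse_split]
  right_inv k := by simp [split_fuse]

lemma fuse_eq_update_comp (b : Fin (n + 1)) (a : Fin n) (k : Fin (n + 1) → G) :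
    fuse b a k = Function.update k (b.succAbove a) (k (b.succAbove a) + k b) ∘ b.succAbove := by
  funext j
  by_cases h : j = a
  · subst h; simp [fuse]
  · simp [fuse, h, Function.update_of_ne]

/-- A permutation of the indices, restricted to the complements of `b` and of `σ b`. -/
lemma exists_perm_succAbove (σ : Equiv.Perm (Fin (n + 1))) (b : Fin (n + 1)) :
    ∃ τ : Equiv.Perm (Fin n), ∀ j, σ (b.succAbove j) = (σ b).succAbove (τ j) := by
  have h : ∀ j, ∃ i, (σ b).succAbove i = σ (b.succAbove j) := fun j =>
    Fin.exists_succAbove_eq fun h => Fin.succAbove_ne b j (σ.injective h)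
  choose t ht using h
  have ti : Function.Injective t := fun x y hxy => by
    have := (ht x).symm.trans ((congrArg _ hxy).trans (ht y))
    exact Fin.succAbove_right_injective (σ.injective this)
  exact ⟨Equiv.ofBijective t (Finite.injective_iff_bijective.1 ti), fun j => (ht j).symm⟩

variable {X : Type*}

/-- Kernels invariant under permutations of their arguments. -/
def Symm (f : (Fin n → G) → X) : Prop := ∀ (σ : Equiv.Perm (Fin n)) k, f (k ∘ σ) = f k

/-- The value of a symmetric kernel after merging the modes `b` and `c`, as a function of the ordered
pair `(b, c)`. -/
def mergeVal (f : (Fin n → G) → X) (k : Fin (n + 1) → G) (b c : Fin (n + 1)) : X :=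
  f (Function.update k c (k c + k b) ∘ b.succAbove)

lemma mergeVal_comp {f : (Fin n → G) → X} (hf : Symm f) (k : Fin (n + 1) → G)
    (σ : Equiv.Perm (Fin (n + 1))) (b c : Fin (n + 1)) :
    mergeVal f (k ∘ σ) b c = mergeVal f k (σ b) (σ c) := by
  obtain ⟨τ, hτ⟩ := exists_perm_succAbove σ b
  unfold mergeVal
  rw [← hf τ (Function.update k (σ c) _ ∘ _)]
  congr 1
  funext j
  simp only [Function.comp_apply, ← hτ, Function.update_apply, σ.injective.eq_iff]

lemma mergeVal_swap {f : (Fin n → G) → X} (hf : Symm f) (k : Fin (n + 1) → G)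
    (b c : Fin (n + 1)) : mergeVal f k b c = mergeVal f k c b := by
  obtain ⟨τ, hτ⟩ := exists_perm_succAbove (Equiv.swap b c) b
  rw [Equiv.swap_apply_left] at hτ
  unfold mergeVal
  rw [← hf τ (Function.update k b (k b + k c) ∘ c.succAbove)]
  congr 1
  funext j
  simp only [Function.comp_apply, ← hτ]
  have hb : b.succAbove j ≠ b := Fin.succAbove_ne b j
  by_cases hc : b.succAbove j = c
  · simp [hc, add_comm]
  · rw [Equiv.swap_apply_of_ne_of_ne hb hc]
    simp [hb, hc]

lemma Symm.split_eq {f : (Fin (n + 1) → G) → X} (hf : Symm f) (b : Fin (n + 1)) (a : Fin n)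
    (l : G) (k : Fin n → G) :
    f (split b a l k) = f (split 0 a l k) := by
  rw [← hf b.cycleRange.symm]
  congr 1
  funext j
  refine Fin.cases ?_ (fun j => ?_) j
  · simp [split]
  · simp only [split, Function.comp_apply, Fin.cycleRange_symm_succ, Fin.insertNth_apply_succAbove,
      Fin.insertNth_zero', Fin.cons_succ]

lemma split_zero (a : Fin n) (l : G) (k : Fin n → G) :
    split 0 a l k = Fin.cons l (Function.update k a (k a - l)) := by
  simp [split]

lemma Symm.split_comp {f : (Fin (n + 1) → G) → X} (hf : Symm f) (a : Fin n) (l : G)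
    (k : Fin n → G) (σ : Equiv.Perm (Fin n)) :
    f (split 0 a l (k ∘ σ)) = f (split 0 (σ a) l k) := by
  rw [← hf (Equiv.Perm.decomposeFin.symm (0, σ)) (split 0 (σ a) l k)]
  congr 1
  funext j
  refine Fin.cases ?_ (fun j => ?_) j
  · simp [split_zero, -Fin.cons_update]
  · simp [split_zero, Function.update_apply, -Fin.cons_update]

/-- A sum over ordered pairs `(b, c)` with `b ≠ c`, for a symmetric summand. -/
lemma sum_succAbove_eq {R : Type*} [Ring R] (g : Fin (n + 1) → Fin (n + 1) → R)
    (hg : ∀ b c, b ≠ c → g b c = g c b) :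
    ∑ b, ∑ a : Fin n, g b (b.succAbove a) = 2 * ∑ a, ∑ b ∈ Finset.Ioi a, g b a := by
  have h1 : ∀ b, ∑ a : Fin n, g b (b.succAbove a) = ∑ c, if c = b then 0 else g b c := by
    intro b
    rw [Fin.sum_univ_succAbove _ b]
    simp [Fin.succAbove_ne]
  have h2 : ∀ b c, (if c = b then 0 else g b c) =
      (if b < c then g c b else 0) + (if c < b then g b c else 0) := by
    intro b c
    rcases lt_trichotomy b c with h | h | h
    · simp [h, h.ne', h.not_gt, hg b c h.ne]
    · simp [h]
    · simp [h, h.ne, h.not_gt]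
  simp_rw [h1, h2, Finset.sum_add_distrib]
  rw [Finset.sum_comm (f := fun b c => if c < b then g b c else 0), two_mul]
  simp [← Finset.sum_filter, Finset.filter_lt_eq_Ioi]

/-- Sums over ordered pairs of distinct indices are invariant under permutations. -/
lemma sum_succAbove_comp {R : Type*} [AddCommMonoid R] (g : Fin (n + 1) → Fin (n + 1) → R)
    (σ : Equiv.Perm (Fin (n + 1))) :
    ∑ b, ∑ a : Fin n, g (σ b) (σ (b.succAbove a)) = ∑ b, ∑ a : Fin n, g b (b.succAbove a) := by
  rw [← Equiv.sum_comp σ (fun b => ∑ a : Fin n, g b (b.succAbove a))]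
  refine Finset.sum_congr rfl fun b _ => ?_
  obtain ⟨τ, hτ⟩ := exists_perm_succAbove σ b
  rw [← Equiv.sum_comp τ (fun a => g (σ b) ((σ b).succAbove a))]
  simp [hτ]

end FuseSplit

/-! ### The generator as a sum over ordered pairs of modes -/

variable {d n : ℕ}

/-- The interaction coefficient of two modes. -/
def vertex (w : Fin d → ℝ) (ε : ℝ) (l m : Fin d → ℤ) : ℝ := dot w (l + m) * cutoff ε l m

lemma cutoff_comm (ε : ℝ) (l m : Fin d → ℤ) : cutoff ε l m = cutoff ε m l := by
  unfold cutoff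
  rw [add_comm m l]
  congr 1
  simp only [eq_iff_iff]
  tauto

lemma vertex_comm (w : Fin d → ℝ) (ε : ℝ) (l m : Fin d → ℤ) :
    vertex w ε l m = vertex w ε m l := by
  unfold vertex
  rw [cutoff_comm, add_comm]

lemma creation_succ (w : Fin d → ℝ) (ε : ℝ) (f : Kernels d) (hf : Symm (f n))
    (k : Fin (n + 1) → Fin d → ℤ) :
    creation w ε f (n + 1) k =
      -(Complex.I / (((2 * Real.pi) ^ ((d : ℝ) / 2) : ℝ) : ℂ)) *
        ((coupling d ε / ((n : ℝ) + 1) : ℝ) : ℂ) *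
        ∑ b : Fin (n + 1), ∑ a : Fin n,
          ((vertex w ε (k (b.succAbove a)) (k b) : ℝ) : ℂ) * f n (fuse b a k) := by
  have h := sum_succAbove_eq
    (fun b c => ((vertex w ε (k c) (k b) : ℝ) : ℂ) * mergeVal (f n) k b c)
    (fun b c _ => by rw [vertex_comm, mergeVal_swap hf k])
  simp only [mergeVal, ← fuse_eq_update_comp] at h
  rw [h]
  simp only [creation, vertex]
  ring

lemma annihilation_apply (w : Fin d → ℝ) (ε : ℝ) (f : Kernels d) (k : Fin n → Fin d → ℤ) :
    annihilation w ε f n k =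
      -(Complex.I / (((2 * Real.pi) ^ ((d : ℝ) / 2) : ℝ) : ℂ)) *
        ((((n : ℝ) + 1) * coupling d ε : ℝ) : ℂ) *
      ∑ a : Fin n, ∑' l : Fin d → ℤ,
        ((vertex w ε (k a - l) l : ℝ) : ℂ) * f (n + 1) (split 0 a l k) := by
  simp only [annihilation]
  congr 1
  refine Finset.sum_congr rfl fun a _ => ?_
  rw [← tsum_mul_left]
  refine tsum_congr fun l => ?_
  rw [split_zero, vertex, cutoff_comm, sub_add_cancel]
  push_cast
  ring

/-! ### Square sums and the Cauchy–Schwarz inequality in `[0, ∞]` -/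

lemma ennreal_cauchy_schwarz {ι : Type*} {f ρ τ : ι → ℝ≥0∞} (h : ∀ i, f i ^ 2 ≤ ρ i * τ i) :
    (∑' i, f i) ^ 2 ≤ (∑' i, ρ i) * ∑' i, τ i := by
  have h1 : ∀ i, f i ≤ ρ i ^ (1 / 2 : ℝ) * τ i ^ (1 / 2 : ℝ) := fun i => by
    rw [← ENNReal.mul_rpow_of_nonneg _ _ (by norm_num)]
    calc f i = (f i ^ 2) ^ (1 / 2 : ℝ) := by
          rw [← ENNReal.rpow_natCast, ← ENNReal.rpow_mul]; norm_num
      _ ≤ _ := ENNReal.rpow_le_rpow (h i) (by norm_num)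
  let _ : MeasurableSpace ι := ⊤
  have h2 := ENNReal.lintegral_mul_le_Lp_mul_Lq (MeasureTheory.Measure.count (α := ι))
    (Real.HolderConjugate.two_two) (f := fun i => ρ i ^ (1 / 2 : ℝ))
    (g := fun i => τ i ^ (1 / 2 : ℝ)) measurable_from_top.aemeasurable
    measurable_from_top.aemeasurable
  simp only [Pi.mul_apply, MeasureTheory.lintegral_count, ← ENNReal.rpow_mul] at h2
  norm_num at h2
  calc (∑' i, f i) ^ 2 ≤ ((∑' i, ρ i) ^ (1 / 2 : ℝ) * (∑' i, τ i) ^ (1 / 2 : ℝ)) ^ 2 := by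
        gcongr
        refine (ENNReal.tsum_le_tsum h1).trans ?_
        norm_num
        exact h2
    _ = _ := by
        rw [mul_pow, ← ENNReal.rpow_natCast, ← ENNReal.rpow_natCast, ← ENNReal.rpow_mul,
          ← ENNReal.rpow_mul]
        norm_num

lemma ennreal_cauchy_schwarz_sum {ι : Type*} [Fintype ι] {f ρ τ : ι → ℝ≥0∞}
    (h : ∀ i, f i ^ 2 ≤ ρ i * τ i) : (∑ i, f i) ^ 2 ≤ (∑ i, ρ i) * ∑ i, τ i := by
  simpa [tsum_fintype] using ennreal_cauchy_schwarz h

/-- The square of the `ℓ²` norm, with values in `[0, ∞]`. -/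
def sqNorm {α : Type*} (f : α → ℂ) : ℝ≥0∞ := ∑' k, ‖f k‖ₑ ^ 2

lemma sqNorm_mono {α : Type*} {f g : α → ℂ} (h : ∀ k, ‖f k‖ ≤ ‖g k‖) : sqNorm f ≤ sqNorm g := by
  refine ENNReal.tsum_le_tsum fun k => ?_
  gcongr
  exact enorm_le_iff_norm_le.2 (h k)

lemma sqNorm_const_mul {α : Type*} (c : ℂ) (f : α → ℂ) :
    sqNorm (fun k => c * f k) = ‖c‖ₑ ^ 2 * sqNorm f := by
  simp only [sqNorm, enorm_mul, mul_pow, ENNReal.tsum_mul_left]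

lemma sqNorm_ofReal_mul_ne_top {α : Type*} (c : ℝ) {f : α → ℂ} (h : sqNorm f ≠ ⊤) :
    sqNorm (fun k => (c : ℂ) * f k) ≠ ⊤ := by
  rw [sqNorm_const_mul]
  exact ENNReal.mul_ne_top (by simp [ENNReal.pow_eq_top_iff]) h

lemma sqNorm_sum_le {α ι : Type*} (s : Finset ι) (f : ι → α → ℂ) :
    sqNorm (fun k => ∑ i ∈ s, f i k) ≤ s.card * ∑ i ∈ s, sqNorm (f i) := by
  simp only [sqNorm]
  rw [← Summable.tsum_finsetSum (fun _ _ => ENNReal.summable), ← ENNReal.tsum_mul_left]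
  refine ENNReal.tsum_le_tsum fun k => ?_
  have h := ennreal_cauchy_schwarz_sum (ι := s) (f := fun i => ‖f i k‖ₑ) (ρ := fun _ => 1)
    (τ := fun i => ‖f i k‖ₑ ^ 2) (fun i => by simp)
  rw [Finset.sum_coe_sort s (fun i => ‖f i k‖ₑ), Finset.sum_coe_sort s (fun i => ‖f i k‖ₑ ^ 2)] at h
  simp only [Finset.sum_const, Finset.card_univ, Fintype.card_coe, nsmul_eq_mul, mul_one] at h
  exact (pow_le_pow_left₀ (by positivity) (enorm_sum_le _ _) 2).trans h

lemma sqNorm_add_le {α : Type*} (f g : α → ℂ) :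
    sqNorm (fun k => f k + g k) ≤ 2 * (sqNorm f + sqNorm g) := by
  simpa using sqNorm_sum_le Finset.univ ![f, g]

/-! ### Sums over pairs of modes -/

section PairOp

variable {d n : ℕ}

/-- The operator which sums over all ways to merge two modes, with coefficients `c`. -/
def pairOp (c : Fin (n + 1) → Fin n → (Fin (n + 1) → Fin d → ℤ) → ℂ)
    (y : (Fin n → Fin d → ℤ) → ℂ) (k : Fin (n + 1) → Fin d → ℤ) : ℂ :=
  ∑ b, ∑ a, c b a k * y (fuse b a k)

/-- The formal adjoint of `pairOp`: a sum over all ways to split a mode. -/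
def pairAdj (c : Fin (n + 1) → Fin n → (Fin (n + 1) → Fin d → ℤ) → ℂ)
    (x : (Fin (n + 1) → Fin d → ℤ) → ℂ) (k : Fin n → Fin d → ℤ) : ℂ :=
  ∑ b, ∑ a, ∑' l, (starRingEnd ℂ) (c b a (split b a l k)) * x (split b a l k)

lemma tsum_eq_tsum_split (b : Fin (n + 1)) (a : Fin n) (F : (Fin (n + 1) → Fin d → ℤ) → ℝ≥0∞) :
    ∑' k, F k = ∑' k', ∑' l, F (split b a l k') := by
  rw [← (splitEquiv b a).tsum_eq F, ENNReal.tsum_prod', ENNReal.tsum_comm]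
  rfl

/-- Boundedness of `pairOp` by the Cauchy–Schwarz inequality: one of the factors of the coefficients
is summed over the pairs of modes, and the other one over the splittings. -/
lemma sqNorm_pairOp_le {c : Fin (n + 1) → Fin n → (Fin (n + 1) → Fin d → ℤ) → ℂ}
    {ρ τ : Fin (n + 1) → Fin n → (Fin (n + 1) → Fin d → ℤ) → ℝ≥0∞} {P Q : ℝ≥0∞}
    {σ : (Fin n → Fin d → ℤ) → ℝ≥0∞}
    (h : ∀ b a k, ‖c b a k‖ₑ ^ 2 ≤ ρ b a k * τ b a k) (hρ : ∀ k, ∑ b, ∑ a, ρ b a k ≤ P)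
    (hτ : ∀ k, ∑ b, ∑ a, ∑' l, τ b a (split b a l k) ≤ Q * σ k) (y : (Fin n → Fin d → ℤ) → ℂ) :
    sqNorm (pairOp c y) ≤ P * Q * ∑' k, σ k * ‖y k‖ₑ ^ 2 := by
  have h1 : ∀ k, ‖pairOp c y k‖ₑ ^ 2 ≤ P * ∑ b, ∑ a, τ b a k * ‖y (fuse b a k)‖ₑ ^ 2 := by
    intro k
    have h2 := ennreal_cauchy_schwarz_sum (ι := Fin (n + 1) × Fin n)
      (f := fun p => ‖c p.1 p.2 k * y (fuse p.1 p.2 k)‖ₑ) (ρ := fun p => ρ p.1 p.2 k)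
      (τ := fun p => τ p.1 p.2 k * ‖y (fuse p.1 p.2 k)‖ₑ ^ 2) (fun p => by
        rw [enorm_mul, mul_pow, ← mul_assoc]
        gcongr
        exact h _ _ _)
    simp only [Fintype.sum_prod_type] at h2
    refine (pow_le_pow_left₀ (by positivity) ?_ 2).trans (h2.trans (by gcongr; exact hρ k))
    exact (enorm_sum_le _ _).trans (Finset.sum_le_sum fun _ _ => enorm_sum_le _ _)
  calc sqNorm (pairOp c y)
      ≤ ∑' k, P * ∑ b, ∑ a, τ b a k * ‖y (fuse b a k)‖ₑ ^ 2 := ENNReal.tsum_le_tsum h1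
    _ = P * ∑ b, ∑ a, ∑' k', ∑' l, τ b a (split b a l k') * ‖y k'‖ₑ ^ 2 := by
        rw [ENNReal.tsum_mul_left, Summable.tsum_finsetSum (fun _ _ => ENNReal.summable)]
        congr 1
        refine Finset.sum_congr rfl fun b _ => ?_
        rw [Summable.tsum_finsetSum (fun _ _ => ENNReal.summable)]
        refine Finset.sum_congr rfl fun a _ => ?_
        rw [tsum_eq_tsum_split b a]
        simp only [fuse_split]
    _ = P * ∑' k', (∑ b, ∑ a, ∑' l, τ b a (split b a l k')) * ‖y k'‖ₑ ^ 2 := by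
        congr 1
        simp_rw [ENNReal.tsum_mul_right, Finset.sum_mul]
        rw [Summable.tsum_finsetSum (fun _ _ => ENNReal.summable)]
        refine Finset.sum_congr rfl fun b _ => ?_
        rw [Summable.tsum_finsetSum (fun _ _ => ENNReal.summable)]
    _ ≤ P * ∑' k', (Q * σ k') * ‖y k'‖ₑ ^ 2 := by gcongr; exact hτ _
    _ = _ := by simp_rw [mul_assoc, ENNReal.tsum_mul_left]

end PairOp

/-! ### Square summable kernels as a Hilbert space -/

section Hilbert

variable {α β : Type*}

lemma memℓp_of_sqNorm {f : α → ℂ} (h : sqNorm f ≠ ⊤) : Memℓp f 2 := by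
  rw [memℓp_gen_iff (by norm_num)]
  have h2 := ENNReal.summable_toReal h
  simpa using h2

lemma sqNorm_coe (x : lp (fun _ : α => ℂ) 2) : sqNorm x = ENNReal.ofReal (‖x‖ ^ 2) := by
  have h := lp.norm_rpow_eq_tsum (p := 2) (by norm_num) x
  have hs := (memℓp_gen_iff (p := 2) (by norm_num)).1 (lp.memℓp x)
  simp only [ENNReal.toReal_ofNat, Real.rpow_ofNat] at h hs
  rw [h, ENNReal.ofReal_tsum_of_nonneg (fun _ => by positivity) hs]
  refine tsum_congr fun k => ?_
  rw [ENNReal.ofReal_pow (norm_nonneg _), ofReal_norm]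

lemma sqNorm_coe_ne_top (x : lp (fun _ : α => ℂ) 2) : sqNorm x ≠ ⊤ := by
  rw [sqNorm_coe]; exact ENNReal.ofReal_ne_top

/-- The bounded operator given by a linear map of functions. -/
lemma exists_clm (L : (α → ℂ) →ₗ[ℂ] (β → ℂ)) {C : ℝ≥0∞} (hC : C ≠ ⊤)
    (h : ∀ y, sqNorm (L y) ≤ C * sqNorm y) :
    ∃ T : lp (fun _ : α => ℂ) 2 →L[ℂ] lp (fun _ : β => ℂ) 2, ∀ y, (T y : β → ℂ) = L y := by
  have hf : ∀ y : lp (fun _ : α => ℂ) 2, Memℓp (L y) 2 := fun y =>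
    memℓp_of_sqNorm ((h y).trans_lt (ENNReal.mul_lt_top hC.lt_top
      (sqNorm_coe_ne_top y).lt_top)).ne
  let T₀ : lp (fun _ : α => ℂ) 2 →ₗ[ℂ] lp (fun _ : β => ℂ) 2 :=
    { toFun := fun y => ⟨L y, hf y⟩
      map_add' := fun x y => by
        apply Subtype.ext
        exact L.map_add x y
      map_smul' := fun c y => by
        apply Subtype.ext
        exact L.map_smul c y }
  refine ⟨T₀.mkContinuous (Real.sqrt C.toReal) fun y => ?_, fun y => rfl⟩
  have h1 := h y
  have h2 : sqNorm (L y) = ENNReal.ofReal (‖T₀ y‖ ^ 2) := sqNorm_coe (T₀ y)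
  rw [h2, sqNorm_coe, ← ENNReal.ofReal_toReal hC, ← ENNReal.ofReal_mul (by positivity),
    ENNReal.ofReal_le_ofReal_iff (by positivity)] at h1
  rw [← abs_of_nonneg (norm_nonneg (T₀ y)), ← Real.sqrt_sq_eq_abs]
  refine (Real.sqrt_le_sqrt h1).trans ?_
  rw [Real.sqrt_mul (by positivity), Real.sqrt_sq (norm_nonneg _)]

lemma exists_lp {f : α → ℂ} (h : sqNorm f ≠ ⊤) : ∃ x : lp (fun _ : α => ℂ) 2, (x : α → ℂ) = f :=
  ⟨⟨f, memℓp_of_sqNorm h⟩, rfl⟩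

variable {d n : ℕ}

/-- The linear map underlying `pairOp`. -/
@[simps] def pairOpLin (c : Fin (n + 1) → Fin n → (Fin (n + 1) → Fin d → ℤ) → ℂ) :
    ((Fin n → Fin d → ℤ) → ℂ) →ₗ[ℂ] ((Fin (n + 1) → Fin d → ℤ) → ℂ) where
  toFun := pairOp c
  map_add' x y := by
    funext k
    simp [pairOp, mul_add, Finset.sum_add_distrib]
  map_smul' r y := by
    funext k
    simp only [pairOp, Pi.smul_apply, smul_eq_mul, Finset.mul_sum, RingHom.id_apply]
    refine Finset.sum_congr rfl fun b _ => Finset.sum_congr rfl fun a _ => ?_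
    ring

open scoped InnerProductSpace in
/-- The Hilbert space adjoint of a bounded `pairOp` is `pairAdj`. -/
lemma adjoint_pairOp {c : Fin (n + 1) → Fin n → (Fin (n + 1) → Fin d → ℤ) → ℂ}
    (hc : ∀ b a k', {l | c b a (split b a l k') ≠ 0}.Finite)
    (T : lp (fun _ : Fin n → Fin d → ℤ => ℂ) 2 →L[ℂ] lp (fun _ : Fin (n + 1) → Fin d → ℤ => ℂ) 2)
    (hT : ∀ y, (T y : _ → ℂ) = pairOp c y) (x : lp (fun _ : Fin (n + 1) → Fin d → ℤ => ℂ) 2) :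
    (ContinuousLinearMap.adjoint T x : _ → ℂ) = pairAdj c x := by
  classical
  funext k'
  have h1 : (ContinuousLinearMap.adjoint T x : _ → ℂ) k' =
      ⟪T (lp.single 2 k' (1 : ℂ)), x⟫_ℂ := by
    rw [← ContinuousLinearMap.adjoint_inner_right, lp.inner_single_left]
    simp
  have h2 := (lp.hasSum_inner (𝕜 := ℂ) (T (lp.single 2 k' (1 : ℂ))) x)
  rw [h1]
  refine h2.unique ?_
  have h3 : ∀ b a, HasSum (fun k => (starRingEnd ℂ) (c b a k * if fuse b a k = k' then 1 else 0) * x k)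
      (∑' l, (starRingEnd ℂ) (c b a (split b a l k')) * x (split b a l k')) := by
    intro b a
    have hs : HasSum (fun l => (starRingEnd ℂ) (c b a (split b a l k')) * x (split b a l k'))
        (∑' l, (starRingEnd ℂ) (c b a (split b a l k')) * x (split b a l k')) := by
      refine (summable_of_hasFiniteSupport ((hc b a k').subset fun l hl => ?_)).hasSum
      intro h0
      simp [h0] at hl
    have hi : Function.Injective fun l : Fin d → ℤ => split b a l k' := fun l m hlm => by
      simpa using congrFun hlm b
    rw [← hi.hasSum_iff]
    · simpa [Function.comp_def, fuse_split] using hs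
    · intro k hk
      by_cases hf : fuse b a k = k'
      · exact absurd ⟨k b, by simp [← hf, split_fuse]⟩ hk
      · simp [hf]
  have h4 := hasSum_sum (s := Finset.univ) fun b _ => hasSum_sum (s := Finset.univ) fun a _ => h3 b a
  have e : (fun k => ⟪(T (lp.single 2 k' (1 : ℂ)) : _ → ℂ) k, x k⟫_ℂ) = fun k => ∑ b, ∑ a,
      (starRingEnd ℂ) (c b a k * if fuse b a k = k' then 1 else 0) * x k := by
    funext k
    rw [hT]
    simp only [pairOp, RCLike.inner_apply, map_sum, Finset.mul_sum, lp.single_apply,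
      Pi.single_apply]
    refine Finset.sum_congr rfl fun b _ => Finset.sum_congr rfl fun a _ => ?_
    ring
  rw [e]
  exact h4

end Hilbert

/-! ### Tridiagonal antisymmetric systems -/

section Tridiagonal

open ContinuousLinearMap

variable {V : ℕ → Type*} [∀ n, NormedAddCommGroup (V n)] [∀ n, InnerProductSpace ℂ (V n)]

/-- The operator `1 + A` is invertible for `A ≥ 0`, and its inverse is positive. -/
lemma exists_inverse_one_add {E : Type*} [NormedAddCommGroup E] [InnerProductSpace ℂ E]
    [CompleteSpace E] {A : E →L[ℂ] E} (hA : A.IsPositive) :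
    ∃ R : E →L[ℂ] E, R.IsPositive ∧ ∀ y, R y + A (R y) = y := by
  have hA' : 0 ≤ A := (nonneg_iff_isPositive A).2 hA
  have hu : IsUnit (1 + A) := CStarAlgebra.isUnit_of_le 1 (le_add_of_nonneg_right hA')
  obtain ⟨u, hu⟩ := hu
  have h1 : ∀ y, (u⁻¹ : (E →L[ℂ] E)ˣ).1 y + A ((u⁻¹ : (E →L[ℂ] E)ˣ).1 y) = y := by
    intro y
    have h : (1 + A) * (u⁻¹ : (E →L[ℂ] E)ˣ).1 = 1 := by rw [← hu]; exact u.mul_inv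
    simpa using congrArg (fun B : E →L[ℂ] E => B y) h
  refine ⟨(u⁻¹ : (E →L[ℂ] E)ˣ).1, ?_, h1⟩
  rw [isPositive_iff_complex]
  intro y
  set R := (u⁻¹ : (E →L[ℂ] E)ˣ).1
  have h2 := (isPositive_iff_complex _).1 hA (R y)
  have h3 : inner ℂ (R y) y = inner ℂ (R y) (R y) + inner ℂ (R y) (A (R y)) := by
    rw [← inner_add_right, h1]
  have h5 := (hA.1 (R y) (R y))
  simp only [coe_coe] at h5
  have h4 : inner ℂ (R y) (R y) = ((‖R y‖ ^ 2 : ℝ) : ℂ) := by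
    rw [inner_self_eq_norm_sq_to_K]; simp
  rw [h3, ← h5, ← h2.1, h4]
  constructor
  · simp only [RCLike.re_to_complex, ← Complex.ofReal_add,
      Complex.ofReal_re]
  · have := h2.2
    simp only [RCLike.re_to_complex, Complex.add_re, Complex.ofReal_re] at this ⊢
    positivity

/-- Solvability of the tridiagonal system with unit diagonal, entries `-T` below and `T†` above the
diagonal. The unknowns are eliminated from the top; in each step the Schur complement `1 + T† R T` is
invertible, because `R ≥ 0`. -/
lemma exists_tridiagonal [∀ n, CompleteSpace (V n)] (T : ∀ n, V n →L[ℂ] V (n + 1)) {i n : ℕ}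
    (hin : i ≤ n) :
    ∃ R : V i →L[ℂ] V i, R.IsPositive ∧ ∀ y, ∃ x : ∀ m, V m,
      x i = R y ∧ (∀ m, m < i ∨ n < m → x m = 0) ∧ x i + adjoint (T i) (x (i + 1)) = y ∧
      ∀ m, i ≤ m → m < n → x (m + 1) + adjoint (T (m + 1)) (x (m + 2)) = T m (x m) := by
  induction hin using Nat.decreasingInduction with
  | self =>
    refine ⟨1, isPositive_one, fun y => ⟨Pi.single n y, by simp, fun m hm => ?_, by simp,
      fun m h1 h2 => by omega⟩⟩
    rw [Pi.single_eq_of_ne]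
    omega
  | of_succ i hi ih =>
    obtain ⟨R', hR', h'⟩ := ih
    obtain ⟨R, hR, h⟩ := exists_inverse_one_add (hR'.adjoint_conj (T i))
    refine ⟨R, hR, fun y => ?_⟩
    obtain ⟨x, h1, h2, h3, h4⟩ := h' (T i (R y))
    refine ⟨Function.update x i (R y), by simp, fun m hm => ?_, ?_, fun m hm1 hm2 => ?_⟩
    · rw [Function.update_of_ne (by omega)]
      exact h2 m (by omega)
    · rw [Function.update_self, Function.update_of_ne (by omega), h1]
      exact h y
    · rw [Function.update_of_ne (by omega), Function.update_of_ne (by omega)]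
      rcases hm1.eq_or_lt with rfl | hm1
      · rw [Function.update_self]; exact h3
      · rw [Function.update_of_ne (by omega)]; exact h4 m hm1 hm2

/-- Weighted energy estimate for antisymmetric tridiagonal systems, in terms of the norms `X m` of the
components and of the real parts `r m` of the pairings of neighbouring components: if the couplings
are small relative to the increments of the weights, antisymmetry controls the weighted energy by the
source. -/
lemma tridiagonal_energy {X r t : ℕ → ℝ} {i n : ℕ} {s Y : ℝ} (hin : i ≤ n)
    (hi : X i ^ 2 = s - r i) (hm : ∀ m, i ≤ m → m < n → X (m + 1) ^ 2 = r m - r (m + 1))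
    (hn : r n = 0) (hs : s ≤ X i * Y)
    (hr : ∀ m, i ≤ m → m < n → |(t (m + 1) ^ 2 - t m ^ 2) * r m| ≤
      1 / 2 * (t m * X m) * (t (m + 1) * X (m + 1))) :
    ∀ m, i ≤ m → m ≤ n → t m ^ 2 * X m ^ 2 ≤ 4 * (t i ^ 2 * Y ^ 2) := by
  intro M hiM hMn
  -- summation by parts
  have key : ∀ N, i ≤ N → N ≤ n → ∑ m ∈ Finset.Ico i (N + 1), t m ^ 2 * X m ^ 2 =
      t i ^ 2 * s + ∑ m ∈ Finset.Ico i N, (t (m + 1) ^ 2 - t m ^ 2) * r m - t N ^ 2 * r N := by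
    intro N hN
    induction N, hN using Nat.le_induction with
    | base => intro _; simp [hi]; ring
    | succ N hN ih =>
      intro hNn
      rw [Finset.sum_Ico_succ_top (by omega), ih (by omega), hm N hN (by omega),
        Finset.sum_Ico_succ_top hN]
      ring
  set E := ∑ m ∈ Finset.Ico i (n + 1), t m ^ 2 * X m ^ 2 with hE
  have h1 := key n hin le_rfl
  rw [hn, mul_zero, sub_zero] at h1
  have hpos : ∀ m, 0 ≤ t m ^ 2 * X m ^ 2 := fun m => by positivity
  have h2 : ∑ m ∈ Finset.Ico i n, (t (m + 1) ^ 2 - t m ^ 2) * r m ≤ 1 / 2 * E := by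
    have h3 : ∑ m ∈ Finset.Ico i n, (t (m + 1) ^ 2 - t m ^ 2) * r m ≤
        ∑ m ∈ Finset.Ico i n, (1 / 4 * (t m ^ 2 * X m ^ 2) +
          1 / 4 * (t (m + 1) ^ 2 * X (m + 1) ^ 2)) := by
      refine Finset.sum_le_sum fun m hm => ?_
      rw [Finset.mem_Ico] at hm
      have := (le_abs_self _).trans (hr m hm.1 hm.2)
      nlinarith [sq_nonneg (t m * X m - t (m + 1) * X (m + 1))]
    refine h3.trans ?_
    rw [Finset.sum_add_distrib, ← Finset.mul_sum, ← Finset.mul_sum]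
    have h4 : ∑ m ∈ Finset.Ico i n, t m ^ 2 * X m ^ 2 ≤ E :=
      Finset.sum_le_sum_of_subset_of_nonneg (Finset.Ico_subset_Ico_right (by omega))
        fun _ _ _ => hpos _
    have h5 : ∑ m ∈ Finset.Ico i n, t (m + 1) ^ 2 * X (m + 1) ^ 2 ≤ E := by
      rw [Finset.sum_Ico_add' (fun m => t m ^ 2 * X m ^ 2)]
      exact Finset.sum_le_sum_of_subset_of_nonneg (Finset.Ico_subset_Ico_left (by omega))
        fun _ _ _ => hpos _
    linarith
  have h6 : t i ^ 2 * X i ^ 2 ≤ E := Finset.single_le_sum (f := fun m => t m ^ 2 * X m ^ 2)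
    (fun m _ => hpos m) (Finset.mem_Ico.2 ⟨le_rfl, by omega⟩)
  have h7 : t M ^ 2 * X M ^ 2 ≤ E := Finset.single_le_sum (f := fun m => t m ^ 2 * X m ^ 2)
    (fun m _ => hpos m) (Finset.mem_Ico.2 ⟨hiM, by omega⟩)
  have h8 : t i ^ 2 * s ≤ t i ^ 2 * (X i * Y) := by gcongr
  have h9 : 0 ≤ (t i * X i - 2 * (t i * Y)) ^ 2 := sq_nonneg _
  nlinarith

/-- Weighted energy estimate for the solution of the tridiagonal system. -/
lemma tridiagonal_estimate [∀ n, CompleteSpace (V n)] (T : ∀ n, V n →L[ℂ] V (n + 1)) {i n : ℕ}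
    (hin : i ≤ n) {x : ∀ m, V m} {y : V i} (h0 : ∀ m, m < i ∨ n < m → x m = 0)
    (hi : x i + adjoint (T i) (x (i + 1)) = y)
    (hm : ∀ m, i ≤ m → m < n → x (m + 1) + adjoint (T (m + 1)) (x (m + 2)) = T m (x m))
    {t : ℕ → ℝ}
    (htT : ∀ m, i ≤ m → m < n → |t (m + 1) ^ 2 - t m ^ 2| * ‖T m‖ ≤ 1 / 2 * t m * t (m + 1)) :
    ∀ m, i ≤ m → m ≤ n → t m ^ 2 * ‖x m‖ ^ 2 ≤ 4 * (t i ^ 2 * ‖y‖ ^ 2) := by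
  have hsq : ∀ {m} (z : V m), (inner ℂ z z).re = ‖z‖ ^ 2 := fun z => by
    rw [inner_self_eq_norm_sq_to_K]; simp [← Complex.ofReal_pow]
  refine tridiagonal_energy (X := fun m => ‖x m‖) (t := t)
    (r := fun m => (inner ℂ (T m (x m)) (x (m + 1))).re) (s := (inner ℂ (x i) y).re) hin ?_
    (fun m h1 h2 => ?_) ?_ (re_inner_le_norm (𝕜 := ℂ) _ _) fun m h1 h2 => ?_
  · rw [← hi, inner_add_right, adjoint_inner_right, Complex.add_re, hsq]
    ring
  · have h := congrArg (fun z => (inner ℂ z (x (m + 1))).re) (hm m h1 h2)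
    simp only [inner_add_left, adjoint_inner_left, Complex.add_re, hsq] at h
    rw [← h, ← inner_conj_symm (T (m + 1) (x (m + 1))) (x (m + 2)), Complex.conj_re]
    ring
  · rw [h0 (n + 1) (by omega)]; simp
  · rw [abs_mul]
    have h3 : |(inner ℂ (T m (x m)) (x (m + 1))).re| ≤ ‖T m‖ * ‖x m‖ * ‖x (m + 1)‖ :=
      (Complex.abs_re_le_norm _).trans ((norm_inner_le_norm _ _).trans (by
        gcongr; exact (T m).le_opNorm _))
    calc _ ≤ |t (m + 1) ^ 2 - t m ^ 2| * (‖T m‖ * ‖x m‖ * ‖x (m + 1)‖) := by gcongr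
      _ = |t (m + 1) ^ 2 - t m ^ 2| * ‖T m‖ * (‖x m‖ * ‖x (m + 1)‖) := by ring
      _ ≤ 1 / 2 * t m * t (m + 1) * (‖x m‖ * ‖x (m + 1)‖) :=
          mul_le_mul_of_nonneg_right (htT m h1 h2) (by positivity)
      _ = _ := by ring

lemma tridiagonal_eq_zero [∀ n, CompleteSpace (V n)] (T : ∀ n, V n →L[ℂ] V (n + 1)) {i n : ℕ}
    (hin : i ≤ n) {x : ∀ m, V m} (h0 : ∀ m, m < i ∨ n < m → x m = 0)
    (hi : x i + adjoint (T i) (x (i + 1)) = 0)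
    (hm : ∀ m, i ≤ m → m < n → x (m + 1) + adjoint (T (m + 1)) (x (m + 2)) = T m (x m)) (m : ℕ) :
    x m = 0 := by
  by_cases h : i ≤ m ∧ m ≤ n
  · have := tridiagonal_estimate T hin h0 hi hm (t := fun _ => 1)
      (fun _ _ _ => by norm_num) m h.1 h.2
    simpa using this
  · exact h0 m (by omega)

lemma tridiagonal_unique [∀ n, CompleteSpace (V n)] (T : ∀ n, V n →L[ℂ] V (n + 1)) {i n : ℕ}
    (hin : i ≤ n) {x x' : ∀ m, V m} {y : V i} (h0 : ∀ m, m < i ∨ n < m → x m = 0)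
    (hi : x i + adjoint (T i) (x (i + 1)) = y)
    (hm : ∀ m, i ≤ m → m < n → x (m + 1) + adjoint (T (m + 1)) (x (m + 2)) = T m (x m))
    (h0' : ∀ m, m < i ∨ n < m → x' m = 0) (hi' : x' i + adjoint (T i) (x' (i + 1)) = y)
    (hm' : ∀ m, i ≤ m → m < n → x' (m + 1) + adjoint (T (m + 1)) (x' (m + 2)) = T m (x' m))
    (m : ℕ) : x' m = x m := by
  have hz := tridiagonal_eq_zero T hin (x := fun m => x' m - x m)
    (fun m hm => by rw [h0 m hm, h0' m hm, sub_zero])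
    (by rw [map_sub, sub_add_sub_comm, hi, hi', sub_self])
    (fun m h1 h2 => by rw [map_sub, map_sub, sub_add_sub_comm, hm m h1 h2, hm' m h1 h2])
  exact sub_eq_zero.1 (hz m)

end Tridiagonal

/-! ### Lattice sums -/

section Lattice

variable {d : ℕ}

/-- The sup-norm of a lattice point. -/
def supN (l : Fin d → ℤ) : ℕ := Finset.univ.sup fun b => (l b).natAbs

/-- The square of the Euclidean norm of a lattice point. -/
def normSq (l : Fin d → ℤ) : ℝ := ∑ b, (l b : ℝ) ^ 2

lemma normSq_nonneg (l : Fin d → ℤ) : 0 ≤ normSq l := Finset.sum_nonneg fun _ _ => sq_nonneg _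

lemma natAbs_le_supN (l : Fin d → ℤ) (b : Fin d) : (l b).natAbs ≤ supN l :=
  Finset.le_sup (f := fun b => (l b).natAbs) (Finset.mem_univ b)

lemma supN_eq_zero {l : Fin d → ℤ} : supN l = 0 ↔ l = 0 := by
  rw [supN, ← Nat.bot_eq_zero, Finset.sup_eq_bot_iff]
  simp [funext_iff]

lemma exists_natAbs_eq_supN {l : Fin d → ℤ} (h : l ≠ 0) : ∃ b, (l b).natAbs = supN l := by
  have hne : (Finset.univ : Finset (Fin d)).Nonempty := by
    obtain ⟨b, _⟩ := Function.ne_iff.1 h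
    exact ⟨b, Finset.mem_univ b⟩
  obtain ⟨b, -, hb⟩ := Finset.exists_mem_eq_sup Finset.univ hne fun b => (l b).natAbs
  exact ⟨b, hb.symm⟩

lemma supN_sq_le_normSq (l : Fin d → ℤ) : (supN l : ℝ) ^ 2 ≤ normSq l := by
  by_cases h : l = 0
  · rw [supN_eq_zero.2 h]; simpa using normSq_nonneg l
  · obtain ⟨b, hb⟩ := exists_natAbs_eq_supN h
    rw [← hb, Nat.cast_natAbs, Int.cast_abs, sq_abs]
    exact Finset.single_le_sum (f := fun b => (l b : ℝ) ^ 2) (fun _ _ => sq_nonneg _)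
      (Finset.mem_univ b)

lemma one_le_normSq {l : Fin d → ℤ} (h : l ≠ 0) : 1 ≤ normSq l := by
  have h1 : 1 ≤ supN l := Nat.one_le_iff_ne_zero.2 (mt supN_eq_zero.1 h)
  have h2 : (1 : ℝ) ≤ supN l := by exact_mod_cast h1
  nlinarith [supN_sq_le_normSq l]

lemma normSq_pos {l : Fin d → ℤ} (h : l ≠ 0) : 0 < normSq l :=
  zero_lt_one.trans_le (one_le_normSq h)

/-- The number of lattice points of sup-norm `r`. -/
lemma card_shell_le (r : ℕ) (hr : r ≠ 0) (s : Finset (Fin d → ℤ)) (hs : ∀ l ∈ s, supN l = r) :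
    s.card ≤ 2 * d * 3 ^ d * r ^ (d - 1) := by
  classical
  let t : Fin d → Finset (Fin d → ℤ) := fun b => Fintype.piFinset
    fun j => if j = b then {(r : ℤ), -(r : ℤ)} else Finset.Icc (-(r : ℤ)) r
  have h1 : s ⊆ Finset.univ.biUnion t := by
    intro l hl
    have hl0 : l ≠ 0 := fun h => hr (by rw [← hs l hl, supN_eq_zero.2 h])
    obtain ⟨b, hb⟩ := exists_natAbs_eq_supN hl0
    rw [Finset.mem_biUnion]
    refine ⟨b, Finset.mem_univ b, Fintype.mem_piFinset.2 fun j => ?_⟩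
    have h2 := natAbs_le_supN l j
    rw [hs l hl] at h2 hb
    split_ifs with h
    · subst h; simp; omega
    · simp; omega
  have h2 : ∀ b, (t b).card ≤ 2 * (3 * r) ^ (d - 1) := by
    intro b
    rw [Fintype.card_piFinset, ← Finset.mul_prod_erase Finset.univ _ (Finset.mem_univ b)]
    simp only [if_true]
    refine Nat.mul_le_mul Finset.card_le_two ?_
    have h3 : ∀ j ∈ Finset.univ.erase b, (if j = b then ({(r : ℤ), -(r : ℤ)} : Finset ℤ) else
        Finset.Icc (-(r : ℤ)) r).card ≤ 3 * r := by
      intro j hj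
      rw [if_neg (Finset.ne_of_mem_erase hj), Int.card_Icc]
      omega
    refine (Finset.prod_le_pow_card _ _ _ h3).trans ?_
    simp
  calc s.card ≤ (Finset.univ.biUnion t).card := Finset.card_le_card h1
    _ ≤ ∑ b, (t b).card := Finset.card_biUnion_le
    _ ≤ ∑ b : Fin d, 2 * (3 * r) ^ (d - 1) := Finset.sum_le_sum fun b _ => h2 b
    _ = 2 * d * 3 ^ (d - 1) * r ^ (d - 1) := by simp [mul_pow]; ring
    _ ≤ _ := by gcongr; norm_num; omega

/-- Sums of functions of the sup-norm, reduced to one-dimensional sums. -/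
lemma tsum_supN_le (φ : ℕ → ℝ≥0∞) (h0 : φ 0 = 0) :
    ∑' l : Fin d → ℤ, φ (supN l) ≤
      (2 * d * 3 ^ d : ℕ) * ∑' r : ℕ, ((r + 1) ^ (d - 1) : ℕ) * φ (r + 1) := by
  rw [← (Equiv.sigmaFiberEquiv (supN (d := d))).tsum_eq, ENNReal.tsum_sigma', 
    tsum_eq_zero_add' ENNReal.summable, ← ENNReal.tsum_mul_left]
  have h1 : ∑' b : {l : Fin d → ℤ // supN l = 0},
      φ (supN ((Equiv.sigmaFiberEquiv (supN (d := d))) ⟨0, b⟩)) = 0 := by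
    rw [ENNReal.tsum_eq_zero]
    rintro ⟨l, hl⟩
    simp [Equiv.sigmaFiberEquiv, hl, h0]
  rw [h1, zero_add]
  refine ENNReal.tsum_le_tsum fun r => ?_
  rw [ENNReal.tsum_eq_iSup_sum]
  refine iSup_le fun s => ?_
  have h2 : ∀ x ∈ s, φ (supN ((Equiv.sigmaFiberEquiv (supN (d := d))) ⟨r + 1, x⟩)) = φ (r + 1) :=
    fun x _ => congrArg φ x.2
  rw [Finset.sum_congr rfl h2, Finset.sum_const, nsmul_eq_mul, ← mul_assoc, ← Nat.cast_mul]
  gcongr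
  have h3 := card_shell_le (d := d) (r + 1) (by omega) (s.map (Function.Embedding.subtype _))
    (fun l hl => by
      obtain ⟨x, -, rfl⟩ := Finset.mem_map.1 hl
      exact x.2)
  simpa using h3

/-- Comparison with a telescoping sum. -/
lemma tsum_inv_sq_add_sq_le {X : ℝ} (hX : 0 < X) :
    ∑' r : ℕ, ENNReal.ofReal (1 / (X ^ 2 + ((r : ℝ) + 1) ^ 2)) ≤ ENNReal.ofReal (2 / X) := by
  refine ENNReal.tsum_le_of_sum_range_le fun M => ?_
  rw [← ENNReal.ofReal_sum_of_nonneg fun _ _ => by positivity]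
  refine ENNReal.ofReal_le_ofReal ?_
  have h : ∑ r ∈ Finset.range M, 1 / (X ^ 2 + ((r : ℝ) + 1) ^ 2) ≤ 2 / X - 2 / (X + M) := by
    induction M with
    | zero => simp
    | succ M ih =>
      rw [Finset.sum_range_succ]
      have h1 : 1 / (X ^ 2 + ((M : ℝ) + 1) ^ 2) ≤ 2 / (X + M) - 2 / (X + (M + 1)) := by
        rw [div_sub_div _ _ (by positivity) (by positivity), div_le_div_iff₀ (by positivity)
          (by positivity)]
        nlinarith [sq_nonneg (X - (M + 1)), hX, (Nat.cast_nonneg M : (0 : ℝ) ≤ M)]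
      push_cast
      linarith
  have : 0 ≤ 2 / (X + M) := by positivity
  linarith

lemma tsum_inv_normSq_le (R : ℕ) :
    ∑' l : Fin d → ℤ, (if l ≠ 0 ∧ supN l ≤ R then ENNReal.ofReal (1 / normSq l) else 0) ≤
      (2 * d * 3 ^ d : ℕ) *
        ENNReal.ofReal (∑ r ∈ Finset.range R, ((r : ℝ) + 1) ^ (d - 1) / ((r : ℝ) + 1) ^ 2) := by
  have h := tsum_supN_le (d := d)
    (fun r => if r ≠ 0 ∧ r ≤ R then ENNReal.ofReal (1 / (r : ℝ) ^ 2) else 0) (by simp)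
  refine (ENNReal.tsum_le_tsum fun l => ?_).trans (h.trans ?_)
  · by_cases hl : l = 0
    · simp [hl]
    · have h1 : supN l ≠ 0 := mt supN_eq_zero.1 hl
      have h2 : (0 : ℝ) < supN l := by positivity
      by_cases hR : supN l ≤ R
      · rw [if_pos ⟨hl, hR⟩, if_pos ⟨h1, hR⟩]
        exact ENNReal.ofReal_le_ofReal
          (one_div_le_one_div_of_le (by positivity) (supN_sq_le_normSq l))
      · simp [hR]
  · gcongr
    rw [tsum_eq_sum (s := Finset.range R), ENNReal.ofReal_sum_of_nonneg fun _ _ => by positivity]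
    · refine Finset.sum_le_sum fun r hr => ?_
      rw [Finset.mem_range] at hr
      rw [if_pos ⟨by omega, by omega⟩, ← ENNReal.ofReal_natCast,
        ← ENNReal.ofReal_mul (by positivity)]
      refine ENNReal.ofReal_le_ofReal (le_of_eq ?_)
      push_cast
      ring
    · intro r hr
      rw [Finset.mem_range] at hr
      rw [if_neg (by omega), mul_zero]

lemma coupling_sq_of_three_le (hd : 3 ≤ d) {ε : ℝ} (hε : 0 < ε) :
    coupling d ε ^ 2 = ε ^ (d - 2) := by
  rw [coupling, if_neg (by omega), ← Real.rpow_natCast, ← Real.rpow_mul hε.le, ← Real.rpow_natCast]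
  congr 1
  rw [Nat.cast_sub (by omega)]
  push_cast
  ring

lemma coupling_two_sq {ε : ℝ} (hε : 0 < ε) (hε1 : ε < 1) :
    coupling 2 ε ^ 2 = 1 / (2 * Real.log (1 / ε)) := by
  have h : 0 < Real.log (1 / ε) := Real.log_pos ((one_lt_div hε).2 hε1)
  have h2 : Real.log (ε ^ (-2 : ℤ)) = 2 * Real.log (1 / ε) := by
    rw [Real.log_zpow, one_div, Real.log_inv]; push_cast; ring
  rw [coupling, if_pos rfl, h2, div_pow, Real.sq_sqrt (by positivity), one_pow]

/-- The modes allowed by the cut-off, up to a constant factor in the scale. -/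
def Allowed (ε : ℝ) (l : Fin d → ℤ) : Prop := l ≠ 0 ∧ ε * supN l ≤ 1

instance (ε : ℝ) (l : Fin d → ℤ) : Decidable (Allowed ε l) := Classical.dec _

/-- The coupling constant compensates the divergence of the sum of the inverse squares over the
modes allowed by the cut-off. -/
lemma exists_coupling_sum_le (hd : 2 ≤ d) :
    ∃ C : ℝ, 0 < C ∧ ∀ ε : ℝ, 0 < ε → ε < 1 → (d = 2 → ε ≤ 1 / 2) →
      ENNReal.ofReal (coupling d ε ^ 2) * ∑' l : Fin d → ℤ,
        (if Allowed ε l then ENNReal.ofReal (1 / normSq l) else 0) ≤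
          ENNReal.ofReal C := by
  refine ⟨(2 * d * 3 ^ d : ℕ) * 2, by positivity, fun ε hε hε1 hε2 => ?_⟩
  have h1 : ∀ l : Fin d → ℤ, ε * supN l ≤ 1 ↔ supN l ≤ ⌊1 / ε⌋₊ := fun l => by
    rw [Nat.le_floor_iff (by positivity), le_div_iff₀ hε, mul_comm]
  have h0 : ∀ l : Fin d → ℤ, (if Allowed ε l then ENNReal.ofReal (1 / normSq l) else 0) =
      if l ≠ 0 ∧ supN l ≤ ⌊1 / ε⌋₊ then ENNReal.ofReal (1 / normSq l) else 0 :=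
    fun l => if_congr (and_congr_right fun _ => h1 l) rfl rfl
  simp_rw [h0]
  refine (mul_le_mul_right (tsum_inv_normSq_le _) _).trans ?_
  set R := ⌊1 / ε⌋₊ with hR
  have hR1 : (R : ℝ) ≤ 1 / ε := Nat.floor_le (by positivity)
  rw [← ENNReal.ofReal_natCast, ← ENNReal.ofReal_mul (by positivity),
    ← ENNReal.ofReal_mul (by positivity)]
  refine ENNReal.ofReal_le_ofReal ?_
  rw [mul_left_comm]
  gcongr
  rcases hd.eq_or_lt with rfl | hd3
  · rw [coupling_two_sq hε hε1]
    have hlog : Real.log 2 ≤ Real.log (1 / ε) := by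
      refine Real.log_le_log (by norm_num) ?_
      rw [le_div_iff₀ hε]; linarith [hε2 rfl]
    have hl2 := Real.log_two_gt_d9
    have h2 : ∑ r ∈ Finset.range R, ((r : ℝ) + 1) ^ (2 - 1) / ((r : ℝ) + 1) ^ 2 ≤
        1 + Real.log R := by
      refine le_trans (le_of_eq ?_) (harmonic_le_one_add_log R)
      rw [harmonic]
      push_cast
      refine Finset.sum_congr rfl fun r _ => ?_
      field_simp
    have h3 : Real.log R ≤ Real.log (1 / ε) := by
      rcases Nat.eq_zero_or_pos R with h0 | h0
      · rw [h0]; simp only [Nat.cast_zero, Real.log_zero]; linarith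
      · exact Real.log_le_log (by exact_mod_cast h0) hR1
    rw [one_div_mul_eq_div, div_le_iff₀ (by linarith)]
    linarith
  · rw [coupling_sq_of_three_le hd3 hε]
    have h2 : ∑ r ∈ Finset.range R, ((r : ℝ) + 1) ^ (d - 1) / ((r : ℝ) + 1) ^ 2 ≤
        ∑ r ∈ Finset.range R, (R : ℝ) ^ (d - 3) := by
      refine Finset.sum_le_sum fun r hr => ?_
      rw [Finset.mem_range] at hr
      have h3 : ((r : ℝ) + 1) ≤ R := by exact_mod_cast hr
      rw [div_le_iff₀ (by positivity), show d - 1 = (d - 3) + 2 by omega, pow_add]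
      gcongr
    rw [Finset.sum_const, Finset.card_range, nsmul_eq_mul, ← pow_succ',
      show d - 3 + 1 = d - 2 by omega] at h2
    calc _ ≤ ε ^ (d - 2) * (1 / ε) ^ (d - 2) := by
          gcongr
          exact h2.trans (by gcongr)
      _ = 1 := by rw [← mul_pow, mul_one_div_cancel hε.ne', one_pow]
      _ ≤ 2 := by norm_num

lemma finite_supN_le (R : ℝ) : {l : Fin d → ℤ | (supN l : ℝ) ≤ R}.Finite := by
  refine (Set.Finite.pi' (fun _ : Fin d => Set.finite_Icc (-⌈R⌉) ⌈R⌉)).subset fun l hl b => ?_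
  have h1 : ((l b).natAbs : ℝ) ≤ R := le_trans (by exact_mod_cast natAbs_le_supN l b) hl
  rw [Nat.cast_natAbs, Int.cast_abs, abs_le] at h1
  have h2 := Int.le_ceil R
  constructor
  · have : (-(⌈R⌉ : ℤ) : ℝ) ≤ l b := by linarith [h1.1]
    exact_mod_cast this
  · have : (l b : ℝ) ≤ ⌈R⌉ := by linarith [h1.2]
    exact_mod_cast this

/-- In two dimensions, the weighted kernel `X / (|y| (X² + |y|²))` has bounded sums. -/
lemma tsum_schur_le {X : ℝ} (hX : 0 < X) :
    ∑' y : Fin 2 → ℤ, (if y ≠ 0 then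
      ENNReal.ofReal (X / (Real.sqrt (normSq y) * (X ^ 2 + normSq y))) else 0) ≤ 72 := by
  have h := tsum_supN_le (d := 2)
    (fun r => if r ≠ 0 then ENNReal.ofReal (X / (r * (X ^ 2 + (r : ℝ) ^ 2))) else 0) (by simp)
  refine (ENNReal.tsum_le_tsum fun l => ?_).trans (h.trans ?_)
  · by_cases hl : l = 0
    · simp [hl]
    · have h1 : supN l ≠ 0 := mt supN_eq_zero.1 hl
      have h2 : (0 : ℝ) < supN l := by positivity
      rw [if_pos hl, if_pos h1]
      have h3 := supN_sq_le_normSq l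
      have h4 : (supN l : ℝ) ≤ Real.sqrt (normSq l) := Real.le_sqrt_of_sq_le h3
      exact ENNReal.ofReal_le_ofReal (by gcongr)
  · have h5 : ∀ r : ℕ, (((r + 1) ^ (2 - 1) : ℕ) : ℝ≥0∞) * (if r + 1 ≠ 0 then
        ENNReal.ofReal (X / ((r + 1 : ℕ) * (X ^ 2 + ((r + 1 : ℕ) : ℝ) ^ 2))) else 0) =
        ENNReal.ofReal X * ENNReal.ofReal (1 / (X ^ 2 + ((r : ℝ) + 1) ^ 2)) := by
      intro r
      rw [if_pos (by omega), ← ENNReal.ofReal_natCast, ← ENNReal.ofReal_mul (by positivity),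
        ← ENNReal.ofReal_mul (by positivity)]
      congr 1
      push_cast
      field_simp
    simp_rw [h5]
    rw [ENNReal.tsum_mul_left]
    calc _ ≤ ((2 * 2 * 3 ^ 2 : ℕ) : ℝ≥0∞) * (ENNReal.ofReal X * ENNReal.ofReal (2 / X)) := by
          gcongr
          exact tsum_inv_sq_add_sq_le hX
      _ = 72 := by
          rw [← ENNReal.ofReal_mul hX.le, mul_div_cancel₀ _ hX.ne']
          norm_num

/-- The sum over the plane lattice of the kernel `K / (|l|² + K²)^(3/2)` is bounded. -/
lemma tsum_kernel_le {K : ℝ} (hK : 1 ≤ K) :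
    ∑' l : Fin 2 → ℤ, ENNReal.ofReal (K / Real.sqrt (normSq l + K ^ 2) ^ 3) ≤ 73 := by
  have hK0 : 0 < K := by linarith
  have h0 : ∀ l : Fin 2 → ℤ, ENNReal.ofReal (K / Real.sqrt (normSq l + K ^ 2) ^ 3) ≤
      (if l = 0 then 1 else 0) + (if l ≠ 0 then
      ENNReal.ofReal (K / (Real.sqrt (normSq l) * (K ^ 2 + normSq l))) else 0) := by
    intro l
    by_cases hl : l = 0
    · subst hl
      simp only [normSq, Pi.zero_apply, Int.cast_zero, if_true, ne_eq, not_true_eq_false, if_false,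
        add_zero]
      norm_num
      rw [Real.sqrt_sq hK0.le, div_le_one (by positivity)]
      exact le_self_pow₀ hK (by norm_num)
    · rw [if_neg hl, if_pos hl, zero_add]
      refine ENNReal.ofReal_le_ofReal ?_
      have h1 := normSq_pos hl
      have h2 : Real.sqrt (normSq l + K ^ 2) ^ 3 =
          Real.sqrt (normSq l + K ^ 2) * (K ^ 2 + normSq l) := by
        rw [pow_succ', Real.sq_sqrt (by positivity)]; ring
      rw [h2]
      have h3 : Real.sqrt (normSq l) ≤ Real.sqrt (normSq l + K ^ 2) :=
        Real.sqrt_le_sqrt (by nlinarith)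
      have h4 : 0 < Real.sqrt (normSq l) := Real.sqrt_pos.2 h1
      gcongr
  refine (ENNReal.tsum_le_tsum h0).trans ?_
  rw [ENNReal.tsum_add, tsum_ite_eq]
  calc _ ≤ (1 : ℝ≥0∞) + 72 := by gcongr; exact tsum_schur_le hK0
    _ = 73 := by norm_num

end Lattice

/-! ### The weighted creation operator -/

section Weighted

variable {d n : ℕ}

/-- The multiplier `(-𝓛₀)^(1/2)`. -/
def hroot (k : Fin n → Fin d → ℤ) : ℝ := Real.sqrt (1 / 2 * modeSq k)

lemma modeSq_eq (k : Fin n → Fin d → ℤ) : modeSq k = ∑ a, normSq (k a) := rfl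

lemma modeSq_nonneg (k : Fin n → Fin d → ℤ) : 0 ≤ modeSq k :=
  Finset.sum_nonneg fun _ _ => normSq_nonneg _

lemma normSq_le_modeSq (k : Fin n → Fin d → ℤ) (a : Fin n) : normSq (k a) ≤ modeSq k :=
  Finset.single_le_sum (f := fun a => normSq (k a)) (fun _ _ => normSq_nonneg _)
    (Finset.mem_univ a)

lemma normSq_add_normSq_le_modeSq (k : Fin n → Fin d → ℤ) {a b : Fin n} (h : a ≠ b) :
    normSq (k a) + normSq (k b) ≤ modeSq k := by
  rw [← Finset.sum_pair h (f := fun a => normSq (k a))]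
  exact Finset.sum_le_sum_of_subset_of_nonneg (Finset.subset_univ _)
    fun _ _ _ => normSq_nonneg _

lemma hroot_nonneg (k : Fin n → Fin d → ℤ) : 0 ≤ hroot k := Real.sqrt_nonneg _

lemma hroot_sq (k : Fin n → Fin d → ℤ) : hroot k ^ 2 = 1 / 2 * modeSq k :=
  Real.sq_sqrt (by have := modeSq_nonneg k; positivity)

lemma modeSq_comp (k : Fin n → Fin d → ℤ) (σ : Equiv.Perm (Fin n)) :
    modeSq (k ∘ σ) = modeSq k :=
  Equiv.sum_comp σ fun a => normSq (k a)

lemma hroot_comp (k : Fin n → Fin d → ℤ) (σ : Equiv.Perm (Fin n)) :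
    hroot (k ∘ σ) = hroot k := by
  rw [hroot, modeSq_comp, hroot]

lemma hroot_eq_zero {k : Fin n → Fin d → ℤ} : hroot k = 0 ↔ k = 0 := by
  constructor
  · intro h
    have h1 := hroot_sq k
    rw [h] at h1
    funext a
    by_contra ha
    have := normSq_pos ha
    have := normSq_le_modeSq k a
    norm_num at h1
    linarith
  · rintro rfl
    simp [hroot, modeSq]

lemma half_le_hroot_sq {k : Fin n → Fin d → ℤ} (h : k ≠ 0) : 1 / 2 ≤ hroot k ^ 2 := by
  obtain ⟨a, ha⟩ := Function.ne_iff.1 h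
  rw [hroot_sq]
  linarith [one_le_normSq ha, normSq_le_modeSq k a]

lemma dot_sq_le (w : Fin d → ℝ) (l : Fin d → ℤ) : dot w l ^ 2 ≤ (∑ b, w b ^ 2) * normSq l :=
  Finset.sum_mul_sq_le_sq_mul_sq _ _ _

lemma supN_le_cutoffNorm (l : Fin d → ℤ) : (supN l : ℝ) ≤ cutoffNorm l := by
  unfold cutoffNorm
  split_ifs with h
  · exact Real.le_sqrt_of_sq_le (supN_sq_le_normSq l)
  · by_cases hl : l = 0
    · rw [supN_eq_zero.2 hl]; simp
    · obtain ⟨b, hb⟩ := exists_natAbs_eq_supN hl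
      rw [← hb, Nat.cast_natAbs, Int.cast_abs]
      exact norm_le_pi_norm (fun b => (l b : ℝ)) b

lemma cutoffNorm_zero : cutoffNorm (0 : Fin d → ℤ) = 0 := by
  unfold cutoffNorm
  split_ifs
  · simp
  · simpa using pi_norm_const_le (ι := Fin d) (0 : ℝ)

lemma cutoff_ne_zero {ε : ℝ} (hε : 0 < ε) {l m : Fin d → ℤ} (h : cutoff ε l m ≠ 0) :
    Allowed ε l ∧ Allowed ε m ∧ Allowed ε (l + m) := by
  unfold cutoff at h
  have key : ∀ l : Fin d → ℤ, 0 < ε * cutoffNorm l ∧ ε * cutoffNorm l ≤ 1 → Allowed ε l := by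
    intro l hl
    refine ⟨?_, (mul_le_mul_of_nonneg_left (supN_le_cutoffNorm l) hε.le).trans hl.2⟩
    rintro rfl
    simp [cutoffNorm_zero] at hl
  split_ifs at h with h1
  · exact ⟨key _ h1.1, key _ h1.2.1, key _ h1.2.2⟩
  · exact absurd rfl h

lemma cutoff_sq_le_one (ε : ℝ) (l m : Fin d → ℤ) : cutoff ε l m ^ 2 ≤ 1 := by
  unfold cutoff; split_ifs <;> norm_num

lemma cutoff_mul_self (ε : ℝ) (l m : Fin d → ℤ) : cutoff ε l m * cutoff ε l m = cutoff ε l m := by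
  unfold cutoff; split_ifs <;> norm_num

lemma finite_allowed {ε : ℝ} (hε : 0 < ε) : {l : Fin d → ℤ | Allowed ε l}.Finite :=
  (finite_supN_le (1 / ε)).subset fun l hl => by
    rw [Set.mem_ofPred_eq, le_div_iff₀ hε, mul_comm]
    exact hl.2

/-- The numerical constant of the creation and annihilation operators. -/
def vconst (d : ℕ) : ℂ := -(Complex.I / (((2 * Real.pi) ^ ((d : ℝ) / 2) : ℝ) : ℂ))

/-- The coefficients of the creation operator from chaos `n` to chaos `n + 1`, in coordinates in which
the Fock norm is the `ℓ²` norm, multiplied by the weights `α` on the left and `β` on the right. -/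
def coef (w : Fin d → ℝ) (ε : ℝ) (α : (Fin (n + 1) → Fin d → ℤ) → ℝ)
    (β : (Fin n → Fin d → ℤ) → ℝ) (b : Fin (n + 1)) (a : Fin n) (k : Fin (n + 1) → Fin d → ℤ) : ℂ :=
  vconst d * ((coupling d ε / Real.sqrt (n + 1) * (α k * vertex w ε (k (b.succAbove a)) (k b) *
    β (fuse b a k)) : ℝ) : ℂ)

lemma fuse_apply_same (b : Fin (n + 1)) (a : Fin n) (k : Fin (n + 1) → Fin d → ℤ) :
    fuse b a k a = k (b.succAbove a) + k b := by simp [fuse]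

/-- Boundedness of the weighted creation operator. The factor `1 / |k_b|²` is summed over the
splittings, where the coupling constant compensates the sum. -/
lemma sqNorm_pairOp_coef_le {w : Fin d → ℝ} {ε C : ℝ} (hε : 0 < ε)
    (hC : ENNReal.ofReal (coupling d ε ^ 2) * ∑' l : Fin d → ℤ,
      (if Allowed ε l then ENNReal.ofReal (1 / normSq l) else 0) ≤ ENNReal.ofReal C)
    {α : (Fin (n + 1) → Fin d → ℤ) → ℝ} {β : (Fin n → Fin d → ℤ) → ℝ} {P : ℝ≥0∞}
    (hα : ∀ k, (∑ b, ∑ _ : Fin n, if Allowed ε (k b) then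
      ENNReal.ofReal (α k ^ 2 * normSq (k b)) else 0) ≤ P)
    (y : (Fin n → Fin d → ℤ) → ℂ) :
    sqNorm (pairOp (coef w ε α β) y) ≤ P * ENNReal.ofReal (‖vconst d‖ ^ 2 * C) *
      ∑' k, (∑ a, if Allowed ε (k a) then ENNReal.ofReal (dot w (k a) ^ 2 * β k ^ 2) else 0) *
        ‖y k‖ₑ ^ 2 := by
  refine sqNorm_pairOp_le (ρ := fun b a k => if Allowed ε (k b) then
      ENNReal.ofReal (α k ^ 2 * normSq (k b)) else 0)
    (τ := fun b a k => ENNReal.ofReal (‖vconst d‖ ^ 2 / (n + 1)) * 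
      (ENNReal.ofReal (coupling d ε ^ 2) *
      (if Allowed ε (k b) then ENNReal.ofReal (1 / normSq (k b)) else 0)) *
      (if Allowed ε (fuse b a k a) then
        ENNReal.ofReal (dot w (fuse b a k a) ^ 2 * β (fuse b a k) ^ 2) else 0))
    (fun b a k => ?_) hα (fun k => ?_) y
  · by_cases h0 : cutoff ε (k (b.succAbove a)) (k b) = 0
    · simp [coef, vertex, h0]
    · obtain ⟨-, h2, h3⟩ := cutoff_ne_zero hε h0
      have h3' : Allowed ε (fuse b a k a) := by rwa [fuse_apply_same]
      simp only [if_pos h2, if_pos h3']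
      have hn := normSq_pos h2.1
      rw [← ofReal_norm, ← ENNReal.ofReal_pow (norm_nonneg _),
        ← ENNReal.ofReal_mul (by positivity), ← ENNReal.ofReal_mul (by positivity),
        ← ENNReal.ofReal_mul (by positivity), ← ENNReal.ofReal_mul (by positivity)]
      refine ENNReal.ofReal_le_ofReal ?_
      rw [coef, norm_mul, mul_pow, Complex.norm_real, Real.norm_eq_abs, sq_abs, fuse_apply_same,
        vertex]
      have h5 : (coupling d ε / Real.sqrt (n + 1)) ^ 2 = coupling d ε ^ 2 / (n + 1) := by
        rw [div_pow, Real.sq_sqrt (by positivity)]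
      calc _ = ‖vconst d‖ ^ 2 * ((coupling d ε / Real.sqrt (n + 1)) ^ 2 * (α k ^ 2 *
            dot w (k (b.succAbove a) + k b) ^ 2 * β (fuse b a k) ^ 2) *
            cutoff ε (k (b.succAbove a)) (k b) ^ 2) := by ring
        _ ≤ ‖vconst d‖ ^ 2 * ((coupling d ε / Real.sqrt (n + 1)) ^ 2 * (α k ^ 2 *
            dot w (k (b.succAbove a) + k b) ^ 2 * β (fuse b a k) ^ 2) * 1) := by
            gcongr
            exact cutoff_sq_le_one _ _ _
        _ = _ := by rw [h5]; field_simp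
  · simp only [fuse_split, split_apply_same]
    simp_rw [ENNReal.tsum_mul_right, ENNReal.tsum_mul_left, ← Finset.mul_sum]
    rw [Finset.sum_const, Finset.card_univ, Fintype.card_fin, nsmul_eq_mul, ← mul_assoc]
    refine mul_le_mul' ?_ le_rfl
    have h1 : ((n + 1 : ℕ) : ℝ≥0∞) *
        (ENNReal.ofReal (‖vconst d‖ ^ 2 / (n + 1)) * ENNReal.ofReal C) =
        ENNReal.ofReal (‖vconst d‖ ^ 2 * C) := by
      rw [← mul_assoc, ← ENNReal.ofReal_natCast, ← ENNReal.ofReal_mul (by positivity),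
        ← ENNReal.ofReal_mul (by positivity)]
      congr 1
      push_cast
      field_simp
    rw [← h1]
    refine (mul_comm _ _).le.trans ?_
    exact mul_le_mul' le_rfl (mul_le_mul' le_rfl hC)

lemma vconst_def (d : ℕ) : -(Complex.I / (((2 * Real.pi) ^ ((d : ℝ) / 2) : ℝ) : ℂ)) = vconst d :=
  rfl

lemma conj_vconst (d : ℕ) : (starRingEnd ℂ) (vconst d) = -vconst d := by
  simp [vconst, neg_div]

lemma sqrt_factorial_succ' (n : ℕ) : (Real.sqrt (n + 1).factorial : ℂ) =
    Real.sqrt (n + 1) * (Real.sqrt n.factorial : ℂ) := by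
  rw [Nat.factorial_succ, Nat.cast_mul, Real.sqrt_mul (by positivity)]
  push_cast
  rfl

lemma sqrt_factorial_succ (n : ℕ) : (Real.sqrt (n + 1).factorial : ℂ) / (n + 1) =
    (Real.sqrt n.factorial : ℂ) / Real.sqrt (n + 1) := by
  rw [Nat.factorial_succ, Nat.cast_mul, Real.sqrt_mul (by positivity)]
  have h2 : (Real.sqrt (n + 1) : ℂ) ^ 2 = n + 1 := by
    rw [← Complex.ofReal_pow, Real.sq_sqrt (by positivity)]; push_cast; rfl
  have h3 : (Real.sqrt (n + 1) : ℂ) ≠ 0 := by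
    rw [Complex.ofReal_ne_zero]; positivity
  push_cast
  rw [← h2]
  field_simp

lemma creation_eq_pairOp (w : Fin d → ℝ) (ε : ℝ) (f : Kernels d) (hf : Symm (f n))
    (α : (Fin (n + 1) → Fin d → ℤ) → ℝ) {β : (Fin n → Fin d → ℤ) → ℝ}
    {g : (Fin n → Fin d → ℤ) → ℂ} (hg : ∀ k, (Real.sqrt n.factorial : ℂ) * f n k = β k * g k)
    (k : Fin (n + 1) → Fin d → ℤ) :
    ((Real.sqrt (n + 1).factorial * α k : ℝ) : ℂ) * creation w ε f (n + 1) k =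
      pairOp (coef w ε α β) g k := by
  have h1 := sqrt_factorial_succ n
  rw [creation_succ w ε f hf, vconst_def]
  simp only [pairOp, coef, Finset.mul_sum]
  refine Finset.sum_congr rfl fun b _ => Finset.sum_congr rfl fun a _ => ?_
  push_cast
  linear_combination (vconst d * coupling d ε * α k * (vertex w ε (k (b.succAbove a)) (k b)) *
    f n (fuse b a k)) * h1 + (vconst d * coupling d ε / Real.sqrt (n + 1) * α k *
      (vertex w ε (k (b.succAbove a)) (k b))) * hg (fuse b a k)

lemma annihilation_eq_pairAdj (w : Fin d → ℝ) (ε : ℝ) (f : Kernels d) (hf : Symm (f (n + 1)))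
    {α : (Fin (n + 1) → Fin d → ℤ) → ℝ} (β : (Fin n → Fin d → ℤ) → ℝ)
    {g : (Fin (n + 1) → Fin d → ℤ) → ℂ}
    (hg : ∀ k, (Real.sqrt (n + 1).factorial : ℂ) * f (n + 1) k = α k * g k)
    (k : Fin n → Fin d → ℤ) :
    ((Real.sqrt n.factorial * β k : ℝ) : ℂ) * annihilation w ε f n k =
      -pairAdj (coef w ε α β) g k := by
  have h1 := sqrt_factorial_succ' n
  have hn : (n : ℂ) + 1 ≠ 0 := by exact_mod_cast Nat.succ_ne_zero n
  have h2 : ∀ b a l, (starRingEnd ℂ) (coef w ε α β b a (split b a l k)) * g (split b a l k) =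
      -(vconst d * (coupling d ε / Real.sqrt (n + 1) * β k) *
        Real.sqrt (n + 1).factorial) *
        (((vertex w ε (k a - l) l : ℝ) : ℂ) * f (n + 1) (split 0 a l k)) := by
    intro b a l
    rw [coef, fuse_split, map_mul, conj_vconst, Complex.conj_ofReal, split_apply_same,
      split_apply_succAbove, Function.update_self, ← hf.split_eq b]
    push_cast
    linear_combination (vconst d * (coupling d ε / Real.sqrt (n + 1) * β k) *
      (vertex w ε (k a - l) l)) * hg (split b a l k)
  simp only [pairAdj, h2, tsum_mul_left, ← Finset.mul_sum]
  rw [annihilation_apply, vconst_def, Finset.sum_const, Finset.card_univ, Fintype.card_fin,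
    nsmul_eq_mul]
  push_cast
  field_simp
  linear_combination (-(β k : ℂ) * vconst d * coupling d ε *
    ∑ x, ∑' l, (vertex w ε (k x - l) l : ℂ) * f (n + 1) (split 0 x l k)) * h1

end Weighted

section Operator

variable {d n : ℕ}

/-- The multiplier `(-𝓛₀)^(-1/2)`, which vanishes at the zero mode. -/
def hinv (k : Fin n → Fin d → ℤ) : ℝ := (hroot k)⁻¹

lemma hinv_nonneg (k : Fin n → Fin d → ℤ) : 0 ≤ hinv k := inv_nonneg.2 (hroot_nonneg k)

lemma hinv_comp (k : Fin n → Fin d → ℤ) (σ : Equiv.Perm (Fin n)) : hinv (k ∘ σ) = hinv k := by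
  rw [hinv, hroot_comp, hinv]

lemma hinv_sq (k : Fin n → Fin d → ℤ) : hinv k ^ 2 = 2 / modeSq k := by
  rw [hinv, inv_pow, hroot_sq, mul_inv, one_div, inv_inv, div_eq_mul_inv]

lemma modeSq_mul_hinv_sq_le (k : Fin n → Fin d → ℤ) : modeSq k * hinv k ^ 2 ≤ 2 := by
  rw [hinv_sq, mul_div_left_comm]
  exact mul_le_of_le_one_right (by norm_num) (div_self_le_one _)

lemma normSq_le_supN (l : Fin d → ℤ) : normSq l ≤ d * (supN l : ℝ) ^ 2 := by
  calc normSq l ≤ ∑ _ : Fin d, (supN l : ℝ) ^ 2 := by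
        refine Finset.sum_le_sum fun b _ => ?_
        have h : ((l b).natAbs : ℝ) ≤ supN l := by exact_mod_cast natAbs_le_supN l b
        rw [Nat.cast_natAbs, Int.cast_abs] at h
        rw [← sq_abs]
        gcongr
    _ = _ := by simp

lemma Allowed.normSq_le {ε : ℝ} (hε : 0 < ε) {l : Fin d → ℤ} (h : Allowed ε l) :
    normSq l ≤ d * (1 / ε) ^ 2 := by
  refine (normSq_le_supN l).trans ?_
  gcongr
  rw [le_div_iff₀ hε, mul_comm]
  exact h.2

lemma sum_dot_sq_le (w : Fin d → ℝ) (k : Fin n → Fin d → ℤ) :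
    ∑ a, dot w (k a) ^ 2 ≤ (∑ b, w b ^ 2) * modeSq k := by
  rw [modeSq_eq, Finset.mul_sum]
  exact Finset.sum_le_sum fun a _ => dot_sq_le w (k a)

variable {w : Fin d → ℝ} {ε C : ℝ}

lemma weight_sum_hinv_le (k : Fin (n + 1) → Fin d → ℤ) :
    (∑ b, ∑ _ : Fin n, if Allowed ε (k b) then ENNReal.ofReal (hinv k ^ 2 * normSq (k b)) else 0) ≤
      ENNReal.ofReal (2 * n) := by
  calc _ ≤ ∑ b, ∑ _ : Fin n, ENNReal.ofReal (hinv k ^ 2 * normSq (k b)) := by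
        refine Finset.sum_le_sum fun b _ => Finset.sum_le_sum fun a _ => ?_
        split_ifs
        · exact le_rfl
        · exact zero_le
    _ = ENNReal.ofReal (n * (modeSq k * hinv k ^ 2)) := by
        simp only [Finset.sum_const, Finset.card_univ, Fintype.card_fin, nsmul_eq_mul]
        rw [← Finset.mul_sum, ENNReal.ofReal_mul (by positivity), ENNReal.ofReal_natCast,
          ← ENNReal.ofReal_sum_of_nonneg
            (fun b _ => mul_nonneg (sq_nonneg _) (normSq_nonneg _)), ← Finset.mul_sum, modeSq_eq,
          mul_comm (hinv k ^ 2)]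
    _ ≤ _ := by
        refine ENNReal.ofReal_le_ofReal ?_
        rw [mul_comm 2 (n : ℝ)]
        gcongr
        exact modeSq_mul_hinv_sq_le k

lemma dot_sum_hinv_le (k : Fin n → Fin d → ℤ) :
    (∑ a, if Allowed ε (k a) then ENNReal.ofReal (dot w (k a) ^ 2 * hinv k ^ 2) else 0) ≤
      ENNReal.ofReal (2 * ∑ b, w b ^ 2) := by
  calc _ ≤ ∑ a, ENNReal.ofReal (dot w (k a) ^ 2 * hinv k ^ 2) := by
        refine Finset.sum_le_sum fun a _ => ?_
        split_ifs
        · exact le_rfl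
        · exact zero_le
    _ = ENNReal.ofReal ((∑ a, dot w (k a) ^ 2) * hinv k ^ 2) := by
        rw [← ENNReal.ofReal_sum_of_nonneg (fun b _ => by positivity), Finset.sum_mul]
    _ ≤ _ := by
        refine ENNReal.ofReal_le_ofReal ?_
        calc _ ≤ (∑ b, w b ^ 2) * modeSq k * hinv k ^ 2 := by
              gcongr
              exact sum_dot_sq_le w k
          _ = (∑ b, w b ^ 2) * (modeSq k * hinv k ^ 2) := by ring
          _ ≤ (∑ b, w b ^ 2) * 2 := by
              gcongr
              exact modeSq_mul_hinv_sq_le k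
          _ = _ := by ring

/-- The graded sector condition: the operator `(-𝓛₀)^(-1/2) 𝓐₊ (-𝓛₀)^(-1/2)` on chaos `n` has norm
of order `√n`, uniformly in the scale. -/
lemma sqNorm_pairOp_hinv_le (hε : 0 < ε)
    (hC : ENNReal.ofReal (coupling d ε ^ 2) * ∑' l : Fin d → ℤ,
      (if Allowed ε l then ENNReal.ofReal (1 / normSq l) else 0) ≤ ENNReal.ofReal C) (hC0 : 0 ≤ C)
    (y : (Fin n → Fin d → ℤ) → ℂ) :
    sqNorm (pairOp (coef w ε hinv hinv) y) ≤
      ENNReal.ofReal (4 * ‖vconst d‖ ^ 2 * C * (∑ b, w b ^ 2) * n) * sqNorm y := by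
  refine (sqNorm_pairOp_coef_le hε hC (weight_sum_hinv_le) y).trans ?_
  calc _ ≤ ENNReal.ofReal (2 * n) * ENNReal.ofReal (‖vconst d‖ ^ 2 * C) *
        ∑' k, ENNReal.ofReal (2 * ∑ b, w b ^ 2) * ‖y k‖ₑ ^ 2 := by
        gcongr
        exact dot_sum_hinv_le _
    _ = _ := by
        rw [ENNReal.tsum_mul_left, ← sqNorm, ← mul_assoc, ← ENNReal.ofReal_mul (by positivity),
          ← ENNReal.ofReal_mul (by positivity)]
        ring_nf

/-- For a fixed scale, `(-𝓛₀)^(-1/2) 𝓐₊` is bounded on each chaos. -/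
lemma sqNorm_pairOp_hinv_one_lt_top (hε : 0 < ε)
    (hC : ENNReal.ofReal (coupling d ε ^ 2) * ∑' l : Fin d → ℤ,
      (if Allowed ε l then ENNReal.ofReal (1 / normSq l) else 0) ≤ ENNReal.ofReal C)
    {y : (Fin n → Fin d → ℤ) → ℂ} (hy : sqNorm y ≠ ⊤) :
    sqNorm (pairOp (coef w ε hinv fun _ => 1) y) ≠ ⊤ := by
  refine ((sqNorm_pairOp_coef_le hε hC (weight_sum_hinv_le) y).trans_lt ?_).ne
  have h : ∀ k : Fin n → Fin d → ℤ, (∑ a, if Allowed ε (k a) then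
      ENNReal.ofReal (dot w (k a) ^ 2 * 1 ^ 2) else 0) ≤
      n * ENNReal.ofReal ((∑ b, w b ^ 2) * (d * (1 / ε) ^ 2)) := by
    intro k
    calc _ ≤ ∑ _ : Fin n, ENNReal.ofReal ((∑ b, w b ^ 2) * (d * (1 / ε) ^ 2)) := by
          refine Finset.sum_le_sum fun a _ => ?_
          split_ifs with h
          · refine ENNReal.ofReal_le_ofReal ?_
            rw [one_pow, mul_one]
            refine (dot_sq_le w _).trans ?_
            gcongr
            exact h.normSq_le hε
          · exact zero_le
      _ = _ := by simp
  refine ENNReal.mul_lt_top (ENNReal.mul_lt_top ENNReal.ofReal_lt_top ENNReal.ofReal_lt_top) ?_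
  refine (ENNReal.tsum_le_tsum fun k => mul_le_mul' (h k) le_rfl).trans_lt ?_
  rw [ENNReal.tsum_mul_left]
  exact ENNReal.mul_lt_top (ENNReal.mul_lt_top (ENNReal.natCast_lt_top n) ENNReal.ofReal_lt_top)
    hy.lt_top

lemma coef_support_finite (hε : 0 < ε) (α : (Fin (n + 1) → Fin d → ℤ) → ℝ)
    (β : (Fin n → Fin d → ℤ) → ℝ) (b : Fin (n + 1)) (a : Fin n) (k' : Fin n → Fin d → ℤ) :
    {l | coef w ε α β b a (split b a l k') ≠ 0}.Finite := by
  refine (finite_allowed hε).subset fun l hl => ?_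
  by_contra h
  refine hl ?_
  have h0 : cutoff ε (split b a l k' (b.succAbove a)) (split b a l k' b) = 0 := by
    by_contra hc
    have := (cutoff_ne_zero hε hc).2.1
    rw [split_apply_same] at this
    exact h this
  rw [coef, vertex, h0]
  simp

/-- For a fixed scale, `(-𝓛₀)^(-1/2) 𝓐₋` is bounded on each chaos, being the adjoint of a bounded
operator. -/
lemma sqNorm_pairAdj_one_hinv_lt_top (hε : 0 < ε)
    (hC : ENNReal.ofReal (coupling d ε ^ 2) * ∑' l : Fin d → ℤ,
      (if Allowed ε l then ENNReal.ofReal (1 / normSq l) else 0) ≤ ENNReal.ofReal C)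
    {x : (Fin (n + 1) → Fin d → ℤ) → ℂ} (hx : sqNorm x ≠ ⊤) :
    sqNorm (pairAdj (coef w ε (fun _ => 1) hinv) x) ≠ ⊤ := by
  have hP : ∀ k : Fin (n + 1) → Fin d → ℤ, (∑ b, ∑ _ : Fin n, if Allowed ε (k b) then
      ENNReal.ofReal (1 ^ 2 * normSq (k b)) else 0) ≤
      ∑ _ : Fin (n + 1), ∑ _ : Fin n, ENNReal.ofReal (d * (1 / ε) ^ 2) := by
    intro k
    refine Finset.sum_le_sum fun b _ => Finset.sum_le_sum fun a _ => ?_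
    split_ifs with h
    · refine ENNReal.ofReal_le_ofReal ?_
      rw [one_pow, one_mul]
      exact h.normSq_le hε
    · exact zero_le
  have hb : ∀ y : (Fin n → Fin d → ℤ) → ℂ, sqNorm (pairOpLin (coef w ε (fun _ => 1) hinv) y) ≤
      ((∑ _ : Fin (n + 1), ∑ _ : Fin n, ENNReal.ofReal (d * (1 / ε) ^ 2)) *
        ENNReal.ofReal (‖vconst d‖ ^ 2 * C) * ENNReal.ofReal (2 * ∑ b, w b ^ 2)) * sqNorm y := by
    intro y
    refine (sqNorm_pairOp_coef_le hε hC hP y).trans ?_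
    rw [mul_assoc _ _ (sqNorm y), sqNorm, ← ENNReal.tsum_mul_left (f := fun k => ‖y k‖ₑ ^ 2)]
    gcongr
    exact dot_sum_hinv_le _
  obtain ⟨T, hT⟩ := exists_clm (pairOpLin (coef w ε (fun _ => 1) hinv))
    (ENNReal.mul_ne_top (ENNReal.mul_ne_top (by simp [ENNReal.mul_eq_top]) ENNReal.ofReal_ne_top)
      ENNReal.ofReal_ne_top) hb
  obtain ⟨x', rfl⟩ := exists_lp hx
  rw [← adjoint_pairOp (coef_support_finite hε _ _) T hT x']
  exact sqNorm_coe_ne_top _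

/-! ### Symmetric kernels with zero averages -/

/-- Symmetric kernels with zero average in each variable. -/
def SymMZ (x : (Fin n → Fin d → ℤ) → ℂ) : Prop := Symm x ∧ ∀ k, (∃ a, k a = 0) → x k = 0

lemma SymMZ.mul {x : (Fin n → Fin d → ℤ) → ℂ} (hx : SymMZ x) {α : (Fin n → Fin d → ℤ) → ℂ}
    (hα : Symm α) : SymMZ fun k => α k * x k :=
  ⟨fun σ k => by simp only [hα σ k, hx.1 σ k], fun k hk => by simp only [hx.2 k hk, mul_zero]⟩

lemma pairOp_coef_symMZ (hε : 0 < ε) {α : (Fin (n + 1) → Fin d → ℤ) → ℝ}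
    {β : (Fin n → Fin d → ℤ) → ℝ} (hα : Symm α) (hβ : Symm β) {x : (Fin n → Fin d → ℤ) → ℂ}
    (hx : SymMZ x) : SymMZ (pairOp (coef w ε α β) x) := by
  constructor
  · intro σ k
    have hF : Symm fun k => (β k : ℂ) * x k := fun σ k => by
      simp only [hβ σ k, hx.1 σ k]
    have h1 : ∀ k, pairOp (coef w ε α β) x k = vconst d *
        ((coupling d ε / Real.sqrt (n + 1) * α k : ℝ) : ℂ) * ∑ b, ∑ a : Fin n,
          (((vertex w ε (k (b.succAbove a)) (k b) : ℝ) : ℂ) *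
            mergeVal (fun k => (β k : ℂ) * x k) k b (b.succAbove a)) := by
      intro k
      simp only [pairOp, coef, mergeVal, ← fuse_eq_update_comp, Finset.mul_sum]
      refine Finset.sum_congr rfl fun b _ => Finset.sum_congr rfl fun a _ => ?_
      push_cast
      ring
    rw [h1, h1, hα]
    congr 1
    simp only [mergeVal_comp hF, Function.comp_apply]
    exact sum_succAbove_comp (fun b c => ((vertex w ε (k c) (k b) : ℝ) : ℂ) *
            mergeVal (fun k => (β k : ℂ) * x k) k b c) σ
  · rintro k ⟨c, hc⟩
    refine Finset.sum_eq_zero fun b _ => Finset.sum_eq_zero fun a _ => ?_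
    by_cases h0 : cutoff ε (k (b.succAbove a)) (k b) = 0
    · simp [coef, vertex, h0]
    · obtain ⟨h1, h2, -⟩ := cutoff_ne_zero hε h0
      rw [hx.2, mul_zero]
      rcases Fin.eq_self_or_eq_succAbove b c with rfl | ⟨j, rfl⟩
      · exact absurd hc h2.1
      · refine ⟨j, ?_⟩
        have : j ≠ a := by rintro rfl; exact h1.1 hc
        simp [fuse, this, hc]

lemma pairAdj_coef_eq {α : (Fin (n + 1) → Fin d → ℤ) → ℝ} (β : (Fin n → Fin d → ℤ) → ℝ)
    (hα : Symm α) {x : (Fin (n + 1) → Fin d → ℤ) → ℂ} (hx : Symm x) (k : Fin n → Fin d → ℤ) :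
    pairAdj (coef w ε α β) x k = -(vconst d * ((coupling d ε * Real.sqrt (n + 1) * β k : ℝ) : ℂ)) *
      ∑ a, ∑' l, ((vertex w ε (k a - l) l * α (split 0 a l k) : ℝ) : ℂ) * x (split 0 a l k) := by
  have h2 : ∀ b a l, (starRingEnd ℂ) (coef w ε α β b a (split b a l k)) * x (split b a l k) =
      -(vconst d * ((coupling d ε / Real.sqrt (n + 1) * β k : ℝ) : ℂ)) *
        (((vertex w ε (k a - l) l * α (split 0 a l k) : ℝ) : ℂ) * x (split 0 a l k)) := by
    intro b a l
    rw [coef, fuse_split, map_mul, conj_vconst, Complex.conj_ofReal, split_apply_same,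
      split_apply_succAbove, Function.update_self, ← hx.split_eq b, ← hα.split_eq b]
    push_cast
    ring
  simp only [pairAdj, h2, tsum_mul_left, ← Finset.mul_sum]
  rw [Finset.sum_const, Finset.card_univ, Fintype.card_fin, nsmul_eq_mul, ← mul_assoc]
  congr 1
  have h3 : (Real.sqrt (n + 1) : ℂ) ^ 2 = n + 1 := by
    rw [← Complex.ofReal_pow, Real.sq_sqrt (by positivity)]; push_cast; rfl
  have h4 : (Real.sqrt (n + 1) : ℂ) ≠ 0 := by
    rw [Complex.ofReal_ne_zero]; positivity
  push_cast
  rw [← h3]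
  field_simp

lemma pairAdj_coef_symMZ {α : (Fin (n + 1) → Fin d → ℤ) → ℝ}
    {β : (Fin n → Fin d → ℤ) → ℝ} (hα : Symm α) (hβ : Symm β)
    {x : (Fin (n + 1) → Fin d → ℤ) → ℂ} (hx : SymMZ x) :
    SymMZ (pairAdj (coef w ε α β) x) := by
  constructor
  · intro σ k
    rw [pairAdj_coef_eq β hα hx.1, pairAdj_coef_eq β hα hx.1, hβ]
    congr 1
    simp only [hx.1.split_comp, hα.split_comp, Function.comp_apply]
    exact Equiv.sum_comp σ (fun a => ∑' l, ((vertex w ε (k a - l) l * α (split 0 a l k) : ℝ) : ℂ) *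
      x (split 0 a l k))
  · rintro k ⟨c, hc⟩
    rw [pairAdj_coef_eq β hα hx.1, Finset.sum_eq_zero, mul_zero]
    intro a _
    rw [← tsum_zero (α := ℂ) (β := Fin d → ℤ)]
    refine tsum_congr fun l => ?_
    by_cases ha : a = c
    · subst ha
      simp [vertex, hc, dot]
    · rw [hx.2 _ ⟨c.succ, ?_⟩, mul_zero]
      rw [split_zero, Fin.cons_succ, Function.update_of_ne (Ne.symm ha), hc]

variable (d n) in
/-- The `n`-th chaos: symmetric square summable kernels with zero averages. -/
def chaos : Submodule ℂ (lp (fun _ : Fin n → Fin d → ℤ => ℂ) 2) where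
  carrier := {x | SymMZ (x : _ → ℂ)}
  add_mem' := by
    intro x y hx hy
    exact ⟨fun σ k => by simp [hx.1 σ k, hy.1 σ k], fun k hk => by simp [hx.2 k hk, hy.2 k hk]⟩
  zero_mem' := ⟨fun σ k => by simp, fun k hk => by simp⟩
  smul_mem' := by
    intro c x hx
    exact ⟨fun σ k => by simp [hx.1 σ k], fun k hk => by simp [hx.2 k hk]⟩

instance : CompleteSpace (chaos d n) := by
  have hc : ∀ k, Continuous fun x : lp (fun _ : Fin n → Fin d → ℤ => ℂ) 2 => x k := fun k =>
    (lp.evalCLM ℂ (fun _ : Fin n → Fin d → ℤ => ℂ) 2 k).continuous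
  have h : IsClosed (chaos d n : Set (lp (fun _ : Fin n → Fin d → ℤ => ℂ) 2)) := by
    have : (chaos d n : Set (lp (fun _ : Fin n → Fin d → ℤ => ℂ) 2)) =
        (⋂ σ : Equiv.Perm (Fin n), ⋂ k, {x | x (k ∘ σ) = x k}) ∩
          ⋂ k, ⋂ _ : ∃ a, k a = 0, {x | x k = 0} := by
      ext x
      simp [chaos, SymMZ, Symm]
    rw [this]
    refine IsClosed.inter ?_ ?_
    · exact isClosed_iInter fun σ => isClosed_iInter fun k => isClosed_eq (hc _) (hc _)
    · exact isClosed_iInter fun k => isClosed_iInter fun _ => isClosed_eq (hc _) continuous_const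
  exact h.completeSpace_coe

/-- The creation operator between the chaoses, in coordinates in which `‖(-𝓛₀)^(1/2) ·‖` is the
`ℓ²` norm; its adjoint is given by the annihilation operator. -/
lemma exists_creation_clm (w : Fin d → ℝ) (hε : 0 < ε)
    (hC : ENNReal.ofReal (coupling d ε ^ 2) * ∑' l : Fin d → ℤ,
      (if Allowed ε l then ENNReal.ofReal (1 / normSq l) else 0) ≤ ENNReal.ofReal C) (hC0 : 0 ≤ C)
    (n : ℕ) :
    ∃ T : chaos d n →L[ℂ] chaos d (n + 1),
      (∀ y, ((T y).1 : _ → ℂ) = pairOp (coef w ε hinv hinv) y.1) ∧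
      (∀ x, ((ContinuousLinearMap.adjoint T x).1 : _ → ℂ) = pairAdj (coef w ε hinv hinv) x.1) ∧
      ‖T‖ ^ 2 ≤ 4 * ‖vconst d‖ ^ 2 * C * (∑ b, w b ^ 2) * n := by
  have hb := sqNorm_pairOp_hinv_le (w := w) (n := n) hε hC hC0
  obtain ⟨T, hT⟩ := exists_clm (pairOpLin (coef w ε hinv hinv)) ENNReal.ofReal_ne_top hb
  have hs : Symm (hinv (d := d) (n := n)) := fun σ k => hinv_comp k σ
  have hs' : Symm (hinv (d := d) (n := n + 1)) := fun σ k => hinv_comp k σ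
  have hA := adjoint_pairOp (coef_support_finite hε _ _) T hT
  let T₁ : chaos d n →L[ℂ] chaos d (n + 1) := (T.comp (chaos d n).subtypeL).codRestrict _
    fun y => by
      change SymMZ (T y.1 : _ → ℂ)
      rw [hT]
      exact pairOp_coef_symMZ hε hs' hs y.2
  let T₂ : chaos d (n + 1) →L[ℂ] chaos d n :=
    ((ContinuousLinearMap.adjoint T).comp (chaos d (n + 1)).subtypeL).codRestrict _
    fun y => by
      change SymMZ (ContinuousLinearMap.adjoint T y.1 : _ → ℂ)
      rw [hA]
      exact pairAdj_coef_symMZ hs' hs y.2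
  have hT12 : T₂ = ContinuousLinearMap.adjoint T₁ := by
    rw [ContinuousLinearMap.eq_adjoint_iff]
    intro x y
    exact ContinuousLinearMap.adjoint_inner_left T y.1 x.1
  refine ⟨T₁, fun y => hT y.1, fun x => ?_, ?_⟩
  · rw [← hT12]
    exact hA x.1
  · have hM : 0 ≤ 4 * ‖vconst d‖ ^ 2 * C * (∑ b, w b ^ 2) * n := by positivity
    rw [← Real.sq_sqrt hM]
    gcongr
    refine ContinuousLinearMap.opNorm_le_bound _ (Real.sqrt_nonneg _) fun y => ?_
    have h1 := hb y.1
    have h2 : ((T₁ y).1 : _ → ℂ) = pairOp (coef w ε hinv hinv) y.1 := hT y.1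
    rw [← h2, sqNorm_coe, sqNorm_coe, ← ENNReal.ofReal_mul hM,
      ENNReal.ofReal_le_ofReal_iff (by positivity)] at h1
    rw [← Real.sqrt_sq (norm_nonneg y), ← Real.sqrt_mul hM]
    exact Real.le_sqrt_of_sq_le h1

end Operator

/-! ### Fourier coefficients of the test functions -/

section TestFunctions

open MeasureTheory

variable {d : ℕ}

/-- Lebesgue measure on the fundamental domain of the torus. -/
def boxMeasure (d : ℕ) : Measure (Fin d → ℝ) :=
  Measure.pi fun _ : Fin d => (volume : Measure ℝ).restrict (Set.Ico 0 (2 * Real.pi))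

instance : IsFiniteMeasure (boxMeasure d) := by unfold boxMeasure; infer_instance

lemma volume_restrict_box :
    (volume : Measure (Fin d → ℝ)).restrict (Set.univ.pi fun _ => Set.Ico 0 (2 * Real.pi)) =
      boxMeasure d := by
  rw [volume_pi, Measure.restrict_pi_pi, boxMeasure]

lemma volume_restrict_boxes {n : ℕ} :
    (volume : Measure (Fin n → Fin d → ℝ)).restrict
      (Set.univ.pi fun _ => Set.univ.pi fun _ => Set.Ico 0 (2 * Real.pi)) =
      Measure.pi fun _ : Fin n => boxMeasure d := by
  rw [volume_pi, Measure.restrict_pi_pi, volume_restrict_box]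

/-- The one-dimensional Fourier basis. -/
def circleFun (j : ℤ) (t : ℝ) : ℂ :=
  (((2 * Real.pi) ^ (-1 / 2 : ℝ) : ℝ) : ℂ) * Complex.exp (Complex.I * ((j * t : ℝ) : ℂ))

lemma basisFun_eq_prod (k : Fin d → ℤ) (x : Fin d → ℝ) :
    basisFun k x = ∏ b, circleFun (k b) (x b) := by
  simp only [basisFun, circleFun, Finset.prod_mul_distrib, Finset.prod_const, Finset.card_univ,
    Fintype.card_fin, ← Complex.exp_sum, ← Finset.mul_sum]
  congr 1
  · rw [← Complex.ofReal_pow, ← Real.rpow_natCast, ← Real.rpow_mul (by positivity)]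
    congr 2
    ring
  · push_cast
    rfl

lemma conj_circleFun (j : ℤ) (t : ℝ) : (starRingEnd ℂ) (circleFun j t) = circleFun (-j) t := by
  simp only [circleFun, map_mul, Complex.conj_ofReal, ← Complex.exp_conj, Complex.conj_I]
  push_cast
  congr 2
  ring

lemma conj_basisFun (k : Fin d → ℤ) (x : Fin d → ℝ) :
    (starRingEnd ℂ) (basisFun k x) = basisFun (-k) x := by
  simp [basisFun_eq_prod, conj_circleFun]

lemma continuous_basisFun (k : Fin d → ℤ) : Continuous (basisFun k) := by
  unfold basisFun; fun_prop

lemma integral_circleFun_mul (j m : ℤ) :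
    ∫ t in Set.Ico 0 (2 * Real.pi), circleFun (-j) t * circleFun m t = if j = m then 1 else 0 := by
  have h1 : ∀ t : ℝ, circleFun (-j) t * circleFun m t =
      (((2 * Real.pi)⁻¹ : ℝ) : ℂ) * Complex.exp ((Complex.I * ((m - j : ℤ) : ℂ)) * t) := by
    intro t
    simp only [circleFun]
    rw [mul_mul_mul_comm, ← Complex.exp_add, ← Complex.ofReal_mul, ← Real.rpow_add (by positivity)]
    norm_num [Real.rpow_neg_one]
    ring_nf
  simp_rw [h1]
  rw [integral_Ico_eq_integral_Ioc, ← intervalIntegral.integral_of_le (by positivity),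
    intervalIntegral.integral_const_mul]
  split_ifs with h
  · subst h
    simp
    field_simp
  · have h2 : Complex.I * ((m - j : ℤ) : ℂ) ≠ 0 :=
      mul_ne_zero Complex.I_ne_zero (by exact_mod_cast sub_ne_zero.2 (Ne.symm h))
    rw [integral_exp_mul_complex h2]
    have h3 : Complex.exp (Complex.I * ((m - j : ℤ) : ℂ) * ((2 * Real.pi : ℝ) : ℂ)) = 1 := by
      rw [Complex.exp_eq_one_iff]
      exact ⟨m - j, by push_cast; ring⟩
    rw [h3]
    simp

lemma integral_basisFun_mul (k m : Fin d → ℤ) :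
    ∫ x, (starRingEnd ℂ) (basisFun k x) * basisFun m x ∂boxMeasure d =
      if k = m then 1 else 0 := by
  simp only [conj_basisFun]
  simp only [basisFun_eq_prod, ← Finset.prod_mul_distrib]
  rw [boxMeasure, integral_fintype_prod_eq_prod (fun b t => circleFun ((-k) b) t * circleFun (m b) t)]
  simp only [Pi.neg_apply, integral_circleFun_mul]
  rw [Finset.prod_ite_zero]
  simp [funext_iff]

lemma memLp_of_continuous {φ : (Fin d → ℝ) → ℂ} (h : Continuous φ) (p : ℝ≥0∞) :
    MemLp φ p (boxMeasure d) := by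
  have hK : IsCompact (Set.univ.pi fun _ : Fin d => Set.Icc 0 (2 * Real.pi)) :=
    isCompact_univ_pi fun _ => isCompact_Icc
  obtain ⟨M, hM⟩ := hK.exists_bound_of_continuousOn h.continuousOn
  refine MemLp.of_bound h.aestronglyMeasurable M ?_
  rw [← volume_restrict_box]
  refine (ae_restrict_iff' (MeasurableSet.univ_pi fun _ => measurableSet_Ico)).2
    (Filter.Eventually.of_forall fun x hx => hM x fun b hb => ?_)
  exact Set.Ico_subset_Icc_self (hx b hb)

/-- The Fourier coefficients of a function on the torus. -/
def torusCoeff (φ : (Fin d → ℝ) → ℂ) (k : Fin d → ℤ) : ℂ :=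
  ∫ x, φ x * basisFun (-k) x ∂boxMeasure d

/-- Bessel's inequality. -/
lemma sqNorm_torusCoeff_ne_top {φ : (Fin d → ℝ) → ℂ} (h : Continuous φ) :
    sqNorm (torusCoeff φ) ≠ ⊤ := by
  let e : (Fin d → ℤ) → Lp ℂ 2 (boxMeasure d) := fun k =>
    (memLp_of_continuous (continuous_basisFun k) 2).toLp
  have he : Orthonormal ℂ e := by
    rw [orthonormal_iff_ite]
    intro k m
    rw [L2.inner_def, ← integral_basisFun_mul]
    refine integral_congr_ae ?_
    filter_upwards [(memLp_of_continuous (continuous_basisFun k) 2).coeFn_toLp,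
      (memLp_of_continuous (continuous_basisFun m) 2).coeFn_toLp] with x h1 h2
    rw [h1, h2, RCLike.inner_apply, mul_comm]
  have h1 : ∀ k, inner ℂ (e k) (memLp_of_continuous h 2).toLp = torusCoeff φ k := by
    intro k
    rw [L2.inner_def, torusCoeff]
    refine integral_congr_ae ?_
    filter_upwards [(memLp_of_continuous (continuous_basisFun k) 2).coeFn_toLp,
      (memLp_of_continuous h 2).coeFn_toLp] with x h1 h2
    rw [h1, h2, RCLike.inner_apply, conj_basisFun]
  have h2 := he.inner_products_summable (x := (memLp_of_continuous h 2).toLp)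
  simp only [h1] at h2
  have h3 : sqNorm (torusCoeff φ) = ∑' k, ENNReal.ofReal (‖torusCoeff φ k‖ ^ 2) := by
    refine tsum_congr fun k => ?_
    rw [ENNReal.ofReal_pow (norm_nonneg _), ofReal_norm]
  rw [h3, ← ENNReal.ofReal_tsum_of_nonneg (fun _ => by positivity) h2]
  exact ENNReal.ofReal_ne_top

lemma IsTestFunction.torusCoeff_zero {φ : (Fin d → ℝ) → ℂ} (h : IsTestFunction φ) :
    torusCoeff φ 0 = 0 := by
  have h1 : ∀ x : Fin d → ℝ, basisFun (-0) x = basisFun (0 : Fin d → ℤ) 0 := by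
    intro x; simp [basisFun]
  simp only [torusCoeff, h1]
  rw [integral_mul_const, ← volume_restrict_box, h.mean_zero, zero_mul]

lemma fourierCoefficient_one (φ ψ : (Fin d → ℝ) → ℂ) (k : Fin 1 → Fin d → ℤ) :
    fourierCoefficient (testKernel φ ψ 1) k = torusCoeff φ (k 0) := by
  rw [fourierCoefficient, volume_restrict_boxes]
  have h := integral_fintype_prod_eq_prod (μ := fun _ : Fin 1 => boxMeasure d)
    (fun a x => φ x * basisFun (-(k a)) x)
  simpa [testKernel, torusCoeff] using h

lemma fourierCoefficient_two {φ ψ : (Fin d → ℝ) → ℂ} (hφ : Continuous φ) (hψ : Continuous ψ)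
    (k : Fin 2 → Fin d → ℤ) :
    fourierCoefficient (testKernel φ ψ 2) k =
      (torusCoeff φ (k 0) * torusCoeff ψ (k 1) + torusCoeff ψ (k 0) * torusCoeff φ (k 1)) / 2 := by
  rw [fourierCoefficient, volume_restrict_boxes]
  have key : ∀ φ ψ : (Fin d → ℝ) → ℂ, Continuous φ → Continuous ψ →
      Integrable (fun x : Fin 2 → Fin d → ℝ =>
        (φ (x 0) * basisFun (-(k 0)) (x 0)) * (ψ (x 1) * basisFun (-(k 1)) (x 1)))
        (Measure.pi fun _ : Fin 2 => boxMeasure d) ∧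
      ∫ x : Fin 2 → Fin d → ℝ,
        (φ (x 0) * basisFun (-(k 0)) (x 0)) * (ψ (x 1) * basisFun (-(k 1)) (x 1))
        ∂(Measure.pi fun _ : Fin 2 => boxMeasure d) = torusCoeff φ (k 0) * torusCoeff ψ (k 1) := by
    intro φ ψ hφ hψ
    have h := integral_fintype_prod_eq_prod (μ := fun _ : Fin 2 => boxMeasure d)
      (fun a x => (![φ, ψ] a) x * basisFun (-(k a)) x)
    have h2 := Integrable.fintype_prod (μ := fun _ : Fin 2 => boxMeasure d)
      (f := fun a x => (![φ, ψ] a) x * basisFun (-(k a)) x) (fun a => by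
        fin_cases a
        · exact ((memLp_of_continuous (hφ.mul (continuous_basisFun _)) 1).integrable le_rfl)
        · exact ((memLp_of_continuous (hψ.mul (continuous_basisFun _)) 1).integrable le_rfl))
    simp only [Fin.prod_univ_two, Matrix.cons_val_zero, Matrix.cons_val_one] at h h2
    exact ⟨h2, h⟩
  obtain ⟨i1, e1⟩ := key φ ψ hφ hψ
  obtain ⟨i2, e2⟩ := key ψ φ hψ hφ
  rw [← e1, ← e2, ← integral_add i1 i2, ← integral_div]
  refine integral_congr_ae (Filter.Eventually.of_forall fun x => ?_)
  simp only [testKernel, Fin.prod_univ_two]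
  ring

lemma tsum_fin_two (F G : (Fin d → ℤ) → ℝ≥0∞) :
    ∑' k : Fin 2 → Fin d → ℤ, F (k 0) * G (k 1) = (∑' l, F l) * ∑' l, G l := by
  rw [← (finTwoArrowEquiv (Fin d → ℤ)).symm.tsum_eq, ENNReal.tsum_prod', ← ENNReal.tsum_mul_right]
  refine tsum_congr fun l => ?_
  rw [← ENNReal.tsum_mul_left]
  rfl

/-- The kernels of the test inputs are admissible elements of their chaos. -/
lemma testInput_symMZ {φ ψ : (Fin d → ℝ) → ℂ} (hφ : IsTestFunction φ) (hψ : IsTestFunction ψ)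
    {m : ℕ} (hm : m = 1 ∨ m = 2) (n : ℕ) :
    SymMZ (testInput φ ψ m n) ∧ sqNorm (testInput φ ψ m n) ≠ ⊤ := by
  have cφ := hφ.smooth.continuous
  have cψ := hψ.smooth.continuous
  by_cases hn : n = m
  · subst hn
    have h0 : testInput φ ψ n n = fourierCoefficient (testKernel φ ψ n) := by
      funext k; simp [testInput]
    rw [h0]
    rcases hm with rfl | rfl
    · refine ⟨⟨fun σ k => ?_, ?_⟩, ?_⟩
      · rw [Subsingleton.elim σ 1]; rfl
      · rintro k ⟨a, ha⟩
        rw [fourierCoefficient_one, ← Subsingleton.elim a 0, ha, hφ.torusCoeff_zero]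
      · have := sqNorm_torusCoeff_ne_top cφ
        rw [sqNorm, ← (Equiv.funUnique (Fin 1) (Fin d → ℤ)).symm.tsum_eq]
        simpa [fourierCoefficient_one, sqNorm] using this
    · have h1 : fourierCoefficient (testKernel φ ψ 2) = fun k =>
          (torusCoeff φ (k 0) * torusCoeff ψ (k 1) + torusCoeff ψ (k 0) * torusCoeff φ (k 1)) / 2 :=
        funext fun k => fourierCoefficient_two cφ cψ k
      rw [h1]
      refine ⟨⟨fun σ k => ?_, ?_⟩, ?_⟩
      · have hσ : σ = 1 ∨ σ = Equiv.swap 0 1 := by revert σ; decide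
        rcases hσ with rfl | rfl
        · rfl
        · simp; ring
      · rintro k ⟨a, ha⟩
        fin_cases a
        · simp at ha; simp [ha, hφ.torusCoeff_zero, hψ.torusCoeff_zero]
        · simp at ha; simp [ha, hφ.torusCoeff_zero, hψ.torusCoeff_zero]
      · have h2 : ∀ φ ψ : (Fin d → ℝ) → ℂ, Continuous φ → Continuous ψ →
            sqNorm (fun k : Fin 2 → Fin d → ℤ => torusCoeff φ (k 0) * torusCoeff ψ (k 1)) < ⊤ := by
          intro φ ψ hφ hψ
          simp only [sqNorm, enorm_mul, mul_pow]
          rw [tsum_fin_two (fun l => ‖torusCoeff φ l‖ₑ ^ 2) (fun l => ‖torusCoeff ψ l‖ₑ ^ 2)]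
          exact ENNReal.mul_lt_top (sqNorm_torusCoeff_ne_top hφ).lt_top
            (sqNorm_torusCoeff_ne_top hψ).lt_top
        have h3 : sqNorm (fun k : Fin 2 → Fin d → ℤ =>
            torusCoeff φ (k 0) * torusCoeff ψ (k 1) + torusCoeff ψ (k 0) * torusCoeff φ (k 1)) < ⊤ :=
          (sqNorm_add_le _ _).trans_lt (ENNReal.mul_lt_top (by simp)
            (ENNReal.add_lt_top.2 ⟨h2 φ ψ cφ cψ, h2 ψ φ cψ cφ⟩))
        refine ((sqNorm_mono fun k => ?_).trans_lt h3).ne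
        rw [norm_div]
        exact div_le_self (norm_nonneg _) (by norm_num)
  · have h0 : testInput φ ψ m n = fun _ => 0 := by
      funext k; simp [testInput, hn]
    rw [h0]
    exact ⟨⟨fun _ _ => rfl, fun _ _ => rfl⟩, by simp [sqNorm]⟩

end TestFunctions

/-! ### Normalised coordinates -/

section Normalised

variable {d : ℕ} {w : Fin d → ℝ} {ε : ℝ}

/-- Coordinates in which the Fock norm of `(-𝓛₀)^(1/2) f` is the `ℓ²` norm. -/
def nrm (f : Kernels d) (n : ℕ) (k : Fin n → Fin d → ℤ) : ℂ :=
  ((Real.sqrt n.factorial * hroot k : ℝ) : ℂ) * f n k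

/-- Coordinates in which the Fock norm of `(-𝓛₀)^(-1/2) f` is the `ℓ²` norm. -/
def dualNrm (f : Kernels d) (n : ℕ) (k : Fin n → Fin d → ℤ) : ℂ :=
  ((Real.sqrt n.factorial * hinv k : ℝ) : ℂ) * f n k

lemma factorial_mul_tsum (n : ℕ) (g : (Fin n → Fin d → ℤ) → ℂ) :
    (n.factorial : ℝ≥0∞) * ∑' k, ‖g k‖ₑ ^ 2 =
      sqNorm fun k => ((Real.sqrt n.factorial : ℝ) : ℂ) * g k := by
  rw [sqNorm_const_mul, ← ofReal_norm, Complex.norm_real, Real.norm_eq_abs,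
    abs_of_nonneg (Real.sqrt_nonneg _), ← ENNReal.ofReal_pow (Real.sqrt_nonneg _),
    Real.sq_sqrt (by positivity), ENNReal.ofReal_natCast, sqNorm]

lemma fockNorm_half (f : Kernels d) :
    fockNorm (negSymGenPow (1 / 2) f) = (∑' n, sqNorm (nrm f n)) ^ (1 / 2 : ℝ) := by
  unfold fockNorm
  congr 1
  refine tsum_congr fun n => ?_
  rw [factorial_mul_tsum]
  congr 1
  funext k
  rw [negSymGenPow, nrm, hroot, Real.sqrt_eq_rpow (1 / 2 * modeSq k)]
  push_cast
  ring

lemma fockNorm_neg_half (f : Kernels d) :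
    fockNorm (negSymGenPow (-1 / 2) f) = (∑' n, sqNorm (dualNrm f n)) ^ (1 / 2 : ℝ) := by
  unfold fockNorm
  congr 1
  refine tsum_congr fun n => ?_
  rw [factorial_mul_tsum]
  congr 1
  funext k
  have h : (1 / 2 * modeSq k) ^ (-1 / 2 : ℝ) = hinv k := by
    rw [hinv, hroot, Real.sqrt_eq_rpow, ← Real.rpow_neg (by have := modeSq_nonneg k; positivity)]
    norm_num
  rw [negSymGenPow, dualNrm, h]
  push_cast
  ring

/-- Bounds on the squares of the `ℓ²` norms give bounds on the Fock norms. -/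
lemma fockNorm_le_of_tsum_le {f g : Kernels d} {K : ℝ≥0∞}
    (h : ∑' n, sqNorm (dualNrm f n) ≤ K ^ 2 * ∑' n, sqNorm (nrm g n)) :
    fockNorm (negSymGenPow (-1 / 2) f) ≤ K * fockNorm (negSymGenPow (1 / 2) g) := by
  rw [fockNorm_neg_half, fockNorm_half]
  refine (ENNReal.rpow_le_rpow h (by norm_num)).trans (le_of_eq ?_)
  rw [ENNReal.mul_rpow_of_nonneg _ _ (by norm_num), ← ENNReal.rpow_natCast, ← ENNReal.rpow_mul]
  norm_num

lemma tsum_sqNorm_nrm {f : Kernels d} {p : ℕ} (h : ∀ m, m ≠ p → f m = 0) :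
    ∑' m, sqNorm (nrm f m) = sqNorm (nrm f p) := by
  refine tsum_eq_single p fun m hm => ?_
  have h1 : nrm f m = fun _ => 0 := by
    funext k; simp [nrm, h m hm]
  rw [h1]
  simp [sqNorm]

lemma fockNorm_lt_top {f : Kernels d} {n : ℕ} (h0 : ∀ m, n < m → f m = 0)
    (h : ∀ m, sqNorm (f m) ≠ ⊤) : fockNorm f < ⊤ := by
  refine ENNReal.rpow_lt_top_of_nonneg (by norm_num) ?_
  rw [tsum_eq_sum (s := Finset.range (n + 1))]
  · exact ENNReal.sum_ne_top.2 fun m _ => ENNReal.mul_ne_top (ENNReal.natCast_ne_top _) (h m)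
  · intro m hm
    rw [h0 m (by simpa using hm)]
    simp

lemma sqNorm_ne_top_of_fockNorm {f : Kernels d} (h : fockNorm f < ⊤) (n : ℕ) :
    sqNorm (f n) ≠ ⊤ := by
  have h1 : ∑' n, (n.factorial : ℝ≥0∞) * ∑' k, ‖f n k‖ₑ ^ 2 ≠ ⊤ := fun h2 => by
    rw [fockNorm, h2, ENNReal.top_rpow_of_pos (by norm_num)] at h
    exact h.ne rfl
  have h2 := ENNReal.ne_top_of_tsum_ne_top h1 n
  intro h3
  rw [← sqNorm, h3, ENNReal.mul_top (by positivity)] at h2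
  exact h2 rfl

lemma InFock.symMZ {f : Kernels d} (h : InFock f) (n : ℕ) : SymMZ (f n) :=
  ⟨h.symm n, h.mean_zero n⟩

lemma hinv_le (k : Fin n → Fin d → ℤ) : hinv k ≤ 2 := by
  by_cases h : k = 0
  · rw [hinv, hroot_eq_zero.2 h]; norm_num
  · have h1 := half_le_hroot_sq h
    have h2 : 1 / 2 ≤ hroot k := by nlinarith [hroot_nonneg k]
    rw [hinv]
    exact inv_le_of_inv_le₀ (by norm_num) (by simpa using h2)

/-- Kernels which are admissible in each chaos, and vanish in chaos `0`. -/
def Centred (f : Kernels d) : Prop := (∀ n, SymMZ (f n)) ∧ f 0 = 0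

lemma Centred.zero_mode {f : Kernels d} (h : Centred f) (n : ℕ) : f n 0 = 0 := by
  cases n with
  | zero => rw [h.2]; rfl
  | succ n => exact (h.1 _).2 _ ⟨0, rfl⟩

lemma hinv_symm {n : ℕ} : Symm (hinv (d := d) (n := n)) := fun σ k => hinv_comp k σ

lemma nrm_symMZ {f : Kernels d} (h : Centred f) (n : ℕ) : SymMZ (nrm f n) :=
  (h.1 n).mul (α := fun k => ((Real.sqrt n.factorial * hroot k : ℝ) : ℂ))
    fun σ k => by simp only [hroot_comp]

lemma Centred.hinv_mul_nrm {f : Kernels d} (h : Centred f) (n : ℕ) (k : Fin n → Fin d → ℤ) :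
    (Real.sqrt n.factorial : ℂ) * f n k = hinv k * nrm f n k := by
  by_cases hk : k = 0
  · rw [nrm, hk, h.zero_mode]; simp
  · have : hroot k ≠ 0 := mt hroot_eq_zero.1 hk
    rw [nrm, hinv]
    have h2 : (hroot k : ℂ) ≠ 0 := by exact_mod_cast this
    push_cast
    field_simp

lemma dualNrm_creation {f : Kernels d} (h : Centred f) (n : ℕ) :
    dualNrm (creation w ε f) (n + 1) = pairOp (coef w ε hinv hinv) (nrm f n) :=
  funext fun k => creation_eq_pairOp w ε f (h.1 n).1 hinv (h.hinv_mul_nrm n) k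

lemma dualNrm_creation' {f : Kernels d} (h : Centred f) (n : ℕ) :
    dualNrm (creation w ε f) (n + 1) =
      pairOp (coef w ε hinv fun _ => 1) fun k => (Real.sqrt n.factorial : ℂ) * f n k :=
  funext fun k => creation_eq_pairOp w ε f (h.1 n).1 hinv (by simp) k

lemma dualNrm_annihilation {f : Kernels d} (h : Centred f) (n : ℕ) :
    dualNrm (annihilation w ε f) n = -pairAdj (coef w ε hinv hinv) (nrm f (n + 1)) :=
  funext fun k => annihilation_eq_pairAdj w ε f (h.1 _).1 hinv (h.hinv_mul_nrm (n + 1)) k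

lemma dualNrm_annihilation' {f : Kernels d} (h : Centred f) (n : ℕ) :
    dualNrm (annihilation w ε f) n =
      -pairAdj (coef w ε (fun _ => 1) hinv)
        fun k => (Real.sqrt (n + 1).factorial : ℂ) * f (n + 1) k :=
  funext fun k => annihilation_eq_pairAdj w ε f (h.1 _).1 hinv (by simp) k

lemma symm_one {n : ℕ} : Symm fun _ : Fin n → Fin d → ℤ => (1 : ℝ) := fun _ _ => rfl

lemma creation_symMZ (hε : 0 < ε) {f : Kernels d} (h : Centred f) (n : ℕ) :
    SymMZ (creation w ε f (n + 1)) := by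
  have h1 : ∀ k, creation w ε f (n + 1) k = ((Real.sqrt (n + 1).factorial : ℝ) : ℂ)⁻¹ *
      pairOp (coef w ε (fun _ => 1) fun _ => 1) (fun k => (Real.sqrt n.factorial : ℂ) * f n k) k := by
    intro k
    rw [← creation_eq_pairOp w ε f (h.1 n).1 (fun _ => 1) (by simp) k]
    have : (Real.sqrt (n + 1).factorial : ℂ) ≠ 0 := by
      rw [Complex.ofReal_ne_zero]; positivity
    push_cast
    field_simp
  have h2 : SymMZ (pairOp (coef w ε (fun _ => 1) fun _ => 1)
      (fun k => (Real.sqrt n.factorial : ℂ) * f n k)) :=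
    pairOp_coef_symMZ hε symm_one symm_one ((h.1 n).mul (α := fun _ => _) fun _ _ => rfl)
  rw [funext h1]
  exact h2.mul (α := fun _ => _) fun _ _ => rfl

/-- For a fixed scale, `(-𝓛₀)^(-1/2) 𝓐₊ f` is square summable if `f` is. -/
lemma exists_chaos_creation (hε : 0 < ε) {C : ℝ}
    (hC : ENNReal.ofReal (coupling d ε ^ 2) * ∑' l : Fin d → ℤ,
      (if Allowed ε l then ENNReal.ofReal (1 / normSq l) else 0) ≤ ENNReal.ofReal C)
    {f : Kernels d} (hf : Centred f) {m : ℕ} (hs : sqNorm (f m) ≠ ⊤) :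
    ∃ y : chaos d (m + 1), (y.1 : _ → ℂ) = dualNrm (creation w ε f) (m + 1) := by
  have h1 : sqNorm (dualNrm (creation w ε f) (m + 1)) ≠ ⊤ := by
    rw [dualNrm_creation' hf]
    exact sqNorm_pairOp_hinv_one_lt_top hε hC (sqNorm_ofReal_mul_ne_top _ hs)
  obtain ⟨y, hy⟩ := exists_lp h1
  refine ⟨⟨y, ?_⟩, hy⟩
  change SymMZ (y : _ → ℂ)
  rw [hy, dualNrm_creation hf]
  exact pairOp_coef_symMZ hε hinv_symm hinv_symm (nrm_symMZ hf m)

lemma annihilation_symMZ {f : Kernels d} (h : Centred f) (n : ℕ) :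
    SymMZ (annihilation w ε f n) := by
  have h1 : ∀ k, annihilation w ε f n k = ((Real.sqrt n.factorial : ℝ) : ℂ)⁻¹ *
      -pairAdj (coef w ε (fun _ => 1) fun _ => 1)
        (fun k => (Real.sqrt (n + 1).factorial : ℂ) * f (n + 1) k) k := by
    intro k
    rw [← annihilation_eq_pairAdj w ε f (h.1 _).1 (fun _ => 1) (by simp) k]
    have : (Real.sqrt n.factorial : ℂ) ≠ 0 := by
      rw [Complex.ofReal_ne_zero]; positivity
    push_cast
    field_simp
  have h2 : SymMZ (pairAdj (coef w ε (fun _ => 1) fun _ => 1)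
      (fun k => (Real.sqrt (n + 1).factorial : ℂ) * f (n + 1) k)) :=
    pairAdj_coef_symMZ symm_one symm_one ((h.1 _).mul (α := fun _ => _) fun _ _ => rfl)
  rw [funext h1]
  simp only [← neg_one_mul (pairAdj _ _ _), ← mul_assoc]
  exact h2.mul (α := fun _ => _) fun _ _ => rfl

lemma dualNrm_add (f g : Kernels d) (n : ℕ) (k) :
    dualNrm (f + g) n k = dualNrm f n k + dualNrm g n k := mul_add _ _ _

lemma dualNrm_sub (f g : Kernels d) (n : ℕ) (k) :
    dualNrm (f - g) n k = dualNrm f n k - dualNrm g n k := mul_sub _ _ _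

lemma dualNrm_neg (f : Kernels d) (n : ℕ) (k) : dualNrm (-f) n k = -dualNrm f n k := mul_neg _ _

lemma dualNrm_symGen (f : Kernels d) (n : ℕ) (k) : dualNrm (symGen f) n k = -nrm f n k := by
  have h : hinv k * (1 / 2 * modeSq k) = hroot k := by
    rw [← hroot_sq, hinv, sq]
    by_cases h0 : hroot k = 0
    · simp [h0]
    · field_simp
  rw [dualNrm, symGen, nrm, ← h]
  push_cast
  ring

lemma dualNrm_zero_left (f : Kernels d) (k) : dualNrm f 0 k = 0 := by
  have : hinv k = 0 := by rw [hinv, hroot_eq_zero.2 (Subsingleton.elim k 0), inv_zero]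
  rw [dualNrm, this]
  simp

lemma dualNrm_injective {f g : Kernels d} {n : ℕ} {k : Fin n → Fin d → ℤ} (hk : k ≠ 0)
    (h : dualNrm f n k = dualNrm g n k) : f n k = g n k := by
  have h1 : ((Real.sqrt n.factorial * hinv k : ℝ) : ℂ) ≠ 0 := by
    rw [Complex.ofReal_ne_zero, hinv]
    have := mt hroot_eq_zero.1 hk
    positivity
  exact mul_left_cancel₀ h1 h

/-- The kernels with given normalised coordinates. -/
def ofNrm (x : ∀ m, (Fin m → Fin d → ℤ) → ℂ) : Kernels d :=
  fun m k => (((Real.sqrt m.factorial)⁻¹ * hinv k : ℝ) : ℂ) * x m k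

lemma ofNrm_centred {x : ∀ m, (Fin m → Fin d → ℤ) → ℂ} (hx : ∀ m, SymMZ (x m)) (h0 : x 0 = 0) :
    Centred (ofNrm x) :=
  ⟨fun m => (hx m).mul (α := fun k => (((Real.sqrt m.factorial)⁻¹ * hinv k : ℝ) : ℂ))
    fun σ k => by simp only [hinv_comp], by funext k; simp [ofNrm, h0]⟩

lemma nrm_ofNrm {x : ∀ m, (Fin m → Fin d → ℤ) → ℂ} (hx : ∀ m, SymMZ (x m)) (h0 : x 0 = 0) (m : ℕ) :
    nrm (ofNrm x) m = x m := by
  funext k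
  by_cases hk : k = 0
  · have h1 : x m 0 = 0 := by
      cases m with
      | zero => rw [h0]; rfl
      | succ m => exact (hx _).2 _ ⟨0, rfl⟩
    rw [hk, h1, nrm, hroot_eq_zero.2 rfl]
    simp
  · have h2 : (hroot k : ℂ) ≠ 0 := by exact_mod_cast mt hroot_eq_zero.1 hk
    have h3 : (Real.sqrt m.factorial : ℂ) ≠ 0 := by
      rw [Complex.ofReal_ne_zero]; positivity
    rw [nrm, ofNrm, hinv]
    push_cast
    field_simp

lemma inFock_ofNrm {x : ∀ m, (Fin m → Fin d → ℤ) → ℂ} (hx : ∀ m, SymMZ (x m)) (h0 : x 0 = 0)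
    (hs : ∀ m, sqNorm (x m) ≠ ⊤) {n : ℕ} (hn : ∀ m, n < m → x m = 0) : InFock (ofNrm x) := by
  have hc := ofNrm_centred hx h0
  refine ⟨fun m => (hc.1 m).1, fun m => (hc.1 m).2,
    fockNorm_lt_top (n := n) (fun m hm => ?_) fun m => ?_⟩
  · funext k; simp [ofNrm, hn m hm]
  · have h1 : sqNorm (ofNrm x m) ≤ ‖(2 : ℂ)‖ₑ ^ 2 * sqNorm (x m) := by
      rw [← sqNorm_const_mul]
      refine sqNorm_mono fun k => ?_
      rw [ofNrm, norm_mul, norm_mul, Complex.norm_real, Real.norm_eq_abs, Complex.norm_two,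
        abs_of_nonneg (mul_nonneg (by positivity) (hinv_nonneg k))]
      gcongr
      have h2 : (Real.sqrt m.factorial)⁻¹ ≤ 1 := by
        refine inv_le_one_of_one_le₀ (Real.one_le_sqrt.2 ?_)
        exact_mod_cast Nat.factorial_pos m
      calc _ ≤ 1 * hinv k := by gcongr; exact hinv_nonneg k
        _ ≤ 2 := by rw [one_mul]; exact hinv_le k
    exact (h1.trans_lt (ENNReal.mul_lt_top (by simp [ENNReal.pow_lt_top_iff]) (hs m).lt_top)).ne

lemma eq_of_nrm_eq {u v : Kernels d} (hu : Centred u) (hv : Centred v)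
    (h : ∀ m, nrm u m = nrm v m) : u = v := by
  funext m k
  by_cases hk : k = 0
  · rw [hk, hu.zero_mode, hv.zero_mode]
  · have h1 : ((Real.sqrt m.factorial * hroot k : ℝ) : ℂ) ≠ 0 := by
      rw [Complex.ofReal_ne_zero]
      have := mt hroot_eq_zero.1 hk
      positivity
    exact mul_left_cancel₀ h1 (congrFun (h m) k)

lemma nrm_eq_zero {f : Kernels d} {m : ℕ} (h : f m = 0) : nrm f m = 0 := by
  funext k; simp [nrm, h]

lemma InTruncatedFock.eq_zero {i n : ℕ} {v : Kernels d} (h : InTruncatedFock i n v) {m : ℕ}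
    (hm : m < i ∨ n < m) : v m = 0 := by
  rw [← h.2]
  funext k
  rw [chaosProj, if_neg (by omega)]
  rfl

lemma InTruncatedFock.centred {i n : ℕ} (hi : 0 < i) {v : Kernels d} (h : InTruncatedFock i n v) :
    Centred v := ⟨h.1.symMZ, h.eq_zero (Or.inl hi)⟩

lemma pairOp_zero {n : ℕ} (c : Fin (n + 1) → Fin n → (Fin (n + 1) → Fin d → ℤ) → ℂ) :
    pairOp c 0 = 0 := (pairOpLin c).map_zero

lemma pairAdj_zero {n : ℕ} (c : Fin (n + 1) → Fin n → (Fin (n + 1) → Fin d → ℤ) → ℂ) :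
    pairAdj c 0 = 0 := by
  funext k; simp [pairAdj]

lemma chaosProj_centred {f : Kernels d} (h : Centred f) (i n : ℕ) : Centred (chaosProj i n f) := by
  refine ⟨fun m => ⟨fun σ k => ?_, fun k hk => ?_⟩, ?_⟩
  · simp only [chaosProj, (h.1 m).1 σ k]
  · simp only [chaosProj, (h.1 m).2 k hk, ite_self]
  · funext k; simp [chaosProj, h.2]

end Normalised

/-! ### The truncated generator equation -/

section Truncated

open ContinuousLinearMap

variable {d : ℕ} {w : Fin d → ℝ} {ε : ℝ} {p n : ℕ} {f : Kernels d}
  {T : ∀ m, chaos d m →L[ℂ] chaos d (m + 1)}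

/-- The truncated generator equation in normalised coordinates. -/
lemma dualNrm_truncated {v : Kernels d} (hv : Centred v) (m : ℕ) (k) :
    dualNrm (-symGen v - antisymGen w ε v) (m + 1) k =
      nrm v (m + 1) k - pairOp (coef w ε hinv hinv) (nrm v m) k +
        pairAdj (coef w ε hinv hinv) (nrm v (m + 2)) k := by
  rw [dualNrm_sub, dualNrm_neg, dualNrm_symGen, antisymGen, dualNrm_add, dualNrm_creation hv,
    dualNrm_annihilation hv, Pi.neg_apply]
  ring

lemma creation_eq_zero {v : Kernels d} {m : ℕ} (h : v m = 0) : creation w ε v (m + 1) = 0 := by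
  funext k; simp [creation, h]

lemma annihilation_eq_zero {v : Kernels d} {m : ℕ} (h : v (m + 1) = 0) :
    annihilation w ε v m = 0 := by
  funext k; simp [annihilation, h]

/-- Solutions of the truncated generator equation are solutions of a tridiagonal system. -/
lemma IsTruncatedSolution.tridiagonal (hε : 0 < ε) {C : ℝ}
    (hC : ENNReal.ofReal (coupling d ε ^ 2) * ∑' l : Fin d → ℤ,
      (if Allowed ε l then ENNReal.ofReal (1 / normSq l) else 0) ≤ ENNReal.ofReal C)
    (hT : ∀ m y, ((T m y).1 : _ → ℂ) = pairOp (coef w ε hinv hinv) y.1)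
    (hT' : ∀ m x, ((adjoint (T m) x).1 : _ → ℂ) = pairAdj (coef w ε hinv hinv) x.1)
    (hf : Centred f) (hfs : ∀ m, sqNorm (f m) ≠ ⊤) (hfp : ∀ m, m ≠ p → f m = 0)
    (y : chaos d (p + 1)) (hy : (y.1 : _ → ℂ) = dualNrm (creation w ε f) (p + 1)) {u : Kernels d}
    (hpn : p + 1 ≤ n) (hu : IsTruncatedSolution w ε (p + 1) n f u) :
    ∃ x : ∀ m, chaos d m, (∀ m, ((x m).1 : _ → ℂ) = nrm u m) ∧
      (∀ m, m < p + 1 ∨ n < m → x m = 0) ∧ x (p + 1) + adjoint (T (p + 1)) (x (p + 1 + 1)) = y ∧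
      ∀ m, p + 1 ≤ m → m < n → x (m + 1) + adjoint (T (m + 1)) (x (m + 2)) = T m (x m) := by
  have huc : Centred u := hu.1.centred (by omega)
  have hus : ∀ m, sqNorm (u m) ≠ ⊤ := sqNorm_ne_top_of_fockNorm hu.1.1.norm_lt_top
  -- the equation in chaos `m + 1`
  have heq : ∀ m, p + 1 ≤ m + 1 → m + 1 ≤ n → ∀ k,
      dualNrm (-symGen u - antisymGen w ε u) (m + 1) k = dualNrm (creation w ε f) (m + 1) k := by
    intro m h1 h2 k
    rw [← hu.2]
    simp only [dualNrm, truncGenerator, hu.1.2]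
    congr 1
    simp only [Pi.neg_apply, Pi.sub_apply, Pi.add_apply, chaosProj, if_pos (And.intro h1 h2)]
    ring
  have hneg : ∀ {m : ℕ} {g : (Fin m → Fin d → ℤ) → ℂ}, sqNorm g ≠ ⊤ → sqNorm (-g) ≠ ⊤ := by
    intro m g hg
    simpa [sqNorm] using hg
  -- `(-𝓛₀)^(1/2) u` is square summable, as `(-𝓛₀)^(-1/2) 𝓐` is bounded for a fixed scale
  have hreg : ∀ m, sqNorm (nrm u m) ≠ ⊤ := by
    intro m
    by_cases hm : p + 1 ≤ m ∧ m ≤ n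
    · obtain ⟨m, rfl⟩ : ∃ m', m = m' + 1 := ⟨m - 1, by omega⟩
      have h1 : nrm u (m + 1) = fun k => (dualNrm (creation w ε f) (m + 1) k +
          dualNrm (creation w ε u) (m + 1) k) + dualNrm (annihilation w ε u) (m + 1) k := by
        funext k
        rw [← heq m hm.1 hm.2 k, dualNrm_sub, dualNrm_neg, dualNrm_symGen, antisymGen, dualNrm_add]
        ring
      rw [h1]
      refine ((sqNorm_add_le _ _).trans_lt (ENNReal.mul_lt_top (by simp)
        (ENNReal.add_lt_top.2 ⟨(sqNorm_add_le _ _).trans_lt (ENNReal.mul_lt_top (by simp)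
        (ENNReal.add_lt_top.2 ⟨Ne.lt_top ?_, Ne.lt_top ?_⟩)), Ne.lt_top ?_⟩))).ne
      · rw [dualNrm_creation' hf]
        exact sqNorm_pairOp_hinv_one_lt_top hε hC (sqNorm_ofReal_mul_ne_top _ (hfs m))
      · rw [dualNrm_creation' huc]
        exact sqNorm_pairOp_hinv_one_lt_top hε hC (sqNorm_ofReal_mul_ne_top _ (hus m))
      · rw [dualNrm_annihilation' huc]
        exact hneg (sqNorm_pairAdj_one_hinv_lt_top hε hC (sqNorm_ofReal_mul_ne_top _ (hus (m + 2))))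
    · rw [nrm_eq_zero (hu.1.eq_zero (by omega))]
      simp [sqNorm]
  have hx : ∀ m, ∃ x : chaos d m, (x.1 : _ → ℂ) = nrm u m := fun m => by
    obtain ⟨x, hx⟩ := exists_lp (hreg m)
    exact ⟨⟨x, by change SymMZ (x : _ → ℂ); rw [hx]; exact nrm_symMZ huc m⟩, hx⟩
  choose x hx using hx
  refine ⟨x, hx, fun m hm => ?_, ?_, fun m h1 h2 => ?_⟩
  · apply Subtype.ext
    apply lp.ext
    rw [hx, nrm_eq_zero (hu.1.eq_zero hm)]
    rfl
  · apply Subtype.ext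
    apply lp.ext
    funext k
    have h := heq p le_rfl hpn k
    rw [dualNrm_truncated huc, nrm_eq_zero (hu.1.eq_zero (Or.inl (Nat.lt_succ_self p))),
      pairOp_zero, ← hy] at h
    rw [← h, Submodule.coe_add, lp.coeFn_add, Pi.add_apply, hT', hx, hx]
    simp
  · apply Subtype.ext
    apply lp.ext
    funext k
    have h := heq m (by omega) (by omega) k
    rw [dualNrm_truncated huc] at h
    have h3 : dualNrm (creation w ε f) (m + 1) k = 0 := by
      rw [dualNrm, creation_eq_zero (hfp m (by omega))]; simp
    rw [h3] at h
    rw [Submodule.coe_add, lp.coeFn_add, Pi.add_apply, hT', hT, hx, hx, hx]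
    linear_combination h

/-- Solutions of the tridiagonal system are solutions of the truncated generator equation. -/
lemma isTruncatedSolution_ofNrm (hε : 0 < ε)
    (hT : ∀ m y, ((T m y).1 : _ → ℂ) = pairOp (coef w ε hinv hinv) y.1)
    (hT' : ∀ m x, ((adjoint (T m) x).1 : _ → ℂ) = pairAdj (coef w ε hinv hinv) x.1)
    (hf : Centred f) (hfp : ∀ m, m ≠ p → f m = 0)
    (y : chaos d (p + 1)) (hy : (y.1 : _ → ℂ) = dualNrm (creation w ε f) (p + 1))
    (hpn : p + 1 ≤ n) {x : ∀ m, chaos d m}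
    (h0 : ∀ m, m < p + 1 ∨ n < m → x m = 0)
    (hi : x (p + 1) + adjoint (T (p + 1)) (x (p + 1 + 1)) = y)
    (hm : ∀ m, p + 1 ≤ m → m < n → x (m + 1) + adjoint (T (m + 1)) (x (m + 2)) = T m (x m)) :
    IsTruncatedSolution w ε (p + 1) n f (ofNrm fun m => (x m).1) := by
  have hs : ∀ m, SymMZ ((x m).1 : _ → ℂ) := fun m => (x m).2
  have h0' : ∀ m, m < p + 1 ∨ n < m → ((x m).1 : _ → ℂ) = 0 := fun m hm => by rw [h0 m hm]; rfl
  set v : Kernels d := ofNrm fun m => (x m).1 with hv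
  have hvc : Centred v := ofNrm_centred hs (h0' 0 (by omega))
  have hnrm : ∀ m, nrm v m = (x m).1 := nrm_ofNrm hs (h0' 0 (by omega))
  have hv0 : ∀ m, m < p + 1 ∨ n < m → v m = 0 := fun m hm => by
    funext k; simp only [hv, ofNrm]; rw [h0' m hm]; simp
  have hproj : chaosProj (p + 1) n v = v := by
    funext m k
    rw [chaosProj]
    split_ifs with h
    · rfl
    · rw [hv0 m (by omega)]; rfl
  refine ⟨⟨inFock_ofNrm hs (h0' 0 (by omega)) (fun m => sqNorm_coe_ne_top _)
    (fun m hm => h0' m (Or.inr hm)), hproj⟩, ?_⟩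
  funext m k
  by_cases h : p + 1 ≤ m ∧ m ≤ n
  · obtain ⟨m, rfl⟩ : ∃ m', m = m' + 1 := ⟨m - 1, by omega⟩
    have e1 : (-truncGenerator w ε (p + 1) n v) (m + 1) k =
        (-symGen v - antisymGen w ε v) (m + 1) k := by
      simp only [Pi.neg_apply, Pi.sub_apply, truncGenerator, Pi.add_apply, hproj]
      simp only [chaosProj, if_pos h]
      ring
    rw [e1]
    by_cases hk : k = 0
    · have h1 := (creation_symMZ (w := w) hε hvc m).2 k ⟨0, by rw [hk]; rfl⟩
      have h2 := (creation_symMZ (w := w) hε hf m).2 k ⟨0, by rw [hk]; rfl⟩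
      have h3 := (annihilation_symMZ (w := w) (ε := ε) hvc (m + 1)).2 k ⟨0, by rw [hk]; rfl⟩
      have h4 := (hvc.1 (m + 1)).2 k ⟨0, by rw [hk]; rfl⟩
      simp [symGen, antisymGen, h1, h2, h3, h4]
    · refine dualNrm_injective hk ?_
      rw [dualNrm_truncated hvc, hnrm, hnrm, hnrm]
      rcases eq_or_ne m p with rfl | hmp
      · rw [h0' m (by omega), pairOp_zero, ← hy, ← hi, Submodule.coe_add, lp.coeFn_add,
          Pi.add_apply, hT']
        simp
      · have h1 := congrArg (fun z : chaos d (m + 1) => (z.1 : _ → ℂ) k)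
          (hm m (by omega) (by omega))
        simp only [Submodule.coe_add, lp.coeFn_add, Pi.add_apply, hT', hT] at h1
        have h3 : dualNrm (creation w ε f) (m + 1) k = 0 := by
          rw [dualNrm, creation_eq_zero (hfp m (by omega))]; simp
        rw [h3]
        linear_combination h1
  · have e1 : (-truncGenerator w ε (p + 1) n v) m k = 0 := by
      simp only [Pi.neg_apply, truncGenerator, Pi.add_apply]
      simp only [chaosProj, if_neg h, symGen]
      rw [hv0 m (by omega)]
      simp
    rw [e1]
    cases m with
    | zero => rfl
    | succ m => rw [creation_eq_zero (hfp m (by omega))]; rfl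

/-- The residual of the truncated solution lives in chaos `n + 1`. -/
lemma residual_truncated (hfp : ∀ m, m ≠ p → f m = 0) (hpn : p + 1 ≤ n)
    {v : Kernels d} (hv : IsTruncatedSolution w ε (p + 1) n f v) :
    ∑' m, sqNorm (dualNrm (-generator w ε v - creation w ε f +
      annihilation w ε (chaosProj (p + 1) (p + 1) v)) m) =
      sqNorm (pairOp (coef w ε hinv hinv) (nrm v n)) := by
  have hvc : Centred v := hv.1.centred (by omega)
  have e0 : ∀ m k, dualNrm (-generator w ε v - creation w ε f +
      annihilation w ε (chaosProj (p + 1) (p + 1) v)) m k =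
      dualNrm (-symGen v - antisymGen w ε v) m k - dualNrm (creation w ε f) m k +
      dualNrm (annihilation w ε (chaosProj (p + 1) (p + 1) v)) m k := by
    intro m k
    rw [dualNrm_add, dualNrm_sub]
    congr 2
    simp only [dualNrm, generator, Pi.neg_apply, Pi.sub_apply, Pi.add_apply]
    ring
  have hann : ∀ m, m ≠ p → ∀ k,
      dualNrm (annihilation w ε (chaosProj (p + 1) (p + 1) v)) m k = 0 := by
    intro m hm k
    rw [dualNrm, annihilation_eq_zero, Pi.zero_apply, mul_zero]
    funext k
    rw [chaosProj, if_neg (by omega)]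
    rfl
  have hcr : ∀ m, m ≠ p → ∀ k, dualNrm (creation w ε f) (m + 1) k = 0 := fun m hm k => by
    rw [dualNrm, creation_eq_zero (hfp m hm), Pi.zero_apply, mul_zero]
  rw [tsum_eq_single (n + 1)]
  · have h : ∀ k, dualNrm (-generator w ε v - creation w ε f +
      annihilation w ε (chaosProj (p + 1) (p + 1) v)) (n + 1) k =
        -pairOp (coef w ε hinv hinv) (nrm v n) k := by
      intro k
      rw [e0, hann _ (by omega), hcr _ (by omega), dualNrm_truncated hvc,
        nrm_eq_zero (hv.1.eq_zero (m := n + 1) (Or.inr (by omega))),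
        nrm_eq_zero (hv.1.eq_zero (m := n + 2) (Or.inr (by omega))), pairAdj_zero]
      simp
    simp only [sqNorm, h, enorm_neg]
  · intro m hm
    have h : ∀ k, dualNrm (-generator w ε v - creation w ε f +
      annihilation w ε (chaosProj (p + 1) (p + 1) v)) m k = 0 := by
      intro k
      cases m with
      | zero => exact dualNrm_zero_left _ _
      | succ m =>
        by_cases h1 : p + 1 ≤ m + 1 ∧ m + 1 ≤ n
        · rw [e0, hann _ (by omega), add_zero, sub_eq_zero, ← hv.2]
          simp only [dualNrm, truncGenerator, hv.1.2]
          congr 1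
          simp only [Pi.neg_apply, Pi.sub_apply, Pi.add_apply, chaosProj, if_pos h1]
          ring
        · rw [e0, hcr _ (by omega), dualNrm_truncated hvc, nrm_eq_zero (hv.1.eq_zero (by omega)),
            nrm_eq_zero (hv.1.eq_zero (by omega)), pairOp_zero]
          by_cases h2 : m + 1 = p
          · subst h2
            rw [dualNrm_annihilation (chaosProj_centred hvc _ _)]
            have : nrm (chaosProj (m + 1 + 1) (m + 1 + 1) v) (m + 1 + 1) = nrm v (m + 1 + 1) := by
              funext k; simp [nrm, chaosProj]
            rw [this]
            simp
          · rw [hann _ h2, nrm_eq_zero (hv.1.eq_zero (by omega)), pairAdj_zero]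
            simp
    simp [sqNorm, h]

/-- The growth condition on the weights `(m + A)^q` in the weighted energy estimate. -/
lemma weight_condition {q : ℕ} {M A s m τ : ℝ} (hM : 0 ≤ M) (hm : 0 ≤ m)
    (hA : 16 * q ^ 2 * M + 2 * q ≤ A) (hs : s = m + A) (hτ : 0 ≤ τ) (hτ2 : τ ^ 2 ≤ M * m) :
    |((s + 1) ^ q) ^ 2 - (s ^ q) ^ 2| * τ ≤ 1 / 2 * s ^ q * (s + 1) ^ q := by
  have hA0 : 0 ≤ A := le_trans (by positivity) hA
  have hs0 : 0 ≤ s := by rw [hs]; positivity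
  have h1 : 0 < s + 1 := by linarith
  have hb : ∀ r : ℕ, (s + 1) ^ r * (1 - r / (s + 1)) ≤ s ^ r := by
    intro r
    have h2 := one_add_mul_le_pow (a := -(1 / (s + 1))) (by
      rw [neg_le_neg_iff, div_le_iff₀ h1]; linarith) r
    have h3 : 1 + -(1 / (s + 1)) = s / (s + 1) := by field_simp; ring
    rw [h3, div_pow, le_div_iff₀ (by positivity)] at h2
    calc _ = (1 + r * -(1 / (s + 1))) * (s + 1) ^ r := by ring
      _ ≤ _ := h2
  have hq := hb q
  have h2q := hb (2 * q)
  have hqs : (q : ℝ) / (s + 1) ≤ 1 / 2 := by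
    rw [div_le_iff₀ h1]
    nlinarith [mul_nonneg (sq_nonneg (q : ℝ)) hM]
  have h4 : 1 / 2 * (s + 1) ^ q ≤ s ^ q := by
    refine le_trans ?_ hq
    rw [mul_comm]
    gcongr
    linarith
  have h5 : 8 * q * τ ≤ s + 1 := by
    have h6 : (8 * q * τ) ^ 2 ≤ (s + 1) ^ 2 := by
      calc (8 * q * τ) ^ 2 = 64 * q ^ 2 * τ ^ 2 := by ring
        _ ≤ 64 * q ^ 2 * (M * m) := by gcongr
        _ = 4 * (m * (16 * q ^ 2 * M)) := by ring
        _ ≤ 4 * (m * A) := by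
            gcongr
            have : (0 : ℝ) ≤ 2 * q := by positivity
            linarith
        _ ≤ (s + 1) ^ 2 := by rw [hs]; nlinarith [sq_nonneg (m - A)]
    exact le_of_sq_le_sq h6 h1.le
  have h7 : |((s + 1) ^ q) ^ 2 - (s ^ q) ^ 2| ≤ 2 * q / (s + 1) * ((s + 1) ^ q) ^ 2 := by
    rw [abs_of_nonneg (by
      rw [sub_nonneg]
      gcongr
      linarith)]
    rw [← pow_mul, ← pow_mul, mul_comm q 2]
    push_cast at h2q
    nlinarith
  calc _ ≤ 2 * q / (s + 1) * ((s + 1) ^ q) ^ 2 * τ := by gcongr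
    _ = (8 * q * τ) / (s + 1) * (1 / 4 * ((s + 1) ^ q) ^ 2) := by field_simp; ring
    _ ≤ 1 * (1 / 4 * ((s + 1) ^ q) ^ 2) := by
        gcongr
        rw [div_le_one h1]
        exact h5
    _ = 1 / 2 * (1 / 2 * (s + 1) ^ q) * (s + 1) ^ q := by ring
    _ ≤ _ := by gcongr

/-- The theorem in dimension at least three. -/
lemma exists_truncated (hd : 3 ≤ d) (w : Fin d → ℝ) (q : ℕ) :
    ∃ K : ℝ, 0 < K ∧ ∀ p, p = 1 ∨ p = 2 → ∀ n, p + 1 ≤ n → ∀ f : Kernels d, Centred f →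
      (∀ m, sqNorm (f m) ≠ ⊤) → (∀ m, m ≠ p → f m = 0) → ∀ ε, 0 < ε → ε < 1 →
      ∃ v, IsTruncatedSolution w ε (p + 1) n f v ∧
        (∀ u, IsTruncatedSolution w ε (p + 1) n f u → u = v) ∧
        fockNorm (negSymGenPow (-1 / 2) (-generator w ε v - creation w ε f +
          annihilation w ε (chaosProj (p + 1) (p + 1) v))) ≤
          ENNReal.ofReal (K / (n : ℝ) ^ q) * fockNorm (negSymGenPow (1 / 2) f) := by
  obtain ⟨C, hC0, hC⟩ := exists_coupling_sum_le (d := d) (by omega)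
  set M : ℝ := 4 * ‖vconst d‖ ^ 2 * C * (∑ b, w b ^ 2) with hM
  have hM0 : 0 ≤ M := by positivity
  set A : ℝ := 16 * ((q + 1 : ℕ) : ℝ) ^ 2 * M + 2 * ((q + 1 : ℕ) : ℝ) with hA
  have hA0 : 0 ≤ A := by positivity
  -- the summand `1` only makes the constant positive
  refine ⟨Real.sqrt (8 * M ^ 2 * (3 + A) ^ (2 * (q + 1)) + 1), by positivity, ?_⟩
  intro p hp n hpn f hf hfs hfp ε hε hε1
  have hCε := hC ε hε hε1 (by omega)
  choose T hT hT' hTn using fun m => exists_creation_clm w hε hCε hC0.le m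
  obtain ⟨y, hy⟩ : ∃ y : chaos d (p + 1),
      (y.1 : _ → ℂ) = dualNrm (creation w ε f) (p + 1) := exists_chaos_creation hε hCε hf (hfs p)
  obtain ⟨R, -, hR⟩ := exists_tridiagonal T hpn
  obtain ⟨x, -, h0, hi, hm⟩ := hR y
  have hsol := isTruncatedSolution_ofNrm hε hT hT' hf hfp y hy hpn h0 hi hm
  refine ⟨_, hsol, fun u hu => ?_, ?_⟩
  · have hnrm : ∀ m, nrm (ofNrm fun m => ((x m).1 : _ → ℂ)) m = (x m).1 :=
      nrm_ofNrm (fun m => (x m).2) (by rw [h0 0 (by omega)]; rfl)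
    obtain ⟨x', hx', h0', hi', hm'⟩ := hu.tridiagonal hε hCε hT hT' hf hfs hfp y hy hpn
    refine eq_of_nrm_eq (hu.1.centred (by omega)) (hsol.1.centred (by omega)) fun m => ?_
    rw [hnrm, ← hx', tridiagonal_unique T hpn h0 hi hm h0' hi' hm' m]
  · have hn0 : (0 : ℝ) < n := by exact_mod_cast (by omega : 0 < n)
    refine fockNorm_le_of_tsum_le ?_
    rw [residual_truncated hfp hpn hsol, tsum_sqNorm_nrm hfp,
      nrm_ofNrm (fun m => (x m).2) (by rw [h0 0 (by omega)]; rfl)]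
    have hest := tridiagonal_estimate T hpn h0 hi hm (t := fun m => ((m : ℝ) + A) ^ (q + 1))
      (fun m h1 h2 => by
        push_cast
        rw [add_right_comm]
        exact weight_condition hM0 (Nat.cast_nonneg m) le_rfl rfl
          (ContinuousLinearMap.opNorm_nonneg _) (hTn m)) n hpn
        le_rfl
    beta_reduce at hest
    have hy2 : sqNorm y.1 ≤ ENNReal.ofReal (M * p) * sqNorm (nrm f p) := by
      rw [hy, dualNrm_creation hf]
      exact sqNorm_pairOp_hinv_le hε hCε hC0.le _
    have hp2 : (p : ℝ) ≤ 2 := by rcases hp with rfl | rfl <;> norm_num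
    have hkey : M * n * ‖x n‖ ^ 2 ≤ 4 * M * (3 + A) ^ (2 * (q + 1)) / ((n : ℝ) ^ q) ^ 2 * ‖y‖ ^ 2 := by
      have h1 : ((p + 1 : ℕ) + A) ^ (q + 1) ≤ (3 + A) ^ (q + 1) := by
        gcongr
        push_cast
        linarith
      have h2 : (n : ℝ) ^ (q + 1) ≤ ((n : ℝ) + A) ^ (q + 1) := by
        gcongr
        linarith
      have h3 : ((n : ℝ) ^ (q + 1)) ^ 2 * ‖x n‖ ^ 2 ≤ 4 * (((3 + A) ^ (q + 1)) ^ 2 * ‖y‖ ^ 2) := by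
        calc _ ≤ (((n : ℝ) + A) ^ (q + 1)) ^ 2 * ‖x n‖ ^ 2 := by gcongr
          _ ≤ _ := hest
          _ ≤ _ := by gcongr
      rw [div_mul_eq_mul_div, le_div_iff₀ (by positivity)]
      have hn1 : (1 : ℝ) ≤ n := by exact_mod_cast (by omega : 1 ≤ n)
      calc M * n * ‖x n‖ ^ 2 * ((n : ℝ) ^ q) ^ 2
          ≤ M * n * ‖x n‖ ^ 2 * ((n : ℝ) ^ q) ^ 2 * n := le_mul_of_one_le_right (by positivity) hn1
        _ = M * (((n : ℝ) ^ (q + 1)) ^ 2 * ‖x n‖ ^ 2) := by ring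
        _ ≤ M * (4 * (((3 + A) ^ (q + 1)) ^ 2 * ‖y‖ ^ 2)) := by gcongr
        _ = _ := by ring
    calc _ ≤ ENNReal.ofReal (M * n) * sqNorm (x n).1 := sqNorm_pairOp_hinv_le hε hCε hC0.le _
      _ = ENNReal.ofReal (M * n * ‖x n‖ ^ 2) := by
          rw [sqNorm_coe, ← ENNReal.ofReal_mul (by positivity)]
          rfl
      _ ≤ ENNReal.ofReal (4 * M * (3 + A) ^ (2 * (q + 1)) / ((n : ℝ) ^ q) ^ 2 * ‖y‖ ^ 2) :=
          ENNReal.ofReal_le_ofReal hkey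
      _ = ENNReal.ofReal (4 * M * (3 + A) ^ (2 * (q + 1)) / ((n : ℝ) ^ q) ^ 2) * sqNorm y.1 := by
          rw [sqNorm_coe, ← ENNReal.ofReal_mul (by positivity)]
          rfl
      _ ≤ ENNReal.ofReal (4 * M * (3 + A) ^ (2 * (q + 1)) / ((n : ℝ) ^ q) ^ 2) *
          (ENNReal.ofReal (M * p) * sqNorm (nrm f p)) := by gcongr
      _ ≤ _ := by
          rw [← mul_assoc, ← ENNReal.ofReal_mul (by positivity),
            ← ENNReal.ofReal_pow (by positivity)]
          gcongr
          rw [div_pow, Real.sq_sqrt (by positivity), div_mul_eq_mul_div]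
          gcongr
          calc 4 * M * (3 + A) ^ (2 * (q + 1)) * (M * p)
              ≤ 4 * M * (3 + A) ^ (2 * (q + 1)) * (M * 2) := by gcongr
            _ ≤ _ := by ring_nf; linarith

end Truncated

/-! ### The effective diffusivity in dimension two -/

section Diffusivity

variable {w : Fin 2 → ℝ} {ε u v : ℝ}

/-- The multiplier `G(L^ε(u))` of the two-dimensional ansatz. -/
def diffusivity (w : Fin 2 → ℝ) (ε u : ℝ) : ℝ := diffusivityG w (logScale 2 ε u)

/-- The quantity `3|w|²L^ε(u)/(2π) + 1`, whose power `2/3` is `1 + |w|² G(L^ε(u))`. -/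
def diffusivityBase (w : Fin 2 → ℝ) (ε u : ℝ) : ℝ :=
  3 * (∑ b, w b ^ 2) / (2 * Real.pi) * logScale 2 ε u + 1

lemma sum_sq_pos (hw : w ≠ 0) : 0 < ∑ b, w b ^ 2 := by
  obtain ⟨b, hb⟩ := Function.ne_iff.1 hw
  exact Finset.sum_pos' (fun b _ => sq_nonneg _) ⟨b, Finset.mem_univ _, by positivity [show w b ≠ 0 from hb]⟩

lemma coupling_two_sq_pos (hε : 0 < ε) (hε1 : ε ≤ 1 / 4) : 0 < coupling 2 ε ^ 2 := by
  rw [coupling_two_sq hε (by linarith)]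
  have : 0 < Real.log (1 / ε) := Real.log_pos (by rw [lt_div_iff₀ hε]; linarith)
  positivity

lemma logScale_nonneg (hε : 0 < ε) (hu : 0 < u) : 0 ≤ logScale 2 ε u := by
  rw [logScale]
  have : 0 ≤ Real.log (1 + 1 / (ε ^ 2 * u)) := Real.log_nonneg (by
    have : 0 < 1 / (ε ^ 2 * u) := by positivity
    linarith)
  positivity

lemma one_le_diffusivityBase (hε : 0 < ε) (hu : 0 < u) : 1 ≤ diffusivityBase w ε u := by
  have h1 := logScale_nonneg hε hu
  have h2 : 0 ≤ ∑ b, w b ^ 2 := Finset.sum_nonneg fun b _ => sq_nonneg _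
  rw [diffusivityBase]
  have : 0 ≤ 3 * (∑ b, w b ^ 2) / (2 * Real.pi) * logScale 2 ε u := by positivity
  linarith

lemma sq_mul_diffusivity (hw : w ≠ 0) :
    1 + (∑ b, w b ^ 2) * diffusivity w ε u = diffusivityBase w ε u ^ (2 / 3 : ℝ) := by
  have := sum_sq_pos hw
  rw [diffusivity, diffusivityG, diffusivityBase]
  field_simp
  ring

lemma sqrt_one_add_diffusivity (hw : w ≠ 0) (hε : 0 < ε) (hu : 0 < u) :
    Real.sqrt (1 + (∑ b, w b ^ 2) * diffusivity w ε u) = diffusivityBase w ε u ^ (1 / 3 : ℝ) := by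
  have h := one_le_diffusivityBase (w := w) hε hu
  rw [sq_mul_diffusivity hw, Real.sqrt_eq_rpow, ← Real.rpow_mul (by linarith)]
  norm_num

lemma diffusivity_nonneg (hw : w ≠ 0) (hε : 0 < ε) (hu : 0 < u) : 0 ≤ diffusivity w ε u := by
  have h := Real.one_le_rpow (one_le_diffusivityBase (w := w) hε hu) (z := 2 / 3) (by norm_num)
  rw [← sq_mul_diffusivity hw] at h
  have := sum_sq_pos hw
  by_contra! h2
  nlinarith

/-- `G` is Lipschitz with constant `1/π` on the positive half-line. -/
lemma diffusivityG_sub_le (hw : w ≠ 0) {x y : ℝ} (hx : 0 ≤ x) (hxy : x ≤ y) :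
    diffusivityG w y - diffusivityG w x ≤ (y - x) / Real.pi := by
  have hm := sum_sq_pos hw
  set m := ∑ b, w b ^ 2 with hm_def
  set c := 3 * m / (2 * Real.pi) with hc
  have hc0 : 0 < c := by positivity
  set A := c * x + 1 with hA
  have hA1 : 1 ≤ A := by nlinarith
  have hB : c * y + 1 = A * (1 + c * (y - x) / A) := by field_simp; ring
  have h0 : 0 ≤ c * (y - x) / A := by
    have : 0 ≤ y - x := by linarith
    positivity
  have h1 : (1 + c * (y - x) / A) ^ (2 / 3 : ℝ) ≤ 1 + 2 / 3 * (c * (y - x) / A) :=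
    rpow_one_add_le_one_add_mul_self (by linarith) (by norm_num) (by norm_num)
  have h2 : A ^ (2 / 3 : ℝ) ≤ A := by
    calc A ^ (2 / 3 : ℝ) ≤ A ^ (1 : ℝ) := Real.rpow_le_rpow_of_exponent_le hA1 (by norm_num)
      _ = A := Real.rpow_one A
  have h3 : (c * y + 1) ^ (2 / 3 : ℝ) - A ^ (2 / 3 : ℝ) ≤ 2 / 3 * (c * (y - x)) := by
    rw [hB, Real.mul_rpow (by linarith) (by linarith)]
    have h4 : 0 ≤ A ^ (2 / 3 : ℝ) := Real.rpow_nonneg (by linarith) _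
    calc _ ≤ A ^ (2 / 3 : ℝ) * (1 + 2 / 3 * (c * (y - x) / A)) - A ^ (2 / 3 : ℝ) := by gcongr
      _ = A ^ (2 / 3 : ℝ) * (2 / 3 * (c * (y - x) / A)) := by ring
      _ ≤ A * (2 / 3 * (c * (y - x) / A)) := by gcongr
      _ = _ := by field_simp
  calc diffusivityG w y - diffusivityG w x
      = 1 / m * ((c * y + 1) ^ (2 / 3 : ℝ) - A ^ (2 / 3 : ℝ)) := by
        rw [diffusivityG, diffusivityG]; ring
    _ ≤ 1 / m * (2 / 3 * (c * (y - x))) := by gcongr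
    _ = _ := by rw [hc]; field_simp

lemma diffusivityG_zero (w : Fin 2 → ℝ) : diffusivityG w 0 = 0 := by simp [diffusivityG]

lemma logScale_antitone (hε : 0 < ε) (hu : 0 < u) (huv : u ≤ v) :
    logScale 2 ε v ≤ logScale 2 ε u := by
  rw [logScale, logScale]
  have : 0 < ε ^ 2 * v := by have := hu.trans_le huv; positivity
  gcongr

lemma diffusivity_antitone (hw : w ≠ 0) (hε : 0 < ε) (hu : 0 < u) (huv : u ≤ v) :
    diffusivity w ε v ≤ diffusivity w ε u := by
  have hm := sum_sq_pos hw
  have h := logScale_antitone hε hu huv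
  have h0 := logScale_nonneg hε (hu.trans_le huv)
  rw [diffusivity, diffusivity, diffusivityG, diffusivityG]
  gcongr

/-- `|G(L^ε(u)) - G(L^ε(v))| ≤ λ_ε² |u - v| / min(u, v)`. -/
lemma abs_diffusivity_sub_le (hw : w ≠ 0) (hε : 0 < ε) (hu : 0 < u) (hv : 0 < v) :
    |diffusivity w ε u - diffusivity w ε v| ≤ coupling 2 ε ^ 2 * (|u - v| / min u v) := by
  wlog huv : u ≤ v generalizing u v
  · rw [abs_sub_comm, abs_sub_comm u, min_comm]
    exact this hv hu (le_of_not_ge huv)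
  rw [abs_of_nonneg (sub_nonneg.2 (diffusivity_antitone hw hε hu huv)), min_eq_left huv,
    abs_sub_comm, abs_of_nonneg (sub_nonneg.2 huv)]
  have h1 := diffusivityG_sub_le hw (logScale_nonneg hε hv) (logScale_antitone hε hu huv)
  have h2 : logScale 2 ε u - logScale 2 ε v ≤ coupling 2 ε ^ 2 * ((v - u) / u) := by
    rw [logScale, logScale, ← mul_sub]
    gcongr
    rw [← Real.log_div (by positivity) (by positivity)]
    have h3 : (1 + 1 / (ε ^ 2 * u)) / (1 + 1 / (ε ^ 2 * v)) ≤ v / u := by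
      have : (1 + 1 / (ε ^ 2 * u)) / (1 + 1 / (ε ^ 2 * v)) =
          v / u * ((ε ^ 2 * u + 1) / (ε ^ 2 * v + 1)) := by field_simp
      rw [this]
      refine mul_le_of_le_one_right (by positivity) ?_
      rw [div_le_one (by positivity)]
      gcongr
    calc _ ≤ (1 + 1 / (ε ^ 2 * u)) / (1 + 1 / (ε ^ 2 * v)) - 1 :=
          Real.log_le_sub_one_of_pos (by positivity)
      _ ≤ v / u - 1 := by gcongr
      _ = _ := by field_simp
  have h4 : 0 ≤ logScale 2 ε u - logScale 2 ε v := sub_nonneg.2 (logScale_antitone hε hu huv)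
  calc _ ≤ (logScale 2 ε u - logScale 2 ε v) / Real.pi := h1
    _ ≤ logScale 2 ε u - logScale 2 ε v := div_le_self h4 (by linarith [Real.pi_gt_three])
    _ ≤ _ := h2

lemma diffusivity_le (hw : w ≠ 0) (hε : 0 < ε) (hu : 0 < u) :
    diffusivity w ε u ≤ coupling 2 ε ^ 2 / Real.pi * Real.log (1 + 1 / (ε ^ 2 * u)) := by
  have := diffusivityG_sub_le hw le_rfl (logScale_nonneg hε hu)
  rw [diffusivityG_zero, sub_zero, sub_zero, logScale] at this
  rw [diffusivity, logScale]
  calc _ ≤ _ := this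
    _ = _ := by ring

lemma diffusivity_le_one (hw : w ≠ 0) (hε : 0 < ε) (hε1 : ε ≤ 1 / 4) (hu : 1 / 2 ≤ u) :
    diffusivity w ε u ≤ 1 := by
  have hu0 : 0 < u := by linarith
  refine (diffusivity_le hw hε hu0).trans ?_
  have hN : 4 ≤ 1 / ε := by rw [le_div_iff₀ hε]; linarith
  have h1 : 1 + 1 / (ε ^ 2 * u) ≤ (1 / ε) ^ 4 := by
    have h2 : 1 / (ε ^ 2 * u) ≤ 2 * (1 / ε) ^ 2 := by
      have : 1 / (ε ^ 2 * u) = 1 / u * (1 / ε) ^ 2 := by field_simp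
      rw [this]
      gcongr
      rw [div_le_iff₀ hu0]
      linarith
    nlinarith [mul_self_nonneg ((1 / ε) ^ 2 - 4), mul_self_le_mul_self (by norm_num) hN]
  have h3 : Real.log (1 + 1 / (ε ^ 2 * u)) ≤ 4 * Real.log (1 / ε) := by
    rw [show (4 : ℝ) * Real.log (1 / ε) = Real.log ((1 / ε) ^ 4) by rw [Real.log_pow]; norm_num]
    exact Real.log_le_log (by positivity) h1
  have h4 : 0 < Real.log (1 / ε) := Real.log_pos (by linarith)
  rw [coupling_two_sq hε (by linarith)]
  calc _ ≤ 1 / (2 * Real.log (1 / ε)) / Real.pi * (4 * Real.log (1 / ε)) := by gcongr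
    _ = 2 / Real.pi := by field_simp; norm_num
    _ ≤ 1 := by rw [div_le_one Real.pi_pos]; linarith [Real.pi_gt_three]

lemma coupling_two_sq_le_one (hε : 0 < ε) (hε1 : ε ≤ 1 / 4) : coupling 2 ε ^ 2 ≤ 1 := by
  rw [coupling_two_sq hε (by linarith)]
  have h : Real.log 4 ≤ Real.log (1 / ε) :=
    Real.log_le_log (by norm_num) (by rw [le_div_iff₀ hε]; linarith)
  have h2 : Real.log 4 = 2 * Real.log 2 := by
    rw [show (4 : ℝ) = 2 ^ 2 by norm_num, Real.log_pow]; norm_num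
  have := Real.log_two_gt_d9
  rw [div_le_one (by linarith)]
  linarith

/-- The differential equation satisfied by the effective diffusivity. -/
lemma hasDerivAt_diffusivity (hw : w ≠ 0) (hε : 0 < ε) (hu : 0 < u) :
    HasDerivAt (diffusivity w ε)
      (-(coupling 2 ε ^ 2 / Real.pi *
        (1 / (u * (1 + ε ^ 2 * u) * Real.sqrt (1 + (∑ b, w b ^ 2) * diffusivity w ε u))))) u := by
  have hm := sum_sq_pos hw
  have hB := one_le_diffusivityBase (w := w) hε hu
  have h1 : HasDerivAt (fun u => 1 + 1 / (ε ^ 2 * u)) (-(1 / (ε ^ 2 * u ^ 2))) u := by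
    have := (((hasDerivAt_id u).const_mul (ε ^ 2)).fun_inv (mul_pos (by positivity) hu).ne').const_add 1
    simp only [id] at this
    simp only [one_div]
    refine this.congr_deriv ?_
    field_simp
  have h2 := (h1.log (by positivity)).const_mul (coupling 2 ε ^ 2)
  have h3 : HasDerivAt (diffusivityBase w ε) _ u :=
    ((h2.const_mul (3 * (∑ b, w b ^ 2) / (2 * Real.pi))).add_const 1)
  have h4 := ((h3.rpow_const (p := 2 / 3) (Or.inl (by linarith))).sub_const 1).const_mul
    (1 / ∑ b, w b ^ 2)
  have h5 : (fun u => 1 / (∑ b, w b ^ 2) * (diffusivityBase w ε u ^ (2 / 3 : ℝ) - 1)) =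
      diffusivity w ε := by
    funext u; rw [diffusivity, diffusivityG, diffusivityBase]
  rw [h5] at h4
  refine h4.congr_deriv ?_
  rw [sqrt_one_add_diffusivity hw hε hu, show (2 / 3 - 1 : ℝ) = -(1 / 3) by norm_num,
    Real.rpow_neg (by linarith)]
  have : 0 < diffusivityBase w ε u ^ (1 / 3 : ℝ) := Real.rpow_pos_of_pos (by linarith) _
  field_simp
  ring

end Diffusivity

/-! ### Integrals in the plane -/

/-- The angular average of the symbol. -/
lemma integral_angular {a b : ℝ} (ha : 0 < a) (hb : 0 ≤ b) (w : Fin 2 → ℝ) :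
    ∫ θ in -Real.pi..Real.pi, 1 / (a + b * (w 0 * Real.cos θ + w 1 * Real.sin θ) ^ 2) =
      2 * Real.pi / Real.sqrt (a * (a + b * ∑ i, w i ^ 2)) := by
  rw [Fin.sum_univ_two]
  set m := w 0 ^ 2 + w 1 ^ 2 with hm
  have hm0 : 0 ≤ m := by positivity
  set Δ := Real.sqrt (a * (a + b * m)) with hΔ
  have hΔ0 : 0 < Δ := Real.sqrt_pos.2 (by positivity)
  have hΔ2 : Δ ^ 2 = a * (a + b * m) := Real.sq_sqrt (by positivity)
  set α := a + b * m / 2 with hα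
  set β := b * (w 0 ^ 2 - w 1 ^ 2) / 2 with hβ
  set γ := b * (w 0 * w 1) with hγ
  have hz : ∀ θ, a + b * (w 0 * Real.cos θ + w 1 * Real.sin θ) ^ 2 =
      α + (β * Real.cos (2 * θ) + γ * Real.sin (2 * θ)) := by
    intro θ
    rw [Real.cos_two_mul, Real.sin_two_mul, hα, hβ, hγ, hm]
    linear_combination (b * w 1 ^ 2) * Real.sin_sq_add_cos_sq θ
  have hpos : ∀ θ, 0 < α + (β * Real.cos (2 * θ) + γ * Real.sin (2 * θ)) := fun θ => by
    rw [← hz]; positivity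
  set F : ℝ → ℝ := fun θ => 1 / (2 * Δ) * (2 * θ - 2 * Real.arctan
    ((β * Real.sin (2 * θ) - γ * Real.cos (2 * θ)) /
      (α + Δ + (β * Real.cos (2 * θ) + γ * Real.sin (2 * θ))))) with hF
  have hderiv : ∀ θ, HasDerivAt F (1 / (a + b * (w 0 * Real.cos θ + w 1 * Real.sin θ) ^ 2)) θ := by
    intro θ
    have h2 : HasDerivAt (fun θ : ℝ => 2 * θ) 2 θ := by
      simpa using (hasDerivAt_id θ).const_mul (2 : ℝ)
    have hs := h2.sin
    have hc := h2.cos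
    have hn := (hs.const_mul β).fun_sub (hc.const_mul γ)
    have he := (((hc.const_mul β).fun_add (hs.const_mul γ))).const_add (α + Δ)
    have hp := hpos θ
    have he0 : α + Δ + (β * Real.cos (2 * θ) + γ * Real.sin (2 * θ)) ≠ 0 := by linarith
    have := ((h2.fun_sub (((hn.fun_div he he0).arctan).const_mul 2))).const_mul (1 / (2 * Δ))
    refine this.congr_deriv ?_
    rw [hz θ]
    have hcs := Real.sin_sq_add_cos_sq (2 * θ)
    set s := Real.sin (2 * θ)
    set c := Real.cos (2 * θ)
    have hrel : α ^ 2 - β ^ 2 - γ ^ 2 = Δ ^ 2 := by rw [hΔ2, hα, hβ, hγ, hm]; ring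
    set e := α + Δ + (β * c + γ * s) with he_def
    have hq : (β * s - γ * c) ^ 2 = α ^ 2 - Δ ^ 2 - (β * c + γ * s) ^ 2 := by
      linear_combination (β ^ 2 + γ ^ 2) * hcs - hrel
    have hk : e ^ 2 + (β * s - γ * c) ^ 2 = 2 * (α + Δ) * (α + (β * c + γ * s)) := by
      rw [hq, he_def]; ring
    have hk0 : 0 < α + Δ := by
      have : 0 ≤ b * m / 2 := by positivity
      linarith
    have h1 : 1 + ((β * s - γ * c) / e) ^ 2 = 2 * (α + Δ) * (α + (β * c + γ * s)) / e ^ 2 := by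
      rw [← hk]; field_simp
    rw [h1]
    have h5 : β * (c * 2) - γ * (-s * 2) = 2 * (β * c + γ * s) := by ring
    have h6 : (β * (c * 2) - γ * (-s * 2)) * e - (β * s - γ * c) * (β * (-s * 2) + γ * (c * 2)) =
        2 * (α + Δ) * (α + (β * c + γ * s) - Δ) := by
      have : (β * (c * 2) - γ * (-s * 2)) * e - (β * s - γ * c) * (β * (-s * 2) + γ * (c * 2)) =
        2 * (β * c + γ * s) * e + 2 * (β * s - γ * c) ^ 2 := by ring
      rw [this, hq, he_def]; ring
    rw [h6]
    have hp' := hp.ne'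
    field_simp
    ring
  have hcont : Continuous fun θ => 1 / (a + b * (w 0 * Real.cos θ + w 1 * Real.sin θ) ^ 2) :=
    continuous_const.div (by fun_prop) fun θ => by positivity
  rw [intervalIntegral.integral_eq_sub_of_hasDerivAt (fun θ _ => hderiv θ)
    (hcont.intervalIntegrable _ _), hF]
  have e1 : Real.sin (2 * -Real.pi) = 0 := by rw [mul_neg, Real.sin_neg, Real.sin_two_pi, neg_zero]
  have e2 : Real.cos (2 * -Real.pi) = 1 := by rw [mul_neg, Real.cos_neg, Real.cos_two_pi]
  simp only [Real.sin_two_pi, Real.cos_two_pi, e1, e2]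
  field_simp
  ring

section Plane

open MeasureTheory

variable {w : Fin 2 → ℝ} {ε s R : ℝ}

lemma lintegral_floor (F : ℤ → ℝ≥0∞) : ∫⁻ x : ℝ, F ⌊x⌋ = ∑' n, F n := by
  rw [← setLIntegral_univ, ← iUnion_Ico_intCast ℝ,
    lintegral_iUnion (fun _ => measurableSet_Ico) (Set.pairwise_disjoint_Ico_intCast ℝ)]
  refine tsum_congr fun n => ?_
  rw [setLIntegral_congr_fun measurableSet_Ico (g := fun _ => F n) fun x hx => by
    simp only [Int.floor_eq_iff.2 ⟨hx.1, hx.2⟩]]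
  simp

/-- A sum over `ℤ²` is the integral over the plane of the function which is constant on the unit
squares with integer corners. -/
lemma lintegral_floor_prod (F : (Fin 2 → ℤ) → ℝ≥0∞) :
    ∫⁻ x : ℝ × ℝ, F ![⌊x.1⌋, ⌊x.2⌋] = ∑' l, F l := by
  have hm : Measurable fun x : ℝ × ℝ => F ![⌊x.1⌋, ⌊x.2⌋] := by
    have h : Measurable fun p : ℤ × ℤ => F ![p.1, p.2] := .of_discrete
    exact h.comp ((Int.measurable_floor.comp measurable_fst).prodMk
      (Int.measurable_floor.comp measurable_snd))
  rw [Measure.volume_eq_prod, lintegral_prod _ hm.aemeasurable]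
  simp only
  have h1 : ∀ x : ℝ, ∫⁻ y : ℝ, F ![⌊x⌋, ⌊y⌋] = ∑' n, F ![⌊x⌋, n] :=
    fun x => lintegral_floor fun n => F ![⌊x⌋, n]
  simp only [h1]
  rw [lintegral_floor fun m => ∑' n, F ![m, n], ← (finTwoArrowEquiv ℤ).symm.tsum_eq F,
    ENNReal.tsum_prod']
  rfl

/-- The continuum version of the symbol of the ansatz. -/
def planeSymbol (w : Fin 2 → ℝ) (ε s : ℝ) (x : ℝ × ℝ) : ℝ :=
  1 / (x.1 ^ 2 + x.2 ^ 2 + s +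
    (w 0 * x.1 + w 1 * x.2) ^ 2 * diffusivity w ε (x.1 ^ 2 + x.2 ^ 2 + s))

/-- The integral of `planeSymbol` over the circle of radius `r`. -/
def radialDensity (w : Fin 2 → ℝ) (ε s r : ℝ) : ℝ :=
  r * (2 * Real.pi / Real.sqrt ((r ^ 2 + s) *
    (r ^ 2 + s + r ^ 2 * diffusivity w ε (r ^ 2 + s) * ∑ b, w b ^ 2)))

lemma measurable_diffusivity : Measurable (diffusivity w ε) := by
  unfold diffusivity diffusivityG logScale
  fun_prop

lemma measurable_planeSymbol : Measurable (planeSymbol w ε s) := by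
  have := measurable_diffusivity (w := w) (ε := ε)
  unfold planeSymbol
  fun_prop

lemma continuousOn_radialDensity (hw : w ≠ 0) (hε : 0 < ε) (hs : 0 < s) :
    Continuous (radialDensity w ε s) := by
  have h : ∀ r : ℝ, 0 < r ^ 2 + s := fun r => by positivity
  have h1 : Continuous fun r : ℝ => diffusivity w ε (r ^ 2 + s) := by
    rw [continuous_iff_continuousAt]
    intro r
    exact (hasDerivAt_diffusivity hw hε (h r)).continuousAt.comp
      (f := fun r : ℝ => r ^ 2 + s) (by fun_prop)
  refine continuous_id.mul (continuous_const.div (by fun_prop) fun r => ?_)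
  have h2 := diffusivity_nonneg hw hε (h r)
  have h3 := sum_sq_pos hw
  have h4 := h r
  positivity

lemma radialDensity_nonneg {r : ℝ} (hr : 0 ≤ r) : 0 ≤ radialDensity w ε s r := by
  have := Real.pi_pos
  rw [radialDensity]
  positivity

/-- The integral over a disc in polar coordinates. -/
lemma lintegral_disc (hw : w ≠ 0) (hε : 0 < ε) (hs : 0 < s) (hR : 0 ≤ R) :
    ∫⁻ x : ℝ × ℝ, (if x.1 ^ 2 + x.2 ^ 2 < R ^ 2 then ENNReal.ofReal (planeSymbol w ε s x) else 0) =
      ENNReal.ofReal (∫ r in 0..R, radialDensity w ε s r) := by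
  set f : ℝ × ℝ → ℝ≥0∞ := fun x =>
    if x.1 ^ 2 + x.2 ^ 2 < R ^ 2 then ENNReal.ofReal (planeSymbol w ε s x) else 0 with hf
  have hfm : Measurable f :=
    Measurable.ite (measurableSet_lt (by fun_prop) (by fun_prop))
      measurable_planeSymbol.ennreal_ofReal measurable_const
  have hpm : Measurable fun p : ℝ × ℝ => ENNReal.ofReal p.1 • f (polarCoord.symm p) :=
    (measurable_fst.ennreal_ofReal).mul (hfm.comp continuous_polarCoord_symm.measurable)
  rw [← lintegral_comp_polarCoord_symm, polarCoord_target, Measure.volume_eq_prod,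
    setLIntegral_prod _ hpm.aemeasurable]
  have hinner : ∀ r ∈ Set.Ioi (0 : ℝ),
      ∫⁻ θ in Set.Ioo (-Real.pi) Real.pi,
        ENNReal.ofReal (r, θ).1 • f (polarCoord.symm (r, θ)) =
      (Set.Ioo 0 R).indicator (fun r => ENNReal.ofReal (radialDensity w ε s r)) r := by
    intro r hr
    have hr0 : (0 : ℝ) < r := hr
    have hsq : ∀ θ, (r * Real.cos θ) ^ 2 + (r * Real.sin θ) ^ 2 = r ^ 2 := fun θ => by
      linear_combination r ^ 2 * Real.sin_sq_add_cos_sq θ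
    have hu : 0 < r ^ 2 + s := by positivity
    have hΦ := diffusivity_nonneg hw hε hu
    simp only [hf, polarCoord_symm_apply, hsq, planeSymbol, smul_eq_mul]
    by_cases h : r < R
    · rw [Set.indicator_of_mem (Set.mem_Ioo.2 ⟨hr0, h⟩)]
      have h2 : r ^ 2 < R ^ 2 := by gcongr
      simp only [h2, if_true]
      rw [lintegral_const_mul _ (by fun_prop)]
      have hcont : Continuous fun θ => 1 / (r ^ 2 + s +
          (w 0 * (r * Real.cos θ) + w 1 * (r * Real.sin θ)) ^ 2 * diffusivity w ε (r ^ 2 + s)) :=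
        continuous_const.div (by fun_prop) fun θ => by positivity
      rw [radialDensity, ENNReal.ofReal_mul hr0.le, ← integral_angular hu (by positivity),
        intervalIntegral.integral_of_le (by linarith [Real.pi_pos]),
        integral_Ioc_eq_integral_Ioo, ← ofReal_integral_eq_lintegral_ofReal]
      · congr 3
        funext θ
        ring_nf
      · exact (hcont.integrableOn_Icc).mono_set Set.Ioo_subset_Icc_self
      · exact Filter.Eventually.of_forall fun θ => by positivity
    · rw [Set.indicator_of_notMem (fun h' => h h'.2)]
      have h2 : ¬ r ^ 2 < R ^ 2 := by
        rw [not_lt] at h ⊢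
        gcongr
      simp [h2]
  rw [setLIntegral_congr_fun measurableSet_Ioi hinner, lintegral_indicator measurableSet_Ioo,
    Measure.restrict_restrict measurableSet_Ioo,
    Set.inter_eq_left.2 (Set.Ioo_subset_Ioi_self : Set.Ioo 0 R ⊆ Set.Ioi 0),
    intervalIntegral.integral_of_le hR, integral_Ioc_eq_integral_Ioo,
    ofReal_integral_eq_lintegral_ofReal]
  · exact (continuousOn_radialDensity hw hε hs).integrableOn_Icc.mono_set Set.Ioo_subset_Icc_self
  · filter_upwards [ae_restrict_mem measurableSet_Ioo] with r hr
    exact radialDensity_nonneg hr.1.le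

lemma hasDerivAt_sq_add (r : ℝ) : HasDerivAt (fun r : ℝ => r ^ 2 + s) (2 * r) r := by
  simpa using (hasDerivAt_pow 2 r).add_const s

lemma hasDerivAt_diffusivity_sq (hw : w ≠ 0) (hε : 0 < ε) (hs : 0 < s) (r : ℝ) :
    HasDerivAt (fun r => diffusivity w ε (r ^ 2 + s)) (-(coupling 2 ε ^ 2 / Real.pi *
        (1 / ((r ^ 2 + s) * (1 + ε ^ 2 * (r ^ 2 + s)) *
          Real.sqrt (1 + (∑ b, w b ^ 2) * diffusivity w ε (r ^ 2 + s))))) * (2 * r)) r :=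
  HasDerivAt.comp (h₂ := diffusivity w ε) r
    (hasDerivAt_diffusivity hw hε (by positivity)) (hasDerivAt_sq_add r)

lemma le_integral_radialDensity (hw : w ≠ 0) (hε : 0 < ε) (hs : 0 < s) (hR : 0 ≤ R) :
    Real.pi ^ 2 * (diffusivity w ε s - diffusivity w ε (R ^ 2 + s)) ≤
      coupling 2 ε ^ 2 * ∫ r in 0..R, radialDensity w ε s r := by
  rw [← intervalIntegral.integral_const_mul]
  have hm := sum_sq_pos hw
  have hd : ∀ r, HasDerivAt (fun r => -Real.pi ^ 2 * diffusivity w ε (r ^ 2 + s)) _ r :=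
    fun r => (hasDerivAt_diffusivity_sq hw hε hs r).const_mul (-Real.pi ^ 2)
  have := intervalIntegral.sub_le_integral_of_hasDeriv_right_of_le hR
    (fun r _ => (hd r).continuousAt.continuousWithinAt) (fun r _ => (hd r).hasDerivWithinAt)
    (φ := fun r => coupling 2 ε ^ 2 * radialDensity w ε s r)
    (((continuousOn_radialDensity hw hε hs).const_mul _).integrableOn_Icc) ?_
  · calc _ = _ := by
          rw [zero_pow two_ne_zero, zero_add]
          ring
      _ ≤ _ := this
  · intro r hr
    have hr0 : 0 < r := hr.1
    set u := r ^ 2 + s with hu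
    have hu0 : 0 < u := by positivity
    have hΦ := diffusivity_nonneg hw hε hu0
    set P := Real.sqrt (1 + (∑ b, w b ^ 2) * diffusivity w ε u) with hP
    have hP0 : 0 < P := Real.sqrt_pos.2 (by positivity)
    have h1 : Real.sqrt (u * (u + r ^ 2 * diffusivity w ε u * ∑ b, w b ^ 2)) ≤ u * P := by
      rw [hP, Real.sqrt_le_left (by positivity), mul_pow, Real.sq_sqrt (by positivity)]
      have : r ^ 2 ≤ u := by linarith
      calc _ ≤ u * (u + u * diffusivity w ε u * ∑ b, w b ^ 2) := by gcongr
        _ = _ := by ring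
    have h2 : 0 < Real.sqrt (u * (u + r ^ 2 * diffusivity w ε u * ∑ b, w b ^ 2)) :=
      Real.sqrt_pos.2 (by positivity)
    have hpi := Real.pi_pos
    calc _ = coupling 2 ε ^ 2 * (r * (2 * Real.pi / (u * P * (1 + ε ^ 2 * u)))) := by
          field_simp
      _ ≤ coupling 2 ε ^ 2 * (r * (2 * Real.pi / (u * P * 1))) := by
          gcongr
          have : 0 ≤ ε ^ 2 * u := by positivity
          linarith
      _ ≤ _ := by
          rw [radialDensity, mul_one]
          gcongr

lemma integral_radialDensity_le (hw : w ≠ 0) (hε : 0 < ε) (hε1 : ε ≤ 1 / 4) (hs : 1 / 2 ≤ s)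
    (hR : 0 ≤ R) :
    coupling 2 ε ^ 2 * ∫ r in 0..R, radialDensity w ε s r ≤
      Real.pi ^ 2 * diffusivity w ε s + coupling 2 ε ^ 2 *
        (Real.pi * Real.log (1 + ε ^ 2 * R ^ 2) + Real.pi * (∑ b, w b ^ 2) / 2) := by
  rw [← intervalIntegral.integral_const_mul]
  have hs0 : 0 < s := by linarith
  have hm := sum_sq_pos hw
  have hpi := Real.pi_pos
  have hd1 : ∀ r : ℝ, HasDerivAt (fun r : ℝ => Real.log (1 + ε ^ 2 * (r ^ 2 + s)))
      (ε ^ 2 * (2 * r) / (1 + ε ^ 2 * (r ^ 2 + s))) r := fun r =>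
    (((hasDerivAt_sq_add r).const_mul (ε ^ 2)).const_add 1).log (by positivity)
  have hd2 : ∀ r : ℝ, HasDerivAt (fun r : ℝ => (r ^ 2 + s)⁻¹) (-(2 * r) / (r ^ 2 + s) ^ 2) r :=
    fun r => (hasDerivAt_sq_add r).fun_inv (by positivity)
  have hd : ∀ r, HasDerivAt (fun r => -Real.pi ^ 2 * diffusivity w ε (r ^ 2 + s) +
      Real.pi * coupling 2 ε ^ 2 * Real.log (1 + ε ^ 2 * (r ^ 2 + s)) +
      -(Real.pi * coupling 2 ε ^ 2 * (∑ b, w b ^ 2) * s / 2) * (r ^ 2 + s)⁻¹) _ r :=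
    fun r => (((hasDerivAt_diffusivity_sq hw hε hs0 r).const_mul (-Real.pi ^ 2)).fun_add
      ((hd1 r).const_mul (Real.pi * coupling 2 ε ^ 2))).fun_add
      ((hd2 r).const_mul (-(Real.pi * coupling 2 ε ^ 2 * (∑ b, w b ^ 2) * s / 2)))
  have := intervalIntegral.integral_le_sub_of_hasDeriv_right_of_le hR
    (fun r _ => (hd r).continuousAt.continuousWithinAt) (fun r _ => (hd r).hasDerivWithinAt)
    (φ := fun r => coupling 2 ε ^ 2 * radialDensity w ε s r)
    (((continuousOn_radialDensity hw hε hs0).const_mul _).integrableOn_Icc) ?_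
  · refine this.trans ?_
    have hΦ := diffusivity_nonneg hw hε (show 0 < R ^ 2 + s by positivity)
    have h1 : Real.log (1 + ε ^ 2 * (R ^ 2 + s)) ≤
        Real.log (1 + ε ^ 2 * R ^ 2) + Real.log (1 + ε ^ 2 * s) := by
      rw [← Real.log_mul (by positivity) (by positivity)]
      refine Real.log_le_log (by positivity) ?_
      have : 0 ≤ ε ^ 2 * R ^ 2 * (ε ^ 2 * s) := by positivity
      nlinarith
    have h2 : 0 ≤ Real.pi * coupling 2 ε ^ 2 * (∑ b, w b ^ 2) * s / 2 * (R ^ 2 + s)⁻¹ := by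
      positivity
    have h3 : Real.pi * coupling 2 ε ^ 2 * (∑ b, w b ^ 2) * s / 2 * s⁻¹ =
        Real.pi * coupling 2 ε ^ 2 * (∑ b, w b ^ 2) / 2 := by field_simp
    have h4 : Real.pi * coupling 2 ε ^ 2 * Real.log (1 + ε ^ 2 * (R ^ 2 + s)) ≤
        Real.pi * coupling 2 ε ^ 2 * (Real.log (1 + ε ^ 2 * R ^ 2) + Real.log (1 + ε ^ 2 * s)) := by
      gcongr
    simp only [zero_pow two_ne_zero, zero_add]
    nlinarith [mul_nonneg (sq_nonneg Real.pi) hΦ]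
  · intro r hr
    have hr0 : 0 < r := hr.1
    rw [radialDensity]
    set u := r ^ 2 + s with hu
    have hu0 : 0 < u := by positivity
    have hΦ := diffusivity_nonneg hw hε hu0
    have hΦ1 : diffusivity w ε u ≤ 1 := diffusivity_le_one hw hε hε1 (by nlinarith)
    set m := ∑ b, w b ^ 2 with hm_def
    set P := Real.sqrt (1 + m * diffusivity w ε u) with hP
    have hPsq : P ^ 2 = 1 + m * diffusivity w ε u := Real.sq_sqrt (by positivity)
    have hP1 : 1 ≤ P := by
      rw [hP, Real.one_le_sqrt]
      have : 0 ≤ m * diffusivity w ε u := by positivity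
      linarith
    set a := Real.sqrt (u * (u + r ^ 2 * diffusivity w ε u * m)) with ha
    have hasq : a ^ 2 = u * (u + r ^ 2 * diffusivity w ε u * m) := Real.sq_sqrt (by positivity)
    have hau : u ≤ a := by
      rw [ha]
      refine Real.le_sqrt_of_sq_le ?_
      have : 0 ≤ r ^ 2 * diffusivity w ε u * m := by positivity
      nlinarith
    have hb : u ≤ u * P := le_mul_of_one_le_right hu0.le hP1
    have ha0 : 0 < a := hu0.trans_le hau
    have hP0 : 0 < P := by linarith
    -- the defect `u - r² = s` only contributes an error of order `s / u²`
    have key : 1 / a ≤ 1 / (u * P) + m * s / (2 * u ^ 2) := by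
      have h1 : (u * P) ^ 2 - a ^ 2 ≤ u * m * s := by
        rw [mul_pow, hPsq, hasq]
        have : u * m * s * diffusivity w ε u ≤ u * m * s * 1 := by gcongr
        rw [hu] at this ⊢
        nlinarith
      have h2 : 1 / a - 1 / (u * P) = ((u * P) ^ 2 - a ^ 2) / (a * (u * P) * (a + u * P)) := by
        field_simp
        ring
      have h3 : ((u * P) ^ 2 - a ^ 2) / (a * (u * P) * (a + u * P)) ≤
          u * m * s / (u * u * (u + u)) := by gcongr
      have h4 : u * m * s / (u * u * (u + u)) = m * s / (2 * u ^ 2) := by field_simp; ring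
      linarith
    have key2 : 1 / (u * P) ≤ 1 / (u * (1 + ε ^ 2 * u) * P) + ε ^ 2 / (1 + ε ^ 2 * u) := by
      have h1 : 1 / (u * P) = 1 / (u * (1 + ε ^ 2 * u) * P) + ε ^ 2 / ((1 + ε ^ 2 * u) * P) := by
        field_simp
      rw [h1]
      gcongr
      exact le_mul_of_one_le_right (by positivity) hP1
    calc _ = coupling 2 ε ^ 2 * (2 * Real.pi * r) * (1 / a) := by ring
      _ ≤ coupling 2 ε ^ 2 * (2 * Real.pi * r) * (1 / (u * (1 + ε ^ 2 * u) * P) +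
          ε ^ 2 / (1 + ε ^ 2 * u) + m * s / (2 * u ^ 2)) := by gcongr; linarith
      _ = _ := by field_simp

end Plane

/-! ### The diagonal part of the self-energy -/

section Diagonal

open MeasureTheory

variable {w : Fin 2 → ℝ} {ε : ℝ}

/-- The ansatz symbol of the modes `l`, `p - l` and further modes, whose squares sum up to
`κ - |p|²` and whose squared products with `w` sum up to `W`, as a function of real `l`. -/
def pairSymbol (w : Fin 2 → ℝ) (ε κ W p₁ p₂ l₁ l₂ : ℝ) : ℝ :=
  1 / (l₁ ^ 2 + l₂ ^ 2 - (p₁ * l₁ + p₂ * l₂) + κ / 2 +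
    (((w 0 * l₁ + w 1 * l₂) ^ 2 + (w 0 * (p₁ - l₁) + w 1 * (p₂ - l₂)) ^ 2 + W) / 2) *
      diffusivity w ε (l₁ ^ 2 + l₂ ^ 2 - (p₁ * l₁ + p₂ * l₂) + κ / 2))

lemma pairSymbol_arg_ge {κ p₁ p₂ : ℝ} (hp : p₁ ^ 2 + p₂ ^ 2 ≤ κ) (l₁ l₂ : ℝ) :
    (l₁ ^ 2 + l₂ ^ 2 + κ) / 8 ≤ l₁ ^ 2 + l₂ ^ 2 - (p₁ * l₁ + p₂ * l₂) + κ / 2 := by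
  nlinarith [sq_nonneg (3 * p₁ - 4 * l₁), sq_nonneg (3 * p₂ - 4 * l₂), sq_nonneg l₁,
    sq_nonneg l₂]

lemma pairSymbol_nonneg (hw : w ≠ 0) (hε : 0 < ε) {κ W p₁ p₂ : ℝ} (hκ : 1 ≤ κ)
    (hp : p₁ ^ 2 + p₂ ^ 2 ≤ κ) (hW : 0 ≤ W) (l₁ l₂ : ℝ) :
    0 ≤ pairSymbol w ε κ W p₁ p₂ l₁ l₂ := by
  have h := pairSymbol_arg_ge hp l₁ l₂
  have h1 : 0 < l₁ ^ 2 + l₂ ^ 2 - (p₁ * l₁ + p₂ * l₂) + κ / 2 := by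
    have : 0 < (l₁ ^ 2 + l₂ ^ 2 + κ) / 8 := by positivity
    linarith
  have h2 := diffusivity_nonneg hw hε h1
  rw [pairSymbol]
  positivity

lemma planeSymbol_arg_ge {κ l₁ l₂ t₁ t₂ : ℝ} (hκ : 1 ≤ κ) (ht₁ : |t₁| ≤ 1) (ht₂ : |t₂| ≤ 1) :
    (l₁ ^ 2 + l₂ ^ 2 + κ) / 10 ≤ (l₁ + t₁) ^ 2 + (l₂ + t₂) ^ 2 + κ / 2 := by
  have h1 : t₁ ^ 2 ≤ 1 := by rw [sq_le_one_iff_abs_le_one]; exact ht₁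
  have h2 : t₂ ^ 2 ≤ 1 := by rw [sq_le_one_iff_abs_le_one]; exact ht₂
  nlinarith [sq_nonneg (l₁ + 2 * t₁), sq_nonneg (l₂ + 2 * t₂), sq_nonneg (3 * l₁ + 4 * t₁), sq_nonneg (3 * l₂ + 4 * t₂),
    sq_nonneg (l₁ + t₁), sq_nonneg (l₂ + t₂)]

set_option maxHeartbeats 800000 in
/-- On a unit square the symbol of the ansatz differs from its continuum version by the summable
kernel `K / (|l|² + K²)^(3/2)`. -/
lemma abs_pairSymbol_sub_le (hw : w ≠ 0) (hε : 0 < ε) (hε1 : ε ≤ 1 / 4) {κ W p₁ p₂ l₁ l₂ t₁ t₂ : ℝ}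
    (hκ : 1 ≤ κ) (hp : p₁ ^ 2 + p₂ ^ 2 ≤ κ) (hW : 0 ≤ W)
    (hW1 : W ≤ (∑ b, w b ^ 2) * (κ - (p₁ ^ 2 + p₂ ^ 2))) (ht₁ : |t₁| ≤ 1) (ht₂ : |t₂| ≤ 1) :
    |pairSymbol w ε κ W p₁ p₂ l₁ l₂ - planeSymbol w ε (κ / 2) (l₁ + t₁, l₂ + t₂)| ≤
      80 * (7 + 147 * ∑ b, w b ^ 2) * (Real.sqrt κ / Real.sqrt (l₁ ^ 2 + l₂ ^ 2 + κ) ^ 3) := by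
  have hm0 := sum_sq_pos hw
  have hc1 := coupling_two_sq_le_one hε hε1
  have hVge := pairSymbol_arg_ge hp l₁ l₂
  have huge := planeSymbol_arg_ge (l₁ := l₁) (l₂ := l₂) hκ ht₁ ht₂
  rw [Fin.sum_univ_two] at hm0 hW1 ⊢
  set m := w 0 ^ 2 + w 1 ^ 2 with hm
  set K := Real.sqrt κ with hK
  set q := Real.sqrt (l₁ ^ 2 + l₂ ^ 2 + κ) with hq
  have hKsq : K ^ 2 = κ := Real.sq_sqrt (by linarith)
  have hqsq : q ^ 2 = l₁ ^ 2 + l₂ ^ 2 + κ := Real.sq_sqrt (by positivity)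
  have hK1 : 1 ≤ K := Real.one_le_sqrt.2 hκ
  have hKq : K ≤ q := Real.sqrt_le_sqrt (by linarith [sq_nonneg l₁, sq_nonneg l₂])
  have hq1 : 1 ≤ q := hK1.trans hKq
  rw [pairSymbol, planeSymbol]
  simp only
  set V := l₁ ^ 2 + l₂ ^ 2 - (p₁ * l₁ + p₂ * l₂) + κ / 2 with hV
  set u := (l₁ + t₁) ^ 2 + (l₂ + t₂) ^ 2 + κ / 2 with hu
  rw [← hqsq] at hVge huge
  have hKqq : q ≤ K * q := le_mul_of_one_le_left (by linarith) hK1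
  have h1Kq : 1 ≤ K * q := hq1.trans hKqq
  have hV0 : 0 < V := lt_of_lt_of_le (by positivity) hVge
  have hu0 : 0 < u := lt_of_lt_of_le (by positivity) huge
  have habs : ∀ {x y : ℝ}, 0 ≤ y → x ^ 2 ≤ y ^ 2 → |x| ≤ y := fun hy h => abs_le_of_sq_le_sq h hy
  have hl1 : |l₁| ≤ q := habs (by linarith) (by rw [hqsq]; linarith [sq_nonneg l₂])
  have hl2 : |l₂| ≤ q := habs (by linarith) (by rw [hqsq]; linarith [sq_nonneg l₁])
  have hKq2 : K ^ 2 ≤ K * q := by rw [sq]; gcongr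
  have hpl : |p₁ * l₁ + p₂ * l₂| ≤ K * q := by
    refine habs (by positivity) ?_
    calc (p₁ * l₁ + p₂ * l₂) ^ 2 ≤ (p₁ ^ 2 + p₂ ^ 2) * (l₁ ^ 2 + l₂ ^ 2) := by
          nlinarith [sq_nonneg (p₁ * l₂ - p₂ * l₁)]
      _ ≤ κ * q ^ 2 := by
          gcongr
          linarith
      _ = _ := by rw [← hKsq]; ring
  have htl1 : |t₁ * l₁| ≤ q := by
    rw [abs_mul]
    exact (mul_le_of_le_one_left (abs_nonneg _) ht₁).trans hl1
  have htl2 : |t₂ * l₂| ≤ q := by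
    rw [abs_mul]
    exact (mul_le_of_le_one_left (abs_nonneg _) ht₂).trans hl2
  have ht1s : t₁ ^ 2 ≤ 1 := by rw [sq_le_one_iff_abs_le_one]; exact ht₁
  have ht2s : t₂ ^ 2 ≤ 1 := by rw [sq_le_one_iff_abs_le_one]; exact ht₂
  rw [abs_le] at hpl htl1 htl2
  have hδ : |V - u| ≤ 7 * (K * q) := by
    have : V - u = -(p₁ * l₁ + p₂ * l₂) - 2 * (t₁ * l₁) - 2 * (t₂ * l₂) - t₁ ^ 2 - t₂ ^ 2 := by
      rw [hV, hu]; ring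
    rw [this, abs_le]
    constructor <;> linarith [sq_nonneg t₁, sq_nonneg t₂, hpl.1, hpl.2, htl1.1, htl1.2, htl2.1,
      htl2.2]
  have hVle : V ≤ 2 * q ^ 2 := by
    have : K * q ≤ q ^ 2 := by rw [sq]; gcongr
    rw [hV]
    linarith [hpl.1, sq_nonneg l₁, sq_nonneg l₂]
  have hΦu0 := diffusivity_nonneg hw hε hu0
  have hΦV0 := diffusivity_nonneg hw hε hV0
  have hΦu1 : diffusivity w ε u ≤ 1 := diffusivity_le_one hw hε hε1 (by
    have : κ / 2 ≤ u := by rw [hu]; linarith [sq_nonneg (l₁ + t₁), sq_nonneg (l₂ + t₂)]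
    linarith)
  have hΦ : |diffusivity w ε V - diffusivity w ε u| ≤ 70 * (K / q) := by
    have hmin : q ^ 2 / 10 ≤ min V u := le_min (by linarith [sq_nonneg q]) huge
    calc _ ≤ coupling 2 ε ^ 2 * (|V - u| / min V u) := abs_diffusivity_sub_le hw hε hV0 hu0
      _ ≤ 1 * (7 * (K * q) / (q ^ 2 / 10)) := by gcongr
      _ = _ := by field_simp; norm_num
  set a := w 0 * l₁ + w 1 * l₂ with ha
  set b := w 0 * p₁ + w 1 * p₂ with hb
  set t := w 0 * t₁ + w 1 * t₂ with ht
  have hcs : ∀ x y : ℝ, (w 0 * x + w 1 * y) ^ 2 ≤ m * (x ^ 2 + y ^ 2) := fun x y => by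
    rw [hm]; nlinarith [sq_nonneg (w 0 * y - w 1 * x)]
  have hprod : ∀ {x y X Y : ℝ}, 0 ≤ X → 0 ≤ Y → x ^ 2 ≤ m * X ^ 2 → y ^ 2 ≤ m * Y ^ 2 →
      |x * y| ≤ m * (X * Y) := fun {x y X Y} hX hY hx hy => by
    refine habs (by positivity) ?_
    calc (x * y) ^ 2 = x ^ 2 * y ^ 2 := by ring
      _ ≤ (m * X ^ 2) * (m * Y ^ 2) := by gcongr
      _ = _ := by ring
  have ha2 : a ^ 2 ≤ m * q ^ 2 := (hcs l₁ l₂).trans (by gcongr; linarith)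
  have hb2 : b ^ 2 ≤ m * K ^ 2 := (hcs p₁ p₂).trans (by rw [hKsq]; gcongr)
  have ht2 : t ^ 2 ≤ m * (3 / 2) ^ 2 := (hcs t₁ t₂).trans (by gcongr; linarith)
  have hab := hprod (by linarith) (by linarith) ha2 hb2
  have hta := hprod (by linarith) (by norm_num) ha2 ht2
  set Q := ((a) ^ 2 + (w 0 * (p₁ - l₁) + w 1 * (p₂ - l₂)) ^ 2 + W) / 2 with hQ
  have hQ0 : 0 ≤ Q := by positivity
  have hQ1 : Q = a ^ 2 - a * b + (b ^ 2 + W) / 2 := by rw [hQ, ha, hb]; ring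
  have hbW : b ^ 2 + W ≤ m * κ := by
    have := hcs p₁ p₂
    linarith
  have hQle : Q ≤ m * (2 * q ^ 2) := by
    have h1 := hcs l₁ l₂
    have h2 := hcs (p₁ - l₁) (p₂ - l₂)
    calc Q ≤ m * V := by rw [hQ, hV]; linarith
      _ ≤ _ := by gcongr
  rw [show w 0 * (l₁ + t₁) + w 1 * (l₂ + t₂) = a + t by rw [ha, ht]; ring]
  have hQs : |Q - (a + t) ^ 2| ≤ m * (7 * (K * q)) := by
    have e : Q - (a + t) ^ 2 = -(a * b) + (b ^ 2 + W) / 2 - 2 * (a * t) - t ^ 2 := by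
      rw [hQ1]; ring
    have h1 : m * κ ≤ m * (K * q) := by rw [← hKsq]; gcongr
    have h2 : m * q ≤ m * (K * q) := by gcongr
    have h3 : m ≤ m * (K * q) := le_mul_of_one_le_right hm0.le h1Kq
    rw [abs_le] at hab hta ⊢
    rw [e]
    have h4 := hab.1
    have h5 := hab.2
    have h6 := hta.1
    have h7 := hta.2
    constructor <;> linarith [sq_nonneg b, sq_nonneg t]
  set Φu := diffusivity w ε u
  set ΦV := diffusivity w ε V
  have hnum : |(u + (a + t) ^ 2 * Φu) - (V + Q * ΦV)| ≤ (7 + 147 * m) * (K * q) := by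
    have e : (u + (a + t) ^ 2 * Φu) - (V + Q * ΦV) =
        -(V - u) - Q * (ΦV - Φu) - (Q - (a + t) ^ 2) * Φu := by ring
    have h1 : |Q * (ΦV - Φu)| ≤ m * (2 * q ^ 2) * (70 * (K / q)) := by
      rw [abs_mul, abs_of_nonneg hQ0]
      gcongr
    have h2 : m * (2 * q ^ 2) * (70 * (K / q)) = 140 * m * (K * q) := by
      field_simp; norm_num
    have h3 : |(Q - (a + t) ^ 2) * Φu| ≤ m * (7 * (K * q)) * 1 := by
      rw [abs_mul, abs_of_nonneg hΦu0]
      gcongr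
    rw [h2] at h1
    rw [e]
    rw [abs_le] at h1 h3 hδ ⊢
    constructor <;> linarith [h1.1, h1.2, h3.1, h3.2, hδ.1, hδ.2]
  have hD1 : q ^ 2 / 8 ≤ V + Q * ΦV := by
    have : 0 ≤ Q * ΦV := by positivity
    linarith
  have hD2 : q ^ 2 / 10 ≤ u + (a + t) ^ 2 * Φu := by
    have : 0 ≤ (a + t) ^ 2 * Φu := by positivity
    linarith
  have hD1' : 0 < V + Q * ΦV := lt_of_lt_of_le (by positivity) hD1
  have hD2' : 0 < u + (a + t) ^ 2 * Φu := lt_of_lt_of_le (by positivity) hD2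
  rw [div_sub_div _ _ hD1'.ne' hD2'.ne', one_mul, mul_one, abs_div,
    abs_of_pos (mul_pos hD1' hD2')]
  calc _ ≤ (7 + 147 * m) * (K * q) / (q ^ 2 / 8 * (q ^ 2 / 10)) := by gcongr
    _ = _ := by field_simp; norm_num

end Diagonal

section Diagonal

open MeasureTheory

variable {w : Fin 2 → ℝ} {ε : ℝ}

lemma cutoff_two_eq {l m : Fin 2 → ℤ} (hε : 0 < ε) (hl : l ≠ 0) (hm : m ≠ 0) (hlm : l + m ≠ 0)
    (h1 : ε ^ 2 * normSq l ≤ 1) (h2 : ε ^ 2 * normSq m ≤ 1) (h3 : ε ^ 2 * normSq (l + m) ≤ 1) :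
    cutoff ε l m = 1 := by
  have key : ∀ {l : Fin 2 → ℤ}, l ≠ 0 → ε ^ 2 * normSq l ≤ 1 →
      0 < ε * cutoffNorm l ∧ ε * cutoffNorm l ≤ 1 := by
    intro l hl h
    rw [cutoffNorm, if_pos rfl]
    change 0 < ε * Real.sqrt (normSq l) ∧ ε * Real.sqrt (normSq l) ≤ 1
    have hl0 := normSq_pos hl
    refine ⟨by positivity, ?_⟩
    rw [← Real.sqrt_sq hε.le, ← Real.sqrt_mul (by positivity), Real.sqrt_le_one]
    exact h
  rw [cutoff, if_pos ⟨key hl h1, key hm h2, key hlm h3⟩]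

lemma normSq_le_of_cutoff_two {l m : Fin 2 → ℤ} (h : cutoff ε l m ≠ 0) :
    ε ^ 2 * normSq m ≤ 1 ∧ ε ^ 2 * normSq (l + m) ≤ 1 := by
  have key : ∀ {l : Fin 2 → ℤ}, 0 < ε * cutoffNorm l ∧ ε * cutoffNorm l ≤ 1 →
      ε ^ 2 * normSq l ≤ 1 := by
    intro l h
    rw [cutoffNorm, if_pos rfl] at h
    change 0 < ε * Real.sqrt (normSq l) ∧ ε * Real.sqrt (normSq l) ≤ 1 at h
    rw [← Real.sq_sqrt (normSq_nonneg l), ← mul_pow]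
    exact pow_le_one₀ h.1.le h.2
  unfold cutoff at h
  split_ifs at h with hc
  · exact ⟨key hc.2.1, key hc.2.2⟩
  · exact absurd rfl h

lemma cutoff_nonneg {d : ℕ} (ε : ℝ) (l m : Fin d → ℤ) : 0 ≤ cutoff ε l m := by
  unfold cutoff; split_ifs <;> norm_num

lemma cutoff_le_one {d : ℕ} (ε : ℝ) (l m : Fin d → ℤ) : cutoff ε l m ≤ 1 := by
  unfold cutoff; split_ifs <;> norm_num

lemma normSq_two (l : Fin 2 → ℤ) : normSq l = (l 0 : ℝ) ^ 2 + (l 1 : ℝ) ^ 2 := by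
  rw [normSq, Fin.sum_univ_two]

lemma sq_le_floor_sq {y N : ℝ} (hN : 0 ≤ N) (h : (⌊y⌋ : ℝ) ≤ N) :
    y ^ 2 ≤ (⌊y⌋ : ℝ) ^ 2 + 2 * N + 1 := by
  have h1 := Int.fract_nonneg y
  have h2 := (Int.fract_lt_one y).le
  have h3 := Int.floor_add_fract y
  set f : ℝ := (⌊y⌋ : ℝ)
  set t := Int.fract y
  rw [← h3]
  have : t * f ≤ 1 * N := (mul_le_mul_of_nonneg_left h h1).trans (by gcongr)
  nlinarith

lemma floor_sq_le {y N : ℝ} (hN : 0 ≤ N) (h : -N ≤ y) :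
    (⌊y⌋ : ℝ) ^ 2 ≤ y ^ 2 + 2 * N + 1 := by
  have h1 := Int.fract_nonneg y
  have h2 := (Int.fract_lt_one y).le
  have h3 : (⌊y⌋ : ℝ) = y - Int.fract y := by rw [Int.self_sub_fract]
  rw [h3]
  set t := Int.fract y
  have h4 : -y ≤ N := by linarith
  have : t * -y ≤ 1 * N := (mul_le_mul_of_nonneg_left h4 h1).trans (by gcongr)
  nlinarith

lemma tsum_error_le {A κ : ℝ} (hA : 0 ≤ A) (hκ : 1 ≤ κ) :
    ∑' l : Fin 2 → ℤ, ENNReal.ofReal (A * (Real.sqrt κ / Real.sqrt (normSq l + κ) ^ 3)) ≤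
      ENNReal.ofReal (73 * A) := by
  have h := tsum_kernel_le (Real.one_le_sqrt.2 hκ)
  rw [Real.sq_sqrt (by linarith)] at h
  simp only [ENNReal.ofReal_mul hA, ENNReal.tsum_mul_left]
  calc _ ≤ ENNReal.ofReal A * 73 := by gcongr
    _ = _ := by rw [mul_comm (73 : ℝ), ENNReal.ofReal_mul hA]; norm_num

set_option maxHeartbeats 1000000 in
/-- The cut-off sum of the ansatz symbol over the pairs of modes with sum `p`: this is the only
place where the precise form of the ansatz matters. -/
lemma exists_abs_sum_pairSymbol_sub_le (hw : w ≠ 0) : ∃ C : ℝ, 0 < C ∧ ∀ ε, 0 < ε → ε ≤ 1 / 4 →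
    ∀ p : Fin 2 → ℤ, p ≠ 0 → ∀ κ W : ℝ, normSq p ≤ κ → 0 ≤ W →
      W ≤ (∑ b, w b ^ 2) * (κ - normSq p) →
      |coupling 2 ε ^ 2 * (∑' l : Fin 2 → ℤ, cutoff ε (p - l) l *
          pairSymbol w ε κ W (p 0) (p 1) (l 0) (l 1)) - Real.pi ^ 2 * diffusivity w ε (κ / 2)| ≤
        C * coupling 2 ε ^ 2 := by
  have hm0 := sum_sq_pos hw
  have hpi := Real.pi_pos
  have hpi4 := Real.pi_le_four
  set A : ℝ := 80 * (7 + 147 * ∑ b, w b ^ 2) with hA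
  have hA0 : 0 < A := by positivity
  refine ⟨73 * A + 84 + 16 + 2 * (∑ b, w b ^ 2), by positivity, ?_⟩
  intro ε hε hε1 p hp0 κ W hκ hW hW1
  have hc0 := coupling_two_sq_pos hε hε1
  set c := coupling 2 ε ^ 2 with hc
  have hκ1 : 1 ≤ κ := (one_le_normSq hp0).trans hκ
  have hκp : (p 0 : ℝ) ^ 2 + (p 1 : ℝ) ^ 2 ≤ κ := by rw [← normSq_two]; exact hκ
  have hW2 : W ≤ (∑ b, w b ^ 2) * (κ - ((p 0 : ℝ) ^ 2 + (p 1 : ℝ) ^ 2)) := by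
    rw [← normSq_two]; exact hW1
  have hΦ0 := diffusivity_nonneg hw hε (show 0 < κ / 2 by linarith)
  -- the effective diffusivity is of order `λ²` at and beyond the cut-off
  have hlarge : ∀ v, 1 / 4 ≤ ε ^ 2 * v → Real.pi ^ 2 * diffusivity w ε v ≤ 16 * c := by
    intro v hv
    have hv0 : 0 < v := by
      by_contra! h
      nlinarith [sq_nonneg ε]
    have h1 := diffusivity_le hw hε hv0
    have h2 : Real.log (1 + 1 / (ε ^ 2 * v)) ≤ 4 := by
      have h3 : 1 / (ε ^ 2 * v) ≤ 4 := by
        rw [div_le_iff₀ (by positivity)]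
        linarith
      calc _ ≤ 1 + 1 / (ε ^ 2 * v) - 1 := Real.log_le_sub_one_of_pos (by positivity)
        _ ≤ _ := by linarith
    calc _ ≤ Real.pi ^ 2 * (c / Real.pi * 4) := by gcongr; exact h1.trans (by gcongr)
      _ = Real.pi * (4 * c) := by field_simp
      _ ≤ 4 * (4 * c) := by gcongr
      _ = _ := by ring
  by_cases hpε : 1 < ε ^ 2 * normSq p
  · have hz : ∀ l, cutoff ε (p - l) l = 0 := by
      intro l
      by_contra h
      have := (normSq_le_of_cutoff_two h).2
      rw [sub_add_cancel] at this
      linarith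
    simp only [hz, zero_mul, tsum_zero, mul_zero, zero_sub, abs_neg]
    rw [abs_of_nonneg (by positivity)]
    calc _ ≤ 16 * c := hlarge _ (by
          have : ε ^ 2 * normSq p ≤ ε ^ 2 * κ := by gcongr
          linarith)
      _ ≤ _ := by
          gcongr
          linarith
  rw [not_lt] at hpε
  set S : (Fin 2 → ℤ) → ℝ := fun l => pairSymbol w ε κ W (p 0) (p 1) (l 0) (l 1) with hS
  have hS0 : ∀ l, 0 ≤ S l := fun l => pairSymbol_nonneg hw hε hκ1 hκp hW _ _
  have hJS0 : ∀ l, 0 ≤ cutoff ε (p - l) l * S l := fun l => mul_nonneg (cutoff_nonneg _ _ _) (hS0 l)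
  have hsum : Summable fun l => cutoff ε (p - l) l * S l := by
    refine summable_of_hasFiniteSupport ((finite_allowed hε).subset fun l hl => ?_)
    exact (cutoff_ne_zero hε (left_ne_zero_of_mul hl)).2.1
  set Z := ∑' l, cutoff ε (p - l) l * S l with hZ
  have hZ0 : 0 ≤ Z := tsum_nonneg hJS0
  have hofReal : ∑' l, ENNReal.ofReal (cutoff ε (p - l) l * S l) = ENNReal.ofReal Z :=
    (ENNReal.ofReal_tsum_of_nonneg hJS0 hsum).symm
  set E : (Fin 2 → ℤ) → ℝ := fun l => A * (Real.sqrt κ / Real.sqrt (normSq l + κ) ^ 3) with hE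
  have hE0 : ∀ l, 0 ≤ E l := fun l => by positivity
  have htile : ∀ x : ℝ × ℝ, |S ![⌊x.1⌋, ⌊x.2⌋] - planeSymbol w ε (κ / 2) x| ≤
      E ![⌊x.1⌋, ⌊x.2⌋] := by
    intro x
    have h := abs_pairSymbol_sub_le hw hε hε1 hκ1 hκp hW hW2 (l₁ := ⌊x.1⌋) (l₂ := ⌊x.2⌋)
      (t₁ := Int.fract x.1) (t₂ := Int.fract x.2)
      (by rw [Int.abs_fract]; exact (Int.fract_lt_one _).le)
      (by rw [Int.abs_fract]; exact (Int.fract_lt_one _).le)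
    rw [Int.floor_add_fract, Int.floor_add_fract] at h
    simpa only [hE, hS, normSq_two, Matrix.cons_val_zero, Matrix.cons_val_one] using h
  have hs0 : 0 < κ / 2 := by linarith
  set N := 1 / ε with hN
  have hN4 : 4 ≤ N := by rw [hN, le_div_iff₀ hε]; linarith
  have hNε : ε * N = 1 := by rw [hN]; field_simp
  have hεsq : ∀ v, ε ^ 2 * v ≤ 1 ↔ v ≤ N ^ 2 := by
    intro v
    rw [hN, div_pow, one_pow, le_div_iff₀ (by positivity), mul_comm]
  have hEint : ∫⁻ x : ℝ × ℝ, ENNReal.ofReal (E ![⌊x.1⌋, ⌊x.2⌋]) ≤ ENNReal.ofReal (73 * A) := by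
    rw [lintegral_floor_prod fun l => ENNReal.ofReal (E l)]
    exact tsum_error_le hA0.le hκ1
  have hJSint : ∫⁻ x : ℝ × ℝ, ENNReal.ofReal (cutoff ε (p - ![⌊x.1⌋, ⌊x.2⌋]) ![⌊x.1⌋, ⌊x.2⌋] *
      S ![⌊x.1⌋, ⌊x.2⌋]) = ENNReal.ofReal Z := by
    rw [lintegral_floor_prod fun l => ENNReal.ofReal (cutoff ε (p - l) l * S l), hofReal]
  have hmeasfloor : ∀ F : (Fin 2 → ℤ) → ℝ≥0∞,
      Measurable fun x : ℝ × ℝ => F ![⌊x.1⌋, ⌊x.2⌋] := by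
    intro F
    have h : Measurable fun p : ℤ × ℤ => F ![p.1, p.2] := .of_discrete
    exact h.comp ((Int.measurable_floor.comp measurable_fst).prodMk
      (Int.measurable_floor.comp measurable_snd))
  have hplane0 : ∀ x, 0 ≤ planeSymbol w ε (κ / 2) x := fun x => by
    have := diffusivity_nonneg hw hε (show 0 < x.1 ^ 2 + x.2 ^ 2 + κ / 2 by positivity)
    rw [planeSymbol]
    positivity
  have hplane1 : ∀ x : ℝ × ℝ, ∀ v, 0 < v → v ≤ x.1 ^ 2 + x.2 ^ 2 + κ / 2 →
      planeSymbol w ε (κ / 2) x ≤ 1 / v := fun x v hv hx => by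
    have := diffusivity_nonneg hw hε (show 0 < x.1 ^ 2 + x.2 ^ 2 + κ / 2 by positivity)
    rw [planeSymbol]
    gcongr
    have : 0 ≤ (w 0 * x.1 + w 1 * x.2) ^ 2 * diffusivity w ε (x.1 ^ 2 + x.2 ^ 2 + κ / 2) := by
      positivity
    linarith
  -- upper bound: the squares meeting the support of the cut-off lie in a disc
  have hupper : Z ≤ (∫ r in 0..(N + 2), radialDensity w ε (κ / 2) r) + 73 * A := by
    have hI0 : 0 ≤ ∫ r in 0..(N + 2), radialDensity w ε (κ / 2) r :=
      intervalIntegral.integral_nonneg (by linarith) fun r hr => radialDensity_nonneg hr.1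
    rw [← ENNReal.ofReal_le_ofReal_iff (by positivity), ENNReal.ofReal_add hI0 (by positivity),
      ← lintegral_disc hw hε hs0 (by linarith), ← hJSint]
    refine le_trans (lintegral_mono fun x => ?_) ((lintegral_add_right _
      (hmeasfloor fun l => ENNReal.ofReal (E l))).le.trans (by gcongr))
    set l := ![⌊x.1⌋, ⌊x.2⌋] with hl
    by_cases hJ : cutoff ε (p - l) l = 0
    · rw [hJ, zero_mul, ENNReal.ofReal_zero]
      exact zero_le
    · have h1 := (normSq_le_of_cutoff_two hJ).1
      rw [hεsq, normSq_two] at h1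
      simp only [hl, Matrix.cons_val_zero, Matrix.cons_val_one] at h1
      have h2 : x.1 ^ 2 + x.2 ^ 2 < (N + 2) ^ 2 := by
        have c1 := abs_le_of_sq_le_sq (by linarith [sq_nonneg (⌊x.2⌋ : ℝ)] :
          (⌊x.1⌋ : ℝ) ^ 2 ≤ N ^ 2) (by linarith)
        have c2 := abs_le_of_sq_le_sq (by linarith [sq_nonneg (⌊x.1⌋ : ℝ)] :
          (⌊x.2⌋ : ℝ) ^ 2 ≤ N ^ 2) (by linarith)
        have d1 := sq_le_floor_sq (by linarith) ((le_abs_self _).trans c1)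
        have d2 := sq_le_floor_sq (by linarith) ((le_abs_self _).trans c2)
        linarith
      simp only [h2, if_true]
      rw [← ENNReal.ofReal_add (hplane0 x) (hE0 l)]
      refine ENNReal.ofReal_le_ofReal ?_
      have h3 := (abs_le.1 (htile x)).2
      have h4 : cutoff ε (p - l) l * S l ≤ S l := mul_le_of_le_one_left (hS0 l) (cutoff_le_one _ _ _)
      linarith
  -- lower bound: in the disc of radius `N - 2` the cut-off fails at `0`, at `p`, or near the edge
  have hlower : (∫ r in 0..(N - 2), radialDensity w ε (κ / 2) r) ≤ Z + 73 * A + 84 := by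
    set B : (Fin 2 → ℤ) → ℝ≥0∞ := fun l => (if l = 0 then 2 else 0) + (if l = p then 2 else 0)
      with hB
    set D : ℝ × ℝ → ℝ≥0∞ := (Set.Icc (-N) N ×ˢ Set.Icc (-N) N).indicator
      fun _ => ENNReal.ofReal (20 / N ^ 2) with hD
    have hBint : ∫⁻ x : ℝ × ℝ, B ![⌊x.1⌋, ⌊x.2⌋] = ENNReal.ofReal 4 := by
      rw [lintegral_floor_prod B, hB, ENNReal.tsum_add, tsum_ite_eq, tsum_ite_eq]
      norm_num
    have hDint : ∫⁻ x, D x = ENNReal.ofReal 80 := by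
      rw [hD, lintegral_indicator (measurableSet_Icc.prod measurableSet_Icc), setLIntegral_const,
        Measure.volume_eq_prod, Measure.prod_prod, Real.volume_Icc,
        ← ENNReal.ofReal_mul (by linarith), ← ENNReal.ofReal_mul (by positivity)]
      congr 1
      field_simp
      ring
    have hDm : Measurable D :=
      measurable_const.indicator (measurableSet_Icc.prod measurableSet_Icc)
    rw [← ENNReal.ofReal_le_ofReal_iff (by positivity), ENNReal.ofReal_add (by positivity)
      (by norm_num), ENNReal.ofReal_add hZ0 (by positivity),
      ← lintegral_disc hw hε hs0 (by linarith), ← hJSint,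
      show (84 : ℝ) = 4 + 80 by norm_num, ENNReal.ofReal_add (by norm_num) (by norm_num),
      ← hBint, ← hDint]
    refine le_trans (lintegral_mono (g := fun x : ℝ × ℝ =>
      ENNReal.ofReal (cutoff ε (p - ![⌊x.1⌋, ⌊x.2⌋]) ![⌊x.1⌋, ⌊x.2⌋] * S ![⌊x.1⌋, ⌊x.2⌋]) +
      ENNReal.ofReal (E ![⌊x.1⌋, ⌊x.2⌋]) + (B ![⌊x.1⌋, ⌊x.2⌋] + D x)) fun x => ?_) ?_
    · set l := ![⌊x.1⌋, ⌊x.2⌋] with hl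
      simp only
      split_ifs with hx
      · have hx1 : |x.1| ≤ N - 2 := abs_le_of_sq_le_sq (by linarith [sq_nonneg x.2]) (by linarith)
        have hx2 : |x.2| ≤ N - 2 := abs_le_of_sq_le_sq (by linarith [sq_nonneg x.1]) (by linarith)
        rw [abs_le] at hx1 hx2
        have hnl : normSq l ≤ N ^ 2 := by
          rw [normSq_two]
          simp only [hl, Matrix.cons_val_zero, Matrix.cons_val_one]
          have d1 := floor_sq_le (by linarith : 0 ≤ N - 2) (by linarith [hx1.1] : -(N - 2) ≤ x.1)
          have d2 := floor_sq_le (by linarith : 0 ≤ N - 2) (by linarith [hx2.1] : -(N - 2) ≤ x.2)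
          linarith
        by_cases hl0 : l = 0 ∨ l = p
        · have h2 : (2 : ℝ≥0∞) ≤ B l := by
            rcases hl0 with h | h
            · rw [hB]; simp [h]
            · rw [hB]; simp [h]
          have h3 : planeSymbol w ε (κ / 2) x ≤ 2 := by
            have := hplane1 x (1 / 2) (by norm_num) (by linarith [sq_nonneg x.1, sq_nonneg x.2])
            norm_num at this
            exact this
          calc _ ≤ ENNReal.ofReal 2 := ENNReal.ofReal_le_ofReal h3
            _ ≤ B l := by simpa using h2
            _ ≤ B l + D x := le_self_add
            _ ≤ _ := le_add_self
        rw [not_or] at hl0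
        by_cases hpl : ε ^ 2 * normSq (p - l) ≤ 1
        · have hJ : cutoff ε (p - l) l = 1 :=
            cutoff_two_eq hε (sub_ne_zero.2 (Ne.symm hl0.2)) hl0.1 (by rwa [sub_add_cancel]) hpl
              ((hεsq _).2 hnl) (by rwa [sub_add_cancel])
          rw [hJ, one_mul]
          have h3 := (abs_le.1 (htile x)).1
          refine le_trans ?_ le_self_add
          rw [← ENNReal.ofReal_add (hS0 l) (hE0 l)]
          exact ENNReal.ofReal_le_ofReal (by linarith)
        · rw [hεsq, not_le] at hpl
          have hxD : D x = ENNReal.ofReal (20 / N ^ 2) := by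
            rw [hD]
            have h1 : x.1 ∈ Set.Icc (-N) N := ⟨by linarith [hx1.1], by linarith [hx1.2]⟩
            have h2 : x.2 ∈ Set.Icc (-N) N := ⟨by linarith [hx2.1], by linarith [hx2.2]⟩
            exact Set.indicator_of_mem (Set.mk_mem_prod h1 h2) _
          have h4 : planeSymbol w ε (κ / 2) x ≤ 20 / N ^ 2 := by
            have h5 := planeSymbol_arg_ge (l₁ := ⌊x.1⌋) (l₂ := ⌊x.2⌋) (t₁ := Int.fract x.1)
              (t₂ := Int.fract x.2) hκ1
              (by rw [Int.abs_fract]; exact (Int.fract_lt_one _).le)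
              (by rw [Int.abs_fract]; exact (Int.fract_lt_one _).le)
            rw [Int.floor_add_fract, Int.floor_add_fract] at h5
            have h6 := hplane1 x (N ^ 2 / 20) (by positivity) (by
              refine le_trans ?_ h5
              rw [normSq_two] at hpl
              simp only [hl, Pi.sub_apply, Matrix.cons_val_zero, Matrix.cons_val_one,
                Int.cast_sub] at hpl
              linarith [sq_nonneg ((p 0 : ℝ) + ⌊x.1⌋), sq_nonneg ((p 1 : ℝ) + ⌊x.2⌋)])
            calc _ ≤ _ := h6
              _ = _ := by field_simp
          calc _ ≤ D x := by rw [hxD]; exact ENNReal.ofReal_le_ofReal h4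
            _ ≤ B l + D x := le_add_self
            _ ≤ _ := le_add_self
      · exact zero_le
    · have hBD : Measurable fun x : ℝ × ℝ => B ![⌊x.1⌋, ⌊x.2⌋] + D x := (hmeasfloor B).add hDm
      rw [lintegral_add_right _ hBD, lintegral_add_right _ hDm,
        lintegral_add_right _ (hmeasfloor fun l => ENNReal.ofReal (E l))]
      gcongr
  have hU := integral_radialDensity_le hw hε hε1 (show 1 / 2 ≤ κ / 2 by linarith)
    (R := N + 2) (by linarith)
  have hL := le_integral_radialDensity hw hε hs0 (R := N - 2) (by linarith)
  have hεN : ε * N = 1 := hNε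
  rw [abs_le]
  constructor
  · have h1 := hlarge ((N - 2) ^ 2 + κ / 2) (by
      have h2 : 1 / 2 ≤ ε * (N - 2) := by nlinarith
      have h3 : (1 / 2) ^ 2 ≤ (ε * (N - 2)) ^ 2 := by gcongr
      have h4 : 0 ≤ ε ^ 2 * (κ / 2) := by positivity
      nlinarith)
    have h5 : c * ∫ r in 0..(N - 2), radialDensity w ε (κ / 2) r ≤ c * (Z + 73 * A + 84) := by
      gcongr
    nlinarith [mul_pos hm0 hc0]
  · have h1 : Real.log (1 + ε ^ 2 * (N + 2) ^ 2) ≤ 9 / 4 := by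
      have h2 : ε * (N + 2) ≤ 3 / 2 := by nlinarith
      have h3 : (ε * (N + 2)) ^ 2 ≤ (3 / 2) ^ 2 := by
        gcongr
      calc _ ≤ 1 + ε ^ 2 * (N + 2) ^ 2 - 1 := Real.log_le_sub_one_of_pos (by positivity)
        _ = (ε * (N + 2)) ^ 2 := by ring
        _ ≤ _ := by linarith
    have h5 : c * Z ≤ c * ((∫ r in 0..(N + 2), radialDensity w ε (κ / 2) r) + 73 * A) := by
      gcongr
    have h6 : Real.pi * Real.log (1 + ε ^ 2 * (N + 2) ^ 2) ≤ 4 * (9 / 4) :=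
      mul_le_mul hpi4 h1 (Real.log_nonneg (by
        have : 0 ≤ ε ^ 2 * (N + 2) ^ 2 := by positivity
        linarith)) (by norm_num)
    have h7 : Real.pi * (∑ b, w b ^ 2) / 2 ≤ 4 * (∑ b, w b ^ 2) / 2 := by gcongr
    have h8 : c * (Real.pi * Real.log (1 + ε ^ 2 * (N + 2) ^ 2) + Real.pi * (∑ b, w b ^ 2) / 2) ≤
        c * (4 * (9 / 4) + 4 * (∑ b, w b ^ 2) / 2) := by gcongr
    nlinarith

end Diagonal

/-! ### The off-diagonal part of the self-energy -/

section OffDiagonal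

variable {n : ℕ}

/-- The kernel of the Schur test. -/
def schurKernel (ξ β : Fin (n + 1)) (k : Fin (n + 1) → Fin 2 → ℤ) : ℝ≥0∞ :=
  if k ξ ≠ 0 ∧ k β ≠ 0 then ENNReal.ofReal (1 / (normSq (k ξ) + normSq (k β))) else 0

/-- The kernel of the Schur test with the weight `|k_β| / |k_ξ|`. -/
def schurWeight (ξ β : Fin (n + 1)) (k : Fin (n + 1) → Fin 2 → ℤ) : ℝ≥0∞ :=
  if k ξ ≠ 0 ∧ k β ≠ 0 then ENNReal.ofReal (Real.sqrt (normSq (k β)) /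
    (Real.sqrt (normSq (k ξ)) * (Real.sqrt (normSq (k β)) ^ 2 + normSq (k ξ)))) else 0

lemma schurKernel_sq (ξ β : Fin (n + 1)) (k : Fin (n + 1) → Fin 2 → ℤ) :
    schurKernel ξ β k ^ 2 = schurWeight ξ β k * schurWeight β ξ k := by
  unfold schurKernel schurWeight
  by_cases h : k ξ ≠ 0 ∧ k β ≠ 0
  · rw [if_pos h, if_pos h, if_pos h.symm, ← ENNReal.ofReal_mul (by
      have := normSq_nonneg (k ξ); positivity), ← ENNReal.ofReal_pow (by
      have := normSq_nonneg (k ξ); have := normSq_nonneg (k β); positivity)]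
    congr 1
    have h1 := normSq_pos h.1
    have h2 := normSq_pos h.2
    have h3 := Real.sqrt_pos.2 h1
    have h4 := Real.sqrt_pos.2 h2
    rw [Real.sq_sqrt h1.le, Real.sq_sqrt h2.le]
    field_simp
    ring
  · rw [if_neg h, if_neg h, zero_pow two_ne_zero, zero_mul]

lemma split_apply_of_ne {b : Fin (n + 1)} {a : Fin n} {β : Fin (n + 1)} (h1 : β ≠ b)
    (h2 : β ≠ b.succAbove a) (l : Fin 2 → ℤ) (k : Fin n → Fin 2 → ℤ) :
    split b a l k β = split b a 0 k β := by
  obtain ⟨j, rfl⟩ := Fin.exists_succAbove_eq h1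
  have hj : j ≠ a := fun h => h2 (by rw [h])
  simp [hj]

lemma tsum_schurWeight_le {b : Fin (n + 1)} {a : Fin n} {ξ β : Fin (n + 1)}
    (hξ : ξ = b ∨ ξ = b.succAbove a) (hβ : β ≠ b ∧ β ≠ b.succAbove a) (k : Fin n → Fin 2 → ℤ) :
    ∑' l, schurWeight ξ β (split b a l k) ≤ 72 := by
  unfold schurWeight
  simp only [split_apply_of_ne hβ.1 hβ.2]
  set x := split b a 0 k β
  by_cases hx : x = 0
  · simp [hx]
  have hX : 0 < Real.sqrt (normSq x) := Real.sqrt_pos.2 (normSq_pos hx)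
  simp only [ne_eq, hx, not_false_eq_true, and_true]
  rcases hξ with rfl | rfl
  · simp only [split_apply_same]
    exact tsum_schur_le hX
  · simp only [split_apply_succAbove, Function.update_self]
    refine le_trans (le_of_eq ?_) (tsum_schur_le hX)
    exact (Equiv.subLeft (k a)).tsum_eq fun y : Fin 2 → ℤ => if ¬ y = 0 then ENNReal.ofReal
      (Real.sqrt (normSq x) / (Real.sqrt (normSq y) * (Real.sqrt (normSq x) ^ 2 + normSq y))) else 0

/-- Schur's test for a splitting followed by a merging of a different pair of modes. -/
lemma tsum_split_fuse_sq_le {b₁ b₂ : Fin (n + 1)} {a₁ a₂ : Fin n} {ξ β : Fin (n + 1)}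
    (hξ : ξ = b₁ ∨ ξ = b₁.succAbove a₁) (hξ' : ξ ≠ b₂ ∧ ξ ≠ b₂.succAbove a₂)
    (hβ : β = b₂ ∨ β = b₂.succAbove a₂) (hβ' : β ≠ b₁ ∧ β ≠ b₁.succAbove a₁)
    (y : (Fin n → Fin 2 → ℤ) → ℝ≥0∞) :
    ∑' k, (∑' l, schurKernel ξ β (split b₁ a₁ l k) * y (fuse b₂ a₂ (split b₁ a₁ l k))) ^ 2 ≤
      72 ^ 2 * ∑' k, y k ^ 2 := by
  calc _ ≤ ∑' k, 72 * ∑' l, schurWeight β ξ (split b₁ a₁ l k) *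
        y (fuse b₂ a₂ (split b₁ a₁ l k)) ^ 2 := by
        refine ENNReal.tsum_le_tsum fun k => ?_
        refine (ennreal_cauchy_schwarz (ρ := fun l => schurWeight ξ β (split b₁ a₁ l k))
          (τ := fun l => schurWeight β ξ (split b₁ a₁ l k) *
            y (fuse b₂ a₂ (split b₁ a₁ l k)) ^ 2) fun l => ?_).trans ?_
        · rw [mul_pow, schurKernel_sq, mul_assoc]
        · gcongr
          exact tsum_schurWeight_le hξ hβ' k
    _ = 72 * ∑' k, schurWeight β ξ k * y (fuse b₂ a₂ k) ^ 2 := by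
        rw [ENNReal.tsum_mul_left,
          tsum_eq_tsum_split b₁ a₁ fun k => schurWeight β ξ k * y (fuse b₂ a₂ k) ^ 2]
    _ = 72 * ∑' k, (∑' l, schurWeight β ξ (split b₂ a₂ l k)) * y k ^ 2 := by
        rw [tsum_eq_tsum_split b₂ a₂]
        simp only [fuse_split, ENNReal.tsum_mul_right]
    _ ≤ 72 * ∑' k, 72 * y k ^ 2 := by
        gcongr with k
        exact tsum_schurWeight_le hβ hξ' k
    _ = _ := by rw [ENNReal.tsum_mul_left]; ring

end OffDiagonal

/-! ### The replacement of the self-energy by the effective diffusivity -/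

section Replacement

variable {w : Fin 2 → ℝ} {ε : ℝ} {n : ℕ}

/-- The ratio of the multipliers `-𝓛₀^w 𝓖^ε` and `-𝓛₀`. -/
def gain (w : Fin 2 → ℝ) (ε : ℝ) (k : Fin n → Fin 2 → ℤ) : ℝ :=
  1 / 2 * (∑ a, dot w (k a) ^ 2) * diffusivity w ε (1 / 2 * modeSq k) * hinv k ^ 2

lemma gain_symm : Symm (gain w ε : (Fin n → Fin 2 → ℤ) → ℝ) := fun σ k => by
  have h : ∑ a, dot w ((k ∘ σ) a) ^ 2 = ∑ a, dot w (k a) ^ 2 :=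
    Equiv.sum_comp σ fun a => dot w (k a) ^ 2
  rw [gain, h, modeSq_comp, hinv_comp, gain]

lemma half_modeSq_ge {k : Fin n → Fin 2 → ℤ} (hk : k ≠ 0) : 1 / 2 ≤ 1 / 2 * modeSq k := by
  rw [← hroot_sq]; exact half_le_hroot_sq hk

lemma hinv_zero : hinv (0 : Fin n → Fin 2 → ℤ) = 0 := by
  rw [hinv, hroot_eq_zero.2 rfl, inv_zero]

lemma gain_nonneg (hw : w ≠ 0) (hε : 0 < ε) (k : Fin n → Fin 2 → ℤ) : 0 ≤ gain w ε k := by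
  by_cases hk : k = 0
  · rw [hk, gain, hinv_zero]; simp
  have := diffusivity_nonneg hw hε (show 0 < 1 / 2 * modeSq k by linarith [half_modeSq_ge hk])
  rw [gain]
  positivity

lemma gain_le (hw : w ≠ 0) (hε : 0 < ε) (hε1 : ε ≤ 1 / 4) (k : Fin n → Fin 2 → ℤ) :
    gain w ε k ≤ ∑ b, w b ^ 2 := by
  have hm := sum_sq_pos hw
  by_cases hk : k = 0
  · rw [hk, gain, hinv_zero]; simpa using hm.le
  have h1 := diffusivity_le_one hw hε hε1 (half_modeSq_ge hk)
  have h2 := sum_dot_sq_le w k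
  have h3 := modeSq_mul_hinv_sq_le k
  have h4 := modeSq_nonneg k
  have h5 := diffusivity_nonneg hw hε (show 0 < 1 / 2 * modeSq k by linarith [half_modeSq_ge hk])
  calc gain w ε k ≤ 1 / 2 * ((∑ b, w b ^ 2) * modeSq k) * 1 * hinv k ^ 2 := by
        rw [gain]; gcongr
    _ = (∑ b, w b ^ 2) * (1 / 2) * (modeSq k * hinv k ^ 2) := by ring
    _ ≤ (∑ b, w b ^ 2) * (1 / 2) * 2 := by gcongr
    _ = _ := by ring

/-- The multiplier of the ansatz. -/
lemma ansatz_multiplier_eq (k : Fin n → Fin 2 → ℤ) :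
    (1 / 2 * modeSq k + 1 / 2 * (∑ a, dot w (k a) ^ 2) *
      diffusivityG w (logScale 2 ε (1 / 2 * modeSq k)))⁻¹ = hinv k ^ 2 * (1 + gain w ε k)⁻¹ := by
  change (1 / 2 * modeSq k + 1 / 2 * (∑ a, dot w (k a) ^ 2) *
    diffusivity w ε (1 / 2 * modeSq k))⁻¹ = _
  by_cases hk : k = 0
  · subst hk
    rw [hinv_zero]
    simp [modeSq, dot]
  rw [hinv_sq, gain, hinv_sq]
  have : 0 < modeSq k := by linarith [half_modeSq_ge hk]
  rw [← inv_inj, inv_inv, mul_inv, inv_inv, inv_div]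
  field_simp

lemma vertex_eq_zero (hε : 0 < ε) {l m : Fin 2 → ℤ} (h : l = 0 ∨ m = 0) : vertex w ε l m = 0 := by
  have : cutoff ε l m = 0 := by
    by_contra hc
    have := cutoff_ne_zero hε hc
    rcases h with h | h
    · exact this.1.1 h
    · exact this.2.1.1 h
  rw [vertex, this, mul_zero]

lemma dot_hinv_sq_le (k : Fin n → Fin 2 → ℤ) (a : Fin n) :
    (hinv k * dot w (k a)) ^ 2 ≤ 2 * ∑ b, w b ^ 2 := by
  have hm : 0 ≤ ∑ b, w b ^ 2 := Finset.sum_nonneg fun b _ => sq_nonneg _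
  calc (hinv k * dot w (k a)) ^ 2 = hinv k ^ 2 * dot w (k a) ^ 2 := by ring
    _ ≤ hinv k ^ 2 * ((∑ b, w b ^ 2) * modeSq k) := by
        gcongr
        exact (dot_sq_le w (k a)).trans (by gcongr; exact normSq_le_modeSq k a)
    _ = (∑ b, w b ^ 2) * (modeSq k * hinv k ^ 2) := by ring
    _ ≤ (∑ b, w b ^ 2) * 2 := by gcongr; exact modeSq_mul_hinv_sq_le k
    _ = _ := by ring

/-- The coefficient of the self-energy belonging to the splitting of the mode `a` and the merging of
the modes `b` and `b.succAbove a'`. -/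
def energyCoef (w : Fin 2 → ℝ) (ε : ℝ) (a : Fin n) (b : Fin (n + 1)) (a' : Fin n) (l : Fin 2 → ℤ)
    (k : Fin n → Fin 2 → ℤ) : ℝ :=
  ‖vconst 2‖ ^ 2 * coupling 2 ε ^ 2 * (hinv k * vertex w ε (k a - l) l) *
    (hinv (split 0 a l k) ^ 2 * (1 + gain w ε (split 0 a l k))⁻¹) *
    (vertex w ε (split 0 a l k (b.succAbove a')) (split 0 a l k b) *
      hinv (fuse b a' (split 0 a l k)))

/-- The part of the self-energy belonging to the splitting of the mode `a` and the merging of the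
modes `b` and `b.succAbove a'`. -/
def energyTerm (w : Fin 2 → ℝ) (ε : ℝ) (y : (Fin n → Fin 2 → ℤ) → ℂ) (a : Fin n) (b : Fin (n + 1))
    (a' : Fin n) (k : Fin n → Fin 2 → ℤ) : ℂ :=
  ∑' l, (energyCoef w ε a b a' l k : ℂ) * y (fuse b a' (split 0 a l k))

lemma vconst_sq (d : ℕ) : -(vconst d * vconst d) = ((‖vconst d‖ ^ 2 : ℝ) : ℂ) := by
  rw [neg_mul_eq_neg_mul, ← conj_vconst, ← Complex.normSq_eq_conj_mul_self, Complex.normSq_eq_norm_sq]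

lemma vertex_support_finite (hε : 0 < ε) (p : Fin 2 → ℤ) :
    {l | vertex w ε (p - l) l ≠ 0}.Finite :=
  (finite_allowed hε).subset fun l hl => by
    have : cutoff ε (p - l) l ≠ 0 := fun h => hl (by rw [vertex, h, mul_zero])
    exact (cutoff_ne_zero hε this).2.1

lemma selfEnergy_eq_sum (hε : 0 < ε) {y : (Fin n → Fin 2 → ℤ) → ℂ} (hy : SymMZ y)
    (k : Fin n → Fin 2 → ℤ) :
    pairAdj (coef w ε hinv hinv)
      (fun k => (((1 + gain w ε k)⁻¹ : ℝ) : ℂ) * pairOp (coef w ε hinv hinv) y k) k =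
      ∑ a, ∑ b, ∑ a', energyTerm w ε y a b a' k := by
  have hs : Symm fun k : Fin (n + 1) → Fin 2 → ℤ => (((1 + gain w ε k)⁻¹ : ℝ) : ℂ) := fun σ k => by
    simp only [gain_symm σ k]
  rw [pairAdj_coef_eq hinv hinv_symm
    ((pairOp_coef_symMZ hε hinv_symm hinv_symm hy).mul hs).1, Finset.mul_sum]
  refine Finset.sum_congr rfl fun a _ => ?_
  have hfin : ∀ b a', (Function.support fun l => (energyCoef w ε a b a' l k : ℂ) *
      y (fuse b a' (split 0 a l k))).Finite := fun b a' =>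
    (vertex_support_finite (w := w) hε (k a)).subset fun l hl h0 => hl (by
      simp only [energyCoef, h0, mul_zero, zero_mul, Complex.ofReal_zero])
  have hsum : ∀ b a', Summable fun l => (energyCoef w ε a b a' l k : ℂ) *
      y (fuse b a' (split 0 a l k)) := fun b a' => summable_of_hasFiniteSupport (hfin b a')
  simp only [energyTerm]
  rw [← tsum_mul_left]
  have h1 : ∑ b, ∑ a', ∑' l, (energyCoef w ε a b a' l k : ℂ) * y (fuse b a' (split 0 a l k)) =
      ∑' l, ∑ b, ∑ a', (energyCoef w ε a b a' l k : ℂ) * y (fuse b a' (split 0 a l k)) := by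
    rw [Summable.tsum_finsetSum fun b _ => summable_sum fun a' _ => hsum b a']
    refine Finset.sum_congr rfl fun b _ => ?_
    rw [Summable.tsum_finsetSum fun a' _ => hsum b a']
  rw [h1]
  refine tsum_congr fun l => ?_
  have hn : ((coupling 2 ε * Real.sqrt (n + 1) : ℝ) : ℂ) * ((coupling 2 ε / Real.sqrt (n + 1) : ℝ) : ℂ) =
      ((coupling 2 ε ^ 2 : ℝ) : ℂ) := by
    rw [← Complex.ofReal_mul]
    congr 1
    have : Real.sqrt ((n : ℝ) + 1) ≠ 0 := by positivity
    field_simp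
  simp only [pairOp, Finset.mul_sum]
  refine Finset.sum_congr rfl fun b _ => Finset.sum_congr rfl fun a' _ => ?_
  rw [coef, energyCoef]
  rw [mul_assoc (_ * _) (hinv k * _), mul_assoc (_ * _),
    Complex.ofReal_mul (‖vconst 2‖ ^ 2 * _), Complex.ofReal_mul (‖vconst 2‖ ^ 2), ← vconst_sq 2, ← hn]
  push_cast
  ring

/-- The two ways to merge the pair of modes that has just been created. -/
def IsDiag (a : Fin n) (b c : Fin (n + 1)) : Prop := (b = 0 ∧ c = a.succ) ∨ (b = a.succ ∧ c = 0)

instance (a : Fin n) (b c : Fin (n + 1)) : Decidable (IsDiag a b c) := by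
  unfold IsDiag; infer_instance

lemma sum_isDiag (a : Fin n) (x : ℂ) :
    ∑ b : Fin (n + 1), ∑ a' : Fin n, (if IsDiag a b (b.succAbove a') then x else 0) = 2 * x := by
  have h1 : ∀ b : Fin (n + 1), ∑ a' : Fin n, (if IsDiag a b (b.succAbove a') then x else 0) =
      ∑ c, if IsDiag a b c then x else 0 := by
    intro b
    rw [Fin.sum_univ_succAbove _ b]
    have : ¬ IsDiag a b b := by
      rintro (⟨h1, h2⟩ | ⟨h1, h2⟩)
      · exact (Fin.succ_ne_zero a) (h2.symm.trans h1)
      · exact (Fin.succ_ne_zero a) (h1.symm.trans h2)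
    rw [if_neg this, zero_add]
  have h2 : ∀ b c : Fin (n + 1), (if IsDiag a b c then x else 0) =
      (if b = 0 then if c = a.succ then x else 0 else 0) +
        (if b = a.succ then if c = 0 then x else 0 else 0) := by
    intro b c
    have := Fin.succ_ne_zero a
    by_cases hb : b = 0
    · subst hb
      simp [IsDiag, this.symm]
    · simp [IsDiag, hb, ite_and]
  simp only [h1]
  simp only [h2, Finset.sum_add_distrib]
  have h3 : ∀ (e f : Fin (n + 1)), ∑ b : Fin (n + 1), ∑ c : Fin (n + 1),
      (if b = e then if c = f then x else 0 else 0) = x := fun e f => by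
    rw [Finset.sum_eq_single e (fun b _ hb => by simp [hb]) (by simp)]
    simp
  rw [h3, h3, two_mul]

lemma IsDiag.fuse_eq {X : Type*} {f : (Fin n → Fin 2 → ℤ) → X} (hf : Symm f) {a a' : Fin n}
    {b : Fin (n + 1)} (h : IsDiag a b (b.succAbove a')) (l : Fin 2 → ℤ) (k : Fin n → Fin 2 → ℤ) :
    f (fuse b a' (split 0 a l k)) = f k := by
  have h0 : mergeVal f (split 0 a l k) 0 a.succ = f k := by
    rw [mergeVal, ← Fin.zero_succAbove, ← fuse_eq_update_comp, fuse_split]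
  have h1 : f (fuse b a' (split 0 a l k)) = mergeVal f (split 0 a l k) b (b.succAbove a') := by
    rw [mergeVal, fuse_eq_update_comp]
  rw [h1]
  rcases h with ⟨h2, h3⟩ | ⟨h2, h3⟩
  · rw [h3, h2, h0]
  · rw [h3, h2, mergeVal_swap hf, h0]

lemma IsDiag.vertex_eq {a a' : Fin n} {b : Fin (n + 1)} (h : IsDiag a b (b.succAbove a'))
    (l : Fin 2 → ℤ) (k : Fin n → Fin 2 → ℤ) :
    vertex w ε (split 0 a l k (b.succAbove a')) (split 0 a l k b) = vertex w ε (k a - l) l := by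
  have h0 : split 0 a l k 0 = l := split_apply_same _ _ _ _
  have h1 : split 0 a l k a.succ = k a - l := by
    rw [← Fin.zero_succAbove, split_apply_succAbove, Function.update_self]
  rcases h with ⟨h2, h3⟩ | ⟨h2, h3⟩
  · rw [h3, h2, h0, h1]
  · rw [h3, h2, h0, h1, vertex_comm]

lemma exists_of_not_isDiag {a a' : Fin n} {b : Fin (n + 1)} (h : ¬ IsDiag a b (b.succAbove a')) :
    (∃ ξ : Fin (n + 1), (ξ = 0 ∨ ξ = (0 : Fin (n + 1)).succAbove a) ∧
      (ξ ≠ b ∧ ξ ≠ b.succAbove a')) ∧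
    ∃ β : Fin (n + 1), (β = b ∨ β = b.succAbove a') ∧
      (β ≠ 0 ∧ β ≠ (0 : Fin (n + 1)).succAbove a) := by
  rw [Fin.zero_succAbove]
  have h1 := Fin.succ_ne_zero a
  have h2 := Fin.succAbove_ne b a'
  set c := b.succAbove a'
  unfold IsDiag at h
  constructor
  · by_cases h3 : 0 ≠ b ∧ 0 ≠ c
    · exact ⟨0, Or.inl rfl, h3⟩
    · refine ⟨a.succ, Or.inr rfl, ?_, ?_⟩
      · intro h4; apply h; grind
      · intro h4; apply h; grind
  · by_cases h3 : b ≠ 0 ∧ b ≠ a.succ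
    · exact ⟨b, Or.inl rfl, h3⟩
    · refine ⟨c, Or.inr rfl, ?_, ?_⟩
      · intro h4; apply h; grind
      · intro h4; apply h; grind

lemma modeSq_split (a : Fin n) (l : Fin 2 → ℤ) (k : Fin n → Fin 2 → ℤ) :
    modeSq (split 0 a l k) = normSq l + normSq (k a - l) + (modeSq k - normSq (k a)) := by
  rw [modeSq_eq, modeSq_eq, Fin.sum_univ_succ, ← Finset.add_sum_erase _ _ (Finset.mem_univ a),
    ← Finset.add_sum_erase _ (fun a => normSq (k a)) (Finset.mem_univ a)]
  have h1 : split 0 a l k 0 = l := split_apply_same _ _ _ _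
  have h2 : ∀ c : Fin n, split 0 a l k c.succ = Function.update k a (k a - l) c := fun c => by
    rw [← Fin.zero_succAbove, split_apply_succAbove]
  rw [h1, h2, Function.update_self]
  have h3 : ∑ c ∈ Finset.univ.erase a, normSq (split 0 a l k c.succ) =
      ∑ c ∈ Finset.univ.erase a, normSq (k c) :=
    Finset.sum_congr rfl fun c hc => by
      rw [h2, Function.update_of_ne (Finset.ne_of_mem_erase hc)]
  rw [h3]
  ring

lemma sum_dot_split (a : Fin n) (l : Fin 2 → ℤ) (k : Fin n → Fin 2 → ℤ) :
    ∑ c, dot w (split 0 a l k c) ^ 2 = dot w l ^ 2 + dot w (k a - l) ^ 2 +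
      ∑ c ∈ Finset.univ.erase a, dot w (k c) ^ 2 := by
  rw [Fin.sum_univ_succ, ← Finset.add_sum_erase _ _ (Finset.mem_univ a)]
  have h1 : split 0 a l k 0 = l := split_apply_same _ _ _ _
  have h2 : ∀ c : Fin n, split 0 a l k c.succ = Function.update k a (k a - l) c := fun c => by
    rw [← Fin.zero_succAbove, split_apply_succAbove]
  rw [h1, h2, Function.update_self]
  have h3 : ∑ c ∈ Finset.univ.erase a, dot w (split 0 a l k c.succ) ^ 2 =
      ∑ c ∈ Finset.univ.erase a, dot w (k c) ^ 2 :=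
    Finset.sum_congr rfl fun c hc => by
      rw [h2, Function.update_of_ne (Finset.ne_of_mem_erase hc)]
  rw [h3]
  ring

lemma dot_two (l : Fin 2 → ℤ) : dot w l = w 0 * l 0 + w 1 * l 1 := by
  rw [dot, Fin.sum_univ_two]

lemma symbol_split_eq (a : Fin n) (l : Fin 2 → ℤ) (k : Fin n → Fin 2 → ℤ) :
    hinv (split 0 a l k) ^ 2 * (1 + gain w ε (split 0 a l k))⁻¹ =
      pairSymbol w ε (modeSq k) (∑ c ∈ Finset.univ.erase a, dot w (k c) ^ 2) (k a 0) (k a 1)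
        (l 0) (l 1) := by
  rw [← ansatz_multiplier_eq, sum_dot_split, pairSymbol, dot_two, dot_two]
  refine Eq.trans ?_ (one_div _).symm
  have h : 1 / 2 * modeSq (split 0 a l k) = (l 0 : ℝ) ^ 2 + (l 1 : ℝ) ^ 2 -
      ((k a 0 : ℝ) * l 0 + k a 1 * l 1) + modeSq k / 2 := by
    rw [modeSq_split, normSq_two, normSq_two, normSq_two, Pi.sub_apply, Pi.sub_apply]
    push_cast
    ring
  rw [h]
  congr 1
  simp only [Pi.sub_apply, Int.cast_sub, diffusivity]
  ring

end Replacement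

section Replacement

variable {w : Fin 2 → ℝ} {ε : ℝ} {n : ℕ}

lemma vertex_split_eq (a : Fin n) (l : Fin 2 → ℤ) (k : Fin n → Fin 2 → ℤ) :
    vertex w ε (k a - l) l = dot w (k a) * cutoff ε (k a - l) l := by
  rw [vertex, sub_add_cancel]

lemma abs_mul_le_of_sq_le {x y M : ℝ} (hM : 0 ≤ M) (hx : x ^ 2 ≤ M) (hy : y ^ 2 ≤ M) :
    |x * y| ≤ M := by
  refine abs_le_of_sq_le_sq ?_ hM
  calc (x * y) ^ 2 = x ^ 2 * y ^ 2 := by ring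
    _ ≤ M * M := by gcongr
    _ = M ^ 2 := by ring

lemma mul_cutoff_sq_le (x : ℝ) (l m : Fin 2 → ℤ) : (x * cutoff ε l m) ^ 2 ≤ x ^ 2 := by
  rw [mul_pow]
  exact mul_le_of_le_one_right (sq_nonneg _) (cutoff_sq_le_one _ _ _)

lemma abs_energyCoef_le (hw : w ≠ 0) (hε : 0 < ε) (a : Fin n) (b : Fin (n + 1)) (a' : Fin n)
    (l : Fin 2 → ℤ) (k : Fin n → Fin 2 → ℤ) :
    |energyCoef w ε a b a' l k| ≤ 4 * ‖vconst 2‖ ^ 2 * (∑ b, w b ^ 2) * coupling 2 ε ^ 2 *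
      (1 / modeSq (split 0 a l k)) := by
  have hm := sum_sq_pos hw
  set K := split 0 a l k with hK
  have h1 : (hinv k * vertex w ε (k a - l) l) ^ 2 ≤ 2 * ∑ b, w b ^ 2 := by
    rw [vertex_split_eq, ← mul_assoc]
    exact (mul_cutoff_sq_le _ _ _).trans (dot_hinv_sq_le k a)
  have h2 : (vertex w ε (K (b.succAbove a')) (K b) * hinv (fuse b a' K)) ^ 2 ≤
      2 * ∑ b, w b ^ 2 := by
    rw [vertex, ← fuse_apply_same, mul_comm, ← mul_assoc]
    exact (mul_cutoff_sq_le _ _ _).trans (dot_hinv_sq_le _ a')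
  have h3 : 0 ≤ hinv K ^ 2 * (1 + gain w ε K)⁻¹ ∧
      hinv K ^ 2 * (1 + gain w ε K)⁻¹ ≤ 2 * (1 / modeSq K) := by
    have hg := gain_nonneg hw hε K
    refine ⟨by positivity, ?_⟩
    rw [mul_one_div, ← hinv_sq]
    exact mul_le_of_le_one_right (sq_nonneg _) (inv_le_one_of_one_le₀ (by linarith))
  have h4 := abs_mul_le_of_sq_le (by positivity) h1 h2
  have e : energyCoef w ε a b a' l k = ‖vconst 2‖ ^ 2 * coupling 2 ε ^ 2 *
      ((hinv K ^ 2 * (1 + gain w ε K)⁻¹) *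
      ((hinv k * vertex w ε (k a - l) l) *
      (vertex w ε (K (b.succAbove a')) (K b) * hinv (fuse b a' K)))) := by
    rw [energyCoef]; ring
  rw [e, abs_mul, abs_mul (_ * (1 + _)⁻¹), abs_of_nonneg h3.1, abs_of_nonneg (by positivity)]
  calc _ ≤ ‖vconst 2‖ ^ 2 * coupling 2 ε ^ 2 * (2 * (1 / modeSq K) * (2 * ∑ b, w b ^ 2)) := by
        refine mul_le_mul_of_nonneg_left ?_ (by positivity)
        exact mul_le_mul h3.2 h4 (abs_nonneg _) (h3.1.trans h3.2)
    _ = _ := by ring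

/-- The off-diagonal terms of the self-energy are of order `λ²`. -/
lemma sqNorm_energyTerm_le (hw : w ≠ 0) (hε : 0 < ε) {a a' : Fin n} {b : Fin (n + 1)}
    (h : ¬ IsDiag a b (b.succAbove a')) (y : (Fin n → Fin 2 → ℤ) → ℂ) :
    sqNorm (energyTerm w ε y a b a') ≤ ENNReal.ofReal
      ((288 * ‖vconst 2‖ ^ 2 * (∑ b, w b ^ 2) * coupling 2 ε ^ 2) ^ 2) * sqNorm y := by
  have hm := sum_sq_pos hw
  obtain ⟨⟨ξ, hξ, hξ'⟩, β, hβ, hβ'⟩ := exists_of_not_isDiag h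
  obtain ⟨A, hA⟩ : ∃ A, A = 4 * ‖vconst 2‖ ^ 2 * (∑ b, w b ^ 2) * coupling 2 ε ^ 2 := ⟨_, rfl⟩
  have hA0 : 0 ≤ A := by rw [hA]; positivity
  have hcoef : ∀ l k, ‖(energyCoef w ε a b a' l k : ℂ)‖ₑ ≤
      ENNReal.ofReal A * schurKernel ξ β (split 0 a l k) := by
    intro l k
    rw [← ofReal_norm, Complex.norm_real, Real.norm_eq_abs]
    unfold schurKernel
    split_ifs with h0
    · rw [← ENNReal.ofReal_mul hA0]
      refine ENNReal.ofReal_le_ofReal ((abs_energyCoef_le hw hε a b a' l k).trans ?_)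
      have hne : ξ ≠ β := by
        rcases hβ with rfl | rfl
        · exact hξ'.1
        · exact hξ'.2
      have h1 := normSq_add_normSq_le_modeSq (split 0 a l k) hne
      have h2 := normSq_pos h0.1
      have h3 := normSq_pos h0.2
      rw [← hA]
      gcongr
    · have hz : energyCoef w ε a b a' l k = 0 := by
        rw [not_and_or, not_not, not_not] at h0
        rcases h0 with h0 | h0
        · have h1 : vertex w ε (k a - l) l = 0 := by
            refine vertex_eq_zero hε ?_
            rcases hξ with rfl | rfl
            · right; simpa using h0
            · left; rwa [split_apply_succAbove, Function.update_self] at h0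
          rw [energyCoef, h1]; ring
        · have h1 : vertex w ε (split 0 a l k (b.succAbove a')) (split 0 a l k b) = 0 := by
            refine vertex_eq_zero hε ?_
            rcases hβ with rfl | rfl
            · right; exact h0
            · left; exact h0
          rw [energyCoef, h1]; ring
      rw [hz]
      simp
  calc sqNorm (energyTerm w ε y a b a')
      ≤ ∑' k, (ENNReal.ofReal A * ∑' l, schurKernel ξ β (split 0 a l k) *
          ‖y (fuse b a' (split 0 a l k))‖ₑ) ^ 2 := by
        refine ENNReal.tsum_le_tsum fun k => ?_
        gcongr
        rw [← ENNReal.tsum_mul_left]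
        refine enorm_tsum_le_tsum_enorm.trans (ENNReal.tsum_le_tsum fun l => ?_)
        rw [enorm_mul, ← mul_assoc]
        gcongr
        exact hcoef l k
    _ = ENNReal.ofReal A ^ 2 * ∑' k, (∑' l, schurKernel ξ β (split 0 a l k) *
          ‖y (fuse b a' (split 0 a l k))‖ₑ) ^ 2 := by
        simp only [mul_pow, ENNReal.tsum_mul_left]
    _ ≤ ENNReal.ofReal A ^ 2 * (72 ^ 2 * ∑' k, ‖y k‖ₑ ^ 2) := by
        gcongr
        exact tsum_split_fuse_sq_le hξ hξ' hβ hβ' fun k => ‖y k‖ₑ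
    _ = ENNReal.ofReal ((72 * A) ^ 2) * sqNorm y := by
        rw [← ENNReal.ofReal_pow hA0, ← mul_assoc, mul_comm (ENNReal.ofReal _), mul_pow 72 A,
          ENNReal.ofReal_mul (by norm_num), sqNorm]
        norm_num
    _ = _ := by rw [hA]; ring_nf

/-- The contribution of the mode `a` to `gain`. -/
def gainMode (w : Fin 2 → ℝ) (ε : ℝ) (a : Fin n) (k : Fin n → Fin 2 → ℤ) : ℝ :=
  1 / 2 * dot w (k a) ^ 2 * diffusivity w ε (1 / 2 * modeSq k) * hinv k ^ 2

lemma gain_eq_sum (k : Fin n → Fin 2 → ℤ) : gain w ε k = ∑ a, gainMode w ε a k := by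
  simp only [gain, gainMode, Finset.mul_sum, Finset.sum_mul]

lemma norm_vconst_two_sq : ‖vconst 2‖ ^ 2 = 1 / (4 * Real.pi ^ 2) := by
  have h : (2 * Real.pi) ^ (((2 : ℕ) : ℝ) / 2) = 2 * Real.pi := by norm_num
  rw [vconst, h, norm_neg, norm_div, Complex.norm_I, Complex.norm_real, Real.norm_eq_abs,
    abs_of_pos (by positivity)]
  field_simp
  norm_num

/-- The diagonal terms of the self-energy are given by the effective diffusivity, up to an error of
order `λ²`. -/
lemma sqNorm_energyTerm_sub_le {C : ℝ} (hC0 : 0 < C)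
    (hC : ∀ p : Fin 2 → ℤ, p ≠ 0 → ∀ κ W : ℝ, normSq p ≤ κ → 0 ≤ W →
      W ≤ (∑ b, w b ^ 2) * (κ - normSq p) →
      |coupling 2 ε ^ 2 * (∑' l : Fin 2 → ℤ, cutoff ε (p - l) l *
          pairSymbol w ε κ W (p 0) (p 1) (l 0) (l 1)) - Real.pi ^ 2 * diffusivity w ε (κ / 2)| ≤
        C * coupling 2 ε ^ 2)
    {a a' : Fin n} {b : Fin (n + 1)} (h : IsDiag a b (b.succAbove a'))
    {y : (Fin n → Fin 2 → ℤ) → ℂ} (hy : SymMZ y) :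
    sqNorm (fun k => energyTerm w ε y a b a' k - ((1 / 2 * gainMode w ε a k : ℝ) : ℂ) * y k) ≤
      ENNReal.ofReal ((2 * ‖vconst 2‖ ^ 2 * (∑ b, w b ^ 2) * C * coupling 2 ε ^ 2) ^ 2) *
        sqNorm y := by
  have hm : 0 ≤ ∑ b, w b ^ 2 := Finset.sum_nonneg fun b _ => sq_nonneg _
  set B := 2 * ‖vconst 2‖ ^ 2 * (∑ b, w b ^ 2) * C * coupling 2 ε ^ 2 with hB
  have hB0 : 0 ≤ B := by positivity
  have hterm : ∀ k, energyTerm w ε y a b a' k = ((‖vconst 2‖ ^ 2 * (hinv k * dot w (k a)) ^ 2 *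
      (coupling 2 ε ^ 2 * ∑' l : Fin 2 → ℤ, cutoff ε (k a - l) l *
        pairSymbol w ε (modeSq k) (∑ c ∈ Finset.univ.erase a, dot w (k c) ^ 2) (k a 0) (k a 1)
        (l 0) (l 1)) : ℝ) : ℂ) * y k := by
    intro k
    rw [energyTerm]
    simp only [h.fuse_eq hy.1]
    rw [tsum_mul_right, ← Complex.ofReal_tsum, ← tsum_mul_left, ← tsum_mul_left]
    congr 3
    funext l
    rw [energyCoef, h.vertex_eq, h.fuse_eq (f := hinv) hinv_symm, symbol_split_eq, vertex_split_eq]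
    have := cutoff_mul_self ε (k a - l) l
    linear_combination (‖vconst 2‖ ^ 2 * coupling 2 ε ^ 2 * hinv k ^ 2 * dot w (k a) ^ 2 *
      pairSymbol w ε (modeSq k) (∑ c ∈ Finset.univ.erase a, dot w (k c) ^ 2) (k a 0) (k a 1)
        (l 0) (l 1)) * this
  have hpt : ∀ k, ‖energyTerm w ε y a b a' k - ((1 / 2 * gainMode w ε a k : ℝ) : ℂ) * y k‖ ≤
      ‖(B : ℂ) * y k‖ := by
    intro k
    by_cases hk : k a = 0
    · rw [hterm, hy.2 k ⟨a, hk⟩]; simp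
    rw [hterm, ← sub_mul, norm_mul, norm_mul, ← Complex.ofReal_sub, Complex.norm_real,
      Complex.norm_real, Real.norm_eq_abs, Real.norm_eq_abs, abs_of_nonneg hB0]
    gcongr
    have hW0 : 0 ≤ ∑ c ∈ Finset.univ.erase a, dot w (k c) ^ 2 :=
      Finset.sum_nonneg fun _ _ => sq_nonneg _
    have hW : ∑ c ∈ Finset.univ.erase a, dot w (k c) ^ 2 ≤
        (∑ b, w b ^ 2) * (modeSq k - normSq (k a)) := by
      rw [modeSq_eq, ← Finset.add_sum_erase _ (fun a => normSq (k a)) (Finset.mem_univ a),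
        add_sub_cancel_left, Finset.mul_sum]
      exact Finset.sum_le_sum fun c _ => dot_sq_le w (k c)
    have hmain := hC (k a) hk (modeSq k) _ (normSq_le_modeSq k a) hW0 hW
    set Z := coupling 2 ε ^ 2 * ∑' l : Fin 2 → ℤ, cutoff ε (k a - l) l *
        pairSymbol w ε (modeSq k) (∑ c ∈ Finset.univ.erase a, dot w (k c) ^ 2) (k a 0) (k a 1)
        (l 0) (l 1)
    have e : ‖vconst 2‖ ^ 2 * (hinv k * dot w (k a)) ^ 2 * Z - 1 / 2 * gainMode w ε a k =
        ‖vconst 2‖ ^ 2 * (hinv k * dot w (k a)) ^ 2 *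
          (Z - Real.pi ^ 2 * diffusivity w ε (modeSq k / 2)) := by
      have h1 : ‖vconst 2‖ ^ 2 * Real.pi ^ 2 = 1 / 4 := by
        rw [norm_vconst_two_sq]
        have := Real.pi_ne_zero
        field_simp
      rw [gainMode, show 1 / 2 * modeSq k = modeSq k / 2 by ring]
      linear_combination ((hinv k * dot w (k a)) ^ 2 * diffusivity w ε (modeSq k / 2)) * h1
    rw [e, abs_mul, abs_of_nonneg (by positivity)]
    calc _ ≤ ‖vconst 2‖ ^ 2 * (2 * ∑ b, w b ^ 2) * (C * coupling 2 ε ^ 2) := by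
          gcongr
          exact dot_hinv_sq_le k a
      _ = B := by rw [hB]; ring
  refine (sqNorm_mono hpt).trans (le_of_eq ?_)
  rw [sqNorm_const_mul, ← ofReal_norm, Complex.norm_real, Real.norm_eq_abs, abs_of_nonneg hB0,
    ENNReal.ofReal_pow hB0]

/-- On each chaos the self-energy of the ansatz differs from the multiplier `gain` by a bounded
operator of norm of order `λ²`. -/
lemma exists_selfEnergy_sub_gain_le (hw : w ≠ 0) (n : ℕ) : ∃ C : ℝ, 0 < C ∧
    ∀ ε, 0 < ε → ε ≤ 1 / 4 → ∀ y : (Fin n → Fin 2 → ℤ) → ℂ, SymMZ y →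
      sqNorm (fun k => pairAdj (coef w ε hinv hinv) (fun k => (((1 + gain w ε k)⁻¹ : ℝ) : ℂ) *
        pairOp (coef w ε hinv hinv) y k) k - (gain w ε k : ℂ) * y k) ≤
      ENNReal.ofReal ((C * coupling 2 ε ^ 2) ^ 2) * sqNorm y := by
  have hm := sum_sq_pos hw
  obtain ⟨C, hC0, hC⟩ := exists_abs_sum_pairSymbol_sub_le hw
  set N : ℕ := n * ((n + 1) * n) with hN
  set B := (288 + 2 * C) * ‖vconst 2‖ ^ 2 * (∑ b, w b ^ 2) with hB
  have hB0 : 0 ≤ B := by positivity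
  refine ⟨N * B + 1, by positivity, fun ε hε hε1 y hy => ?_⟩
  set F : Fin n × Fin (n + 1) × Fin n → (Fin n → Fin 2 → ℤ) → ℂ := fun i k =>
    energyTerm w ε y i.1 i.2.1 i.2.2 k -
      if IsDiag i.1 i.2.1 (i.2.1.succAbove i.2.2) then
        ((1 / 2 * gainMode w ε i.1 k : ℝ) : ℂ) * y k else 0 with hF
  have hsum : (fun k => pairAdj (coef w ε hinv hinv) (fun k => (((1 + gain w ε k)⁻¹ : ℝ) : ℂ) *
        pairOp (coef w ε hinv hinv) y k) k - (gain w ε k : ℂ) * y k) = fun k => ∑ i, F i k := by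
    funext k
    rw [selfEnergy_eq_sum hε hy, hF, Fintype.sum_prod_type]
    simp only [Fintype.sum_prod_type, Finset.sum_sub_distrib, sum_isDiag]
    congr 1
    rw [gain_eq_sum]
    push_cast
    rw [Finset.sum_mul]
    refine Finset.sum_congr rfl fun a _ => ?_
    ring
  have hFi : ∀ i, sqNorm (F i) ≤ ENNReal.ofReal ((B * coupling 2 ε ^ 2) ^ 2) * sqNorm y := by
    rintro ⟨a, b, a'⟩
    simp only [hF]
    by_cases h : IsDiag a b (b.succAbove a')
    · simp only [h, if_true]
      refine (sqNorm_energyTerm_sub_le hC0 (hC ε hε hε1) h hy).trans ?_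
      gcongr
      rw [hB]
      have : 0 ≤ 288 * (‖vconst 2‖ ^ 2 * (∑ b, w b ^ 2)) := by positivity
      nlinarith
    · simp only [h, if_false, sub_zero]
      refine (sqNorm_energyTerm_le hw hε h y).trans ?_
      gcongr
      rw [hB]
      have : 0 ≤ 2 * C * (‖vconst 2‖ ^ 2 * (∑ b, w b ^ 2)) := by positivity
      nlinarith
  rw [hsum]
  refine (sqNorm_sum_le Finset.univ F).trans ?_
  calc _ ≤ (Finset.univ : Finset (Fin n × Fin (n + 1) × Fin n)).card *
        ∑ _i : Fin n × Fin (n + 1) × Fin n,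
          ENNReal.ofReal ((B * coupling 2 ε ^ 2) ^ 2) * sqNorm y := by
        gcongr with i
        exact hFi i
    _ = ENNReal.ofReal ((N * B * coupling 2 ε ^ 2) ^ 2) * sqNorm y := by
        rw [Finset.sum_const, nsmul_eq_mul, Finset.card_univ, Fintype.card_prod, Fintype.card_prod,
          Fintype.card_fin, Fintype.card_fin, ← hN, ← mul_assoc, ← mul_assoc,
          ← ENNReal.ofReal_natCast N, ← ENNReal.ofReal_mul (by positivity),
          ← ENNReal.ofReal_mul (by positivity)]
        congr 2
        ring
    _ ≤ _ := by
        gcongr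
        linarith

end Replacement

/-! ### The energy of the ansatz -/

section Energy

open ContinuousLinearMap

variable {d n : ℕ}

lemma norm_le_of_sqNorm_le {α β : Type*} {x : lp (fun _ : α => ℂ) 2} {y : lp (fun _ : β => ℂ) 2}
    {c : ℝ} (hc : 0 ≤ c) (h : sqNorm x ≤ ENNReal.ofReal (c ^ 2) * sqNorm y) : ‖x‖ ≤ c * ‖y‖ := by
  rw [sqNorm_coe, sqNorm_coe, ← ENNReal.ofReal_mul (sq_nonneg _), ← mul_pow,
    ENNReal.ofReal_le_ofReal_iff (sq_nonneg _)] at h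
  exact le_of_sq_le_sq h (mul_nonneg hc (norm_nonneg _))

/-- Multiplication by a bounded nonnegative symmetric function acts on each chaos, and its quadratic
form is nonnegative. -/
lemma exists_mul_chaos {α : (Fin n → Fin d → ℤ) → ℝ} (hα : Symm α) {B : ℝ} (h0 : ∀ k, 0 ≤ α k)
    (hB : ∀ k, α k ≤ B) (x : chaos d n) :
    ∃ z : chaos d n, (∀ k, z.1 k = (α k : ℂ) * x.1 k) ∧ ‖z‖ ≤ B * ‖x‖ ∧
      0 ≤ (inner ℂ x z).re ∧ (inner ℂ x z).re ≤ B * ‖x‖ ^ 2 := by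
  have hB0 : 0 ≤ B := (h0 0).trans (hB 0)
  have h1 : sqNorm (fun k => (α k : ℂ) * x.1 k) ≤ ENNReal.ofReal (B ^ 2) * sqNorm x.1 := by
    refine (sqNorm_mono (g := fun k => (B : ℂ) * x.1 k) fun k => ?_).trans (le_of_eq ?_)
    · rw [norm_mul, norm_mul, Complex.norm_real, Complex.norm_real, Real.norm_eq_abs,
        Real.norm_eq_abs, abs_of_nonneg (h0 k), abs_of_nonneg hB0]
      gcongr
      exact hB k
    · rw [sqNorm_const_mul, ← ofReal_norm, Complex.norm_real, Real.norm_eq_abs, abs_of_nonneg hB0,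
        ENNReal.ofReal_pow hB0]
  obtain ⟨z, hz⟩ := exists_lp (h1.trans_lt
    (ENNReal.mul_lt_top ENNReal.ofReal_lt_top (sqNorm_coe_ne_top _).lt_top)).ne
  have hzs : SymMZ (z : _ → ℂ) := by
    rw [hz]
    exact x.2.mul fun σ k => by rw [hα σ k]
  have hn : ‖z‖ ≤ B * ‖x.1‖ := by
    rw [← hz] at h1
    exact norm_le_of_sqNorm_le hB0 h1
  refine ⟨⟨z, hzs⟩, fun k => congrFun hz k, hn, ?_, ?_⟩
  · have h2 := Complex.hasSum_re (lp.hasSum_inner (𝕜 := ℂ) x.1 z)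
    refine h2.nonneg fun k => ?_
    have h3 : inner ℂ (x.1 k) (z k) = ((α k * ‖x.1 k‖ ^ 2 : ℝ) : ℂ) := by
      rw [hz, RCLike.inner_apply, mul_assoc, RCLike.mul_conj]
      push_cast
      rfl
    rw [h3, Complex.ofReal_re]
    exact mul_nonneg (h0 k) (sq_nonneg _)
  · calc _ ≤ ‖inner ℂ x.1 z‖ := Complex.re_le_norm _
      _ ≤ ‖x.1‖ * ‖z‖ := norm_inner_le_norm _ _
      _ ≤ ‖x.1‖ * (B * ‖x.1‖) := by gcongr
      _ = B * ‖x‖ ^ 2 := by rw [← Submodule.coe_norm]; ring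

lemma energy_le {E : Type*} [NormedAddCommGroup E] [InnerProductSpace ℂ E] {z gz y : E}
    (hz : z + gz = y) (h0 : 0 ≤ (inner ℂ z gz).re) : ‖z‖ ^ 2 + (inner ℂ z gz).re ≤ ‖y‖ ^ 2 := by
  have e1 : ‖z‖ ^ 2 + (inner ℂ z gz).re = (inner ℂ z y).re := by
    rw [← hz, inner_add_right, Complex.add_re, inner_self_eq_norm_sq_to_K]
    norm_cast
  have e2 : (inner ℂ z y).re ≤ ‖z‖ * ‖y‖ := by
    calc _ ≤ ‖inner ℂ z y‖ := Complex.re_le_norm _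
      _ ≤ _ := norm_inner_le_norm _ _
  nlinarith [sq_nonneg (‖z‖ - ‖y‖)]

/-- If `z + gz = T x` and `T† z` is close to `gx`, then the energy `‖z‖² + Re ⟨z, gz⟩` is smaller
than the one of `x` by a fixed factor. -/
lemma energy_contraction {E F : Type*} [NormedAddCommGroup E] [InnerProductSpace ℂ E]
    [CompleteSpace E] [NormedAddCommGroup F] [InnerProductSpace ℂ F] [CompleteSpace F]
    (T : E →L[ℂ] F) {x gx : E} {z gz : F} {γ δ : ℝ} (hγ : 0 ≤ γ) (hδ : 0 ≤ δ)
    (hz : z + gz = T x) (hr : ‖adjoint T z - gx‖ ≤ δ * ‖x‖) (h0 : 0 ≤ (inner ℂ x gx).re)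
    (h1 : (inner ℂ x gx).re ≤ γ * ‖x‖ ^ 2) :
    ‖z‖ ^ 2 + (inner ℂ z gz).re ≤ (γ / (1 + γ) + δ) * (‖x‖ ^ 2 + (inner ℂ x gx).re) := by
  have e1 : ‖z‖ ^ 2 + (inner ℂ z gz).re = (inner ℂ z (T x)).re := by
    rw [← hz, inner_add_right, Complex.add_re, inner_self_eq_norm_sq_to_K]
    norm_cast
  have e2 : (inner ℂ z (T x)).re = (inner ℂ x gx).re + (inner ℂ (adjoint T z - gx) x).re := by
    rw [← adjoint_inner_left, ← inner_conj_symm x gx, Complex.conj_re, ← Complex.add_re,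
      ← inner_add_left]
    congr 2
    abel
  have h2 : (inner ℂ (adjoint T z - gx) x).re ≤ δ * ‖x‖ ^ 2 := by
    calc _ ≤ ‖inner ℂ (adjoint T z - gx) x‖ := Complex.re_le_norm _
      _ ≤ ‖adjoint T z - gx‖ * ‖x‖ := norm_inner_le_norm _ _
      _ ≤ δ * ‖x‖ * ‖x‖ := by gcongr
      _ = _ := by ring
  obtain ⟨A, hA⟩ : ∃ A, A = (inner ℂ x gx).re := ⟨_, rfl⟩
  rw [← hA] at e2 h0 h1
  rw [e1, e2, ← hA]
  have h3 : A ≤ γ / (1 + γ) * (‖x‖ ^ 2 + A) := by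
    rw [div_mul_eq_mul_div, le_div_iff₀ (by positivity)]
    linarith
  have h4 : δ * ‖x‖ ^ 2 ≤ δ * (‖x‖ ^ 2 + A) := by gcongr; linarith
  linarith

end Energy

/-! ### The ansatz equation -/

section Ansatz

open ContinuousLinearMap

variable {w : Fin 2 → ℝ} {ε : ℝ} {p n : ℕ} {f : Kernels 2}

lemma nrm_ansatzInv (g : Kernels 2) (m : ℕ) (k) :
    nrm (ansatzInv w ε g) m k = (((1 + gain w ε k)⁻¹ : ℝ) : ℂ) * dualNrm g m k := by
  rw [nrm, ansatzInv, ansatz_multiplier_eq, dualNrm]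
  have h : hroot k * hinv k ^ 2 = hinv k := by
    rw [hinv]
    by_cases h0 : hroot k = 0
    · simp [h0]
    · field_simp
  have h' : (hroot k : ℂ) * (hinv k : ℂ) ^ 2 = hinv k := by exact_mod_cast h
  push_cast
  linear_combination (Real.sqrt m.factorial : ℂ) * (1 + (gain w ε k : ℂ))⁻¹ * g m k * h'

lemma nrm_add {d : ℕ} (f g : Kernels d) (m : ℕ) (k) : nrm (f + g) m k = nrm f m k + nrm g m k :=
  mul_add _ _ _

/-- The ansatz equation in normalised coordinates. -/
lemma nrm_ansatz {v : Kernels 2} (hv : Centred v) (hpn : p + 1 ≤ n)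
    (hz : ∀ m, m < p + 1 ∨ n < m → v m = 0) (m : ℕ) (k) :
    nrm (ansatzInv w ε (creation w ε (chaosProj (p + 1) (n - 1) v)) +
      ansatzInv w ε (creation w ε f)) (m + 1) k =
      (((1 + gain w ε k)⁻¹ : ℝ) : ℂ) * ((if m < n then pairOp (coef w ε hinv hinv) (nrm v m) k else 0)
        + dualNrm (creation w ε f) (m + 1) k) := by
  rw [nrm_add, nrm_ansatzInv, nrm_ansatzInv, dualNrm_creation (chaosProj_centred hv _ _), ← mul_add]
  congr 2
  split_ifs with h
  · congr 1
    funext k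
    rw [nrm, nrm, chaosProj]
    split_ifs with h1
    · rfl
    · rw [hz m (by omega)]; rfl
  · have : nrm (chaosProj (p + 1) (n - 1) v) m = 0 := nrm_eq_zero (by
      funext k; rw [chaosProj, if_neg (by omega)]; rfl)
    rw [this, pairOp_zero]
    rfl

lemma IsAnsatzSolution.nrm_succ {v : Kernels 2} (hv : IsAnsatzSolution w ε (p + 1) n f v)
    (hpn : p + 1 ≤ n) {m : ℕ} (hm : m < n) (k) :
    nrm v (m + 1) k = (((1 + gain w ε k)⁻¹ : ℝ) : ℂ) *
      (pairOp (coef w ε hinv hinv) (nrm v m) k + dualNrm (creation w ε f) (m + 1) k) := by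
  have h := nrm_ansatz (f := f) (w := w) (ε := ε) (hv.1.centred (Nat.succ_pos p)) hpn
    (fun m hm => hv.1.eq_zero hm) m k
  rw [← hv.2, if_pos hm] at h
  exact h

/-- The ansatz equation determines the chaoses one after the other. -/
lemma IsAnsatzSolution.unique {u v : Kernels 2} (hu : IsAnsatzSolution w ε (p + 1) n f u)
    (hv : IsAnsatzSolution w ε (p + 1) n f v) (hpn : p + 1 ≤ n) : u = v := by
  refine eq_of_nrm_eq (hu.1.centred (Nat.succ_pos p)) (hv.1.centred (Nat.succ_pos p)) fun m => ?_
  induction m with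
  | zero => rw [nrm_eq_zero (hu.1.eq_zero (Or.inl (Nat.succ_pos p))),
      nrm_eq_zero (hv.1.eq_zero (Or.inl (Nat.succ_pos p)))]
  | succ m ih =>
    by_cases hm : m < n
    · funext k
      rw [hu.nrm_succ hpn hm, hv.nrm_succ hpn hm, ih]
    · rw [nrm_eq_zero (hu.1.eq_zero (Or.inr (by omega))),
        nrm_eq_zero (hv.1.eq_zero (Or.inr (by omega)))]

/-- Solutions of the recursion in normalised coordinates solve the ansatz equation. -/
lemma isAnsatzSolution_ofNrm (hfp : ∀ m, m ≠ p → f m = 0) (hpn : p + 1 ≤ n) {x : ∀ m, chaos 2 m}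
    (h0 : ∀ m, m < p + 1 ∨ n < m → x m = 0)
    (hx : ∀ m, m < n → ∀ k, (x (m + 1)).1 k = (((1 + gain w ε k)⁻¹ : ℝ) : ℂ) *
      (pairOp (coef w ε hinv hinv) (x m).1 k + dualNrm (creation w ε f) (m + 1) k)) :
    IsAnsatzSolution w ε (p + 1) n f (ofNrm fun m => (x m).1) := by
  have hs : ∀ m, SymMZ ((x m).1 : _ → ℂ) := fun m => (x m).2
  have h0' : ∀ m, m < p + 1 ∨ n < m → ((x m).1 : _ → ℂ) = 0 := fun m hm => by rw [h0 m hm]; rfl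
  set v : Kernels 2 := ofNrm fun m => (x m).1 with hv
  have hvc : Centred v := ofNrm_centred hs (h0' 0 (by omega))
  have hnrm : ∀ m, nrm v m = (x m).1 := nrm_ofNrm hs (h0' 0 (by omega))
  have hv0 : ∀ m, m < p + 1 ∨ n < m → v m = 0 := fun m hm => by
    funext k; simp only [hv, ofNrm]; rw [h0' m hm]; simp
  refine ⟨⟨inFock_ofNrm hs (h0' 0 (by omega)) (fun m => sqNorm_coe_ne_top _)
    (fun m hm => h0' m (Or.inr hm)), ?_⟩, ?_⟩
  · funext m k
    rw [chaosProj]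
    split_ifs with h
    · rfl
    · rw [hv0 m (by omega)]; rfl
  · funext m k
    by_cases hk : k = 0
    · rw [hk, hvc.zero_mode]
      simp [ansatzInv, modeSq, dot]
    · have h1 : ((Real.sqrt m.factorial * hroot k : ℝ) : ℂ) ≠ 0 := by
        rw [Complex.ofReal_ne_zero]
        have := mt hroot_eq_zero.1 hk
        positivity
      refine mul_left_cancel₀ h1 ?_
      change nrm v m k = nrm _ m k
      cases m with
      | zero => exact absurd (Subsingleton.elim k 0) hk
      | succ m =>
        rw [nrm_ansatz hvc hpn hv0, hnrm, hnrm]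
        split_ifs with h
        · exact hx m h k
        · rw [h0' (m + 1) (by omega), dualNrm, creation_eq_zero (hfp m (by omega))]
          simp

/-- Existence for the recursion of the ansatz. -/
lemma exists_ansatz_recursion (hw : w ≠ 0) (hε : 0 < ε)
    {T : ∀ m, chaos 2 m →L[ℂ] chaos 2 (m + 1)}
    (hT : ∀ m y, ((T m y).1 : _ → ℂ) = pairOp (coef w ε hinv hinv) y.1)
    {Y : ∀ m, chaos 2 m} (hY : ∀ m, m ≠ p + 1 → Y m = 0) (hpn : p + 1 ≤ n) :
    ∃ x : ∀ m, chaos 2 m, (∀ m, m < p + 1 ∨ n < m → x m = 0) ∧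
      ∀ m, m < n → ∀ k, (x (m + 1)).1 k = (((1 + gain w ε k)⁻¹ : ℝ) : ℂ) *
        (pairOp (coef w ε hinv hinv) (x m).1 k + (Y (m + 1)).1 k) := by
  have hS : ∀ (m : ℕ) (y : chaos 2 m), ∃ z : chaos 2 m,
      ∀ k, z.1 k = (((1 + gain w ε k)⁻¹ : ℝ) : ℂ) * y.1 k := fun m y => by
    obtain ⟨z, hz, -⟩ := exists_mul_chaos (B := 1) (α := fun k => (1 + gain w ε k)⁻¹)
      (fun σ k => by simp only [gain_symm σ k])
      (fun k => inv_nonneg.2 (by linarith [gain_nonneg hw hε k]))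
      (fun k => inv_le_one_of_one_le₀ (by linarith [gain_nonneg hw hε k])) y
    exact ⟨z, hz⟩
  choose S hS using hS
  let x : ∀ m, chaos 2 m := fun m => Nat.rec 0
    (fun m y => if m < n then S (m + 1) (T m y + Y (m + 1)) else 0) m
  have hx : ∀ m, x (m + 1) = if m < n then S (m + 1) (T m (x m) + Y (m + 1)) else 0 := fun m => rfl
  have hx' : ∀ m, m < n → ∀ k, (x (m + 1)).1 k = (((1 + gain w ε k)⁻¹ : ℝ) : ℂ) *
        (pairOp (coef w ε hinv hinv) (x m).1 k + (Y (m + 1)).1 k) := fun m hm k => by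
    rw [hx, if_pos hm, hS, Submodule.coe_add, lp.coeFn_add, Pi.add_apply, hT]
  refine ⟨x, ?_, hx'⟩
  have hlow : ∀ m, m < p + 1 → x m = 0 := fun m => by
    induction m with
    | zero => exact fun _ => rfl
    | succ m ih =>
      intro hm
      apply Subtype.ext
      apply lp.ext
      funext k
      rw [hx' m (by omega), ih (by omega), hY (m + 1) (by omega)]
      change _ * (pairOp _ 0 k + 0) = 0
      rw [pairOp_zero]
      simp
  rintro m (hm | hm)
  · exact hlow m hm
  · cases m with
    | zero => rfl
    | succ m => rw [hx, if_neg (by omega)]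

end Ansatz

section Residual

open ContinuousLinearMap

variable {w : Fin 2 → ℝ} {ε : ℝ} {p n : ℕ} {f : Kernels 2}

/-- The residual of the solution of the ansatz equation in each chaos: below the chaos `n` it is the
error of the replacement of the self-energy by `gain`. -/
lemma IsAnsatzSolution.residual (hw : w ≠ 0) (hε : 0 < ε) (hfp : ∀ m, m ≠ p → f m = 0)
    (hpn : p + 1 ≤ n) {v : Kernels 2} (hv : IsAnsatzSolution w ε (p + 1) n f v)
    {D : ∀ m, (Fin m → Fin 2 → ℤ) → ℂ}
    (hD : D = dualNrm (-generator w ε v - creation w ε f +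
      annihilation w ε (chaosProj (p + 1) (p + 1) v))) :
    (∀ m, m < p + 1 ∨ n + 1 < m → D m = 0) ∧
    (∀ m, p + 1 ≤ m → m < n → D m = fun k => pairAdj (coef w ε hinv hinv)
      (fun k => (((1 + gain w ε k)⁻¹ : ℝ) : ℂ) * pairOp (coef w ε hinv hinv) (nrm v m) k) k -
        (gain w ε k : ℂ) * nrm v m k) ∧
    (D n = fun k => -((gain w ε k : ℂ) * nrm v n k)) ∧
    D (n + 1) = fun k => -pairOp (coef w ε hinv hinv) (nrm v n) k := by
  have hvc : Centred v := hv.1.centred (by omega)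
  have hann : ∀ m, m ≠ p → ∀ k,
      dualNrm (annihilation w ε (chaosProj (p + 1) (p + 1) v)) m k = 0 := by
    intro m hm k
    rw [dualNrm, annihilation_eq_zero, Pi.zero_apply, mul_zero]
    funext k
    rw [chaosProj, if_neg (by omega)]
    rfl
  have hcr : ∀ m, m ≠ p → ∀ k, dualNrm (creation w ε f) (m + 1) k = 0 := fun m hm k => by
    rw [dualNrm, creation_eq_zero (hfp m hm), Pi.zero_apply, mul_zero]
  have hz : ∀ m, m < p + 1 ∨ n < m → nrm v m = 0 := fun m hm => nrm_eq_zero (hv.1.eq_zero hm)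
  have e0 : ∀ m k, D (m + 1) k = nrm v (m + 1) k - pairOp (coef w ε hinv hinv) (nrm v m) k +
      pairAdj (coef w ε hinv hinv) (nrm v (m + 2)) k - dualNrm (creation w ε f) (m + 1) k +
      dualNrm (annihilation w ε (chaosProj (p + 1) (p + 1) v)) (m + 1) k := by
    intro m k
    rw [hD, ← dualNrm_truncated hvc, dualNrm_add, dualNrm_sub]
    congr 2
    simp only [dualNrm, generator, Pi.neg_apply, Pi.sub_apply, Pi.add_apply]
    ring
  -- `(1 + gain) v = T v + 𝓐₊ f` in chaos `m + 1`
  have hrec : ∀ m, m < n → ∀ k, nrm v (m + 1) k - pairOp (coef w ε hinv hinv) (nrm v m) k -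
      dualNrm (creation w ε f) (m + 1) k = -((gain w ε k : ℂ) * nrm v (m + 1) k) := by
    intro m hm k
    have h1 : (1 + gain w ε k : ℂ) ≠ 0 := by
      have := gain_nonneg hw hε k
      exact_mod_cast (by positivity : 1 + gain w ε k ≠ 0)
    have h2 := hv.nrm_succ hpn hm k
    push_cast at h2
    rw [inv_mul_eq_div, eq_div_iff h1] at h2
    linear_combination h2
  refine ⟨fun m hm => funext fun k => ?_, fun m h1 h2 => funext fun k => ?_, funext fun k => ?_,
    funext fun k => ?_⟩
  · cases m with
    | zero => rw [hD, dualNrm_zero_left]; rfl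
    | succ m =>
      rw [e0, hz m (by omega), hz (m + 1) (by omega), pairOp_zero, hcr m (by omega)]
      by_cases h2 : m + 1 = p
      · subst h2
        rw [dualNrm_annihilation (chaosProj_centred hvc _ _)]
        have : nrm (chaosProj (m + 1 + 1) (m + 1 + 1) v) (m + 1 + 1) = nrm v (m + 1 + 1) := by
          funext k; simp [nrm, chaosProj]
        rw [this]
        simp
      · rw [hann _ h2, hz (m + 2) (by omega), pairAdj_zero]
        simp
  · obtain ⟨m, rfl⟩ : ∃ m', m = m' + 1 := ⟨m - 1, by omega⟩
    have h3 : nrm v (m + 2) = fun k => (((1 + gain w ε k)⁻¹ : ℝ) : ℂ) *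
        pairOp (coef w ε hinv hinv) (nrm v (m + 1)) k := by
      funext k
      rw [hv.nrm_succ hpn h2, hcr (m + 1) (by omega), add_zero]
    rw [e0, hann _ (by omega), ← h3]
    linear_combination hrec m (by omega) k
  · obtain ⟨n, rfl⟩ : ∃ n', n = n' + 1 := ⟨n - 1, by omega⟩
    rw [e0, hann _ (by omega), hz (n + 2) (by omega), pairAdj_zero, Pi.zero_apply]
    linear_combination hrec n (by omega) k
  · rw [e0, hann _ (by omega), hz (n + 2) (by omega), hz (n + 1) (by omega), pairAdj_zero,
      hcr n (by omega)]
    simp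

/-- Geometric decay of the solution of the ansatz equation in the order of the chaos. -/
lemma ansatz_decay (hw : w ≠ 0) (hε : 0 < ε) (hε1 : ε ≤ 1 / 4)
    {T : ∀ m, chaos 2 m →L[ℂ] chaos 2 (m + 1)}
    (hT : ∀ m y, ((T m y).1 : _ → ℂ) = pairOp (coef w ε hinv hinv) y.1)
    (hT' : ∀ m x, ((adjoint (T m) x).1 : _ → ℂ) = pairAdj (coef w ε hinv hinv) x.1)
    {Y x : ∀ m, chaos 2 m} (hY : ∀ m, m ≠ p + 1 → Y m = 0) (hpn : p + 1 ≤ n) (hx0 : x p = 0)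
    (hx : ∀ m, m < n → ∀ k, (x (m + 1)).1 k = (((1 + gain w ε k)⁻¹ : ℝ) : ℂ) *
      (pairOp (coef w ε hinv hinv) (x m).1 k + (Y (m + 1)).1 k))
    {δ : ℝ} (hδ : 0 ≤ δ)
    (herr : ∀ m, m < n → ∀ y : (Fin m → Fin 2 → ℤ) → ℂ, SymMZ y →
      sqNorm (fun k => pairAdj (coef w ε hinv hinv) (fun k => (((1 + gain w ε k)⁻¹ : ℝ) : ℂ) *
        pairOp (coef w ε hinv hinv) y k) k - (gain w ε k : ℂ) * y k) ≤
      ENNReal.ofReal (δ ^ 2) * sqNorm y) {m : ℕ} (h1 : p + 1 ≤ m) (h2 : m ≤ n) :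
    ‖x m‖ ^ 2 ≤ ((∑ b, w b ^ 2) / (1 + ∑ b, w b ^ 2) + δ) ^ (m - (p + 1)) * ‖Y (p + 1)‖ ^ 2 := by
  have hγ := sum_sq_pos hw
  choose g hg hgn hg0 hg1 using fun m => exists_mul_chaos (gain_symm (w := w) (ε := ε) (n := m))
    (gain_nonneg hw hε) (gain_le hw hε hε1) (x m)
  have hrec : ∀ m, m < n → x (m + 1) + g (m + 1) = T m (x m) + Y (m + 1) := by
    intro m hm
    apply Subtype.ext
    apply lp.ext
    funext k
    have h1 : (1 + gain w ε k : ℂ) ≠ 0 := by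
      have := gain_nonneg hw hε k
      exact_mod_cast (by positivity : 1 + gain w ε k ≠ 0)
    have h2 := hx m hm k
    push_cast at h2
    rw [inv_mul_eq_div, eq_div_iff h1] at h2
    simp only [Submodule.coe_add, lp.coeFn_add, Pi.add_apply, hT, hg]
    linear_combination h2
  suffices h : ‖x m‖ ^ 2 + (inner ℂ (x m) (g m)).re ≤
      ((∑ b, w b ^ 2) / (1 + ∑ b, w b ^ 2) + δ) ^ (m - (p + 1)) * ‖Y (p + 1)‖ ^ 2 by
    linarith [hg0 m]
  induction m, h1 using Nat.le_induction with
  | base =>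
    have h3 := hrec p (by omega)
    rw [hx0, map_zero, zero_add] at h3
    rw [Nat.sub_self, pow_zero, one_mul]
    exact energy_le h3 (hg0 _)
  | succ m h1 ih =>
    have h3 : ‖adjoint (T m) (x (m + 1)) - g m‖ ≤ δ * ‖x m‖ := by
      have h4 := herr m (by omega) (x m).1 (x m).2
      have h5 : (fun k => pairAdj (coef w ε hinv hinv) (fun k => (((1 + gain w ε k)⁻¹ : ℝ) : ℂ) *
          pairOp (coef w ε hinv hinv) (x m).1 k) k - (gain w ε k : ℂ) * (x m).1 k) =
          ((adjoint (T m) (x (m + 1)) - g m : chaos 2 m).1 : _ → ℂ) := by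
        funext k
        rw [Submodule.coe_sub, lp.coeFn_sub, Pi.sub_apply, hT', hg]
        congr 2
        funext k
        rw [hx m (by omega), hY (m + 1) (by omega)]
        change _ = _ * (_ + 0)
        rw [add_zero]
      rw [h5] at h4
      exact norm_le_of_sqNorm_le hδ h4
    have h4 := hrec m (by omega)
    rw [hY (m + 1) (by omega), add_zero] at h4
    have h5 := energy_contraction (T m) hγ.le hδ h4 h3 (hg0 m) (hg1 m)
    refine h5.trans ?_
    rw [Nat.sub_add_comm h1, pow_succ' _ (m - (p + 1)), mul_assoc]
    gcongr
    exact ih (by omega)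

end Residual

section Conclusion

open ContinuousLinearMap

variable {w : Fin 2 → ℝ}

/-- In dimension two the coupling constant vanishes as the scale tends to zero. -/
lemma exists_coupling_two_sq_le {δ : ℝ} (hδ : 0 < δ) :
    ∃ ε₀ : ℝ, 0 < ε₀ ∧ ε₀ ≤ 1 / 4 ∧ ∀ ε, 0 < ε → ε < ε₀ → coupling 2 ε ^ 2 ≤ δ := by
  refine ⟨min (1 / 4) (Real.exp (-(1 / (2 * δ)))), by positivity, min_le_left _ _,
    fun ε hε h => ?_⟩
  have h1 : ε < 1 / 4 := h.trans_le (min_le_left _ _)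
  have h2 : Real.log ε < -(1 / (2 * δ)) := by
    rw [Real.log_lt_iff_lt_exp hε]
    exact h.trans_le (min_le_right _ _)
  have h3 : 1 / (2 * δ) < Real.log (1 / ε) := by
    rw [one_div ε, Real.log_inv]
    linarith
  rw [coupling_two_sq hε (by linarith)]
  have h4 : 0 < 1 / (2 * δ) := by positivity
  rw [div_le_iff₀ (by linarith), ← div_le_iff₀' hδ]
  calc 1 / δ = 2 * (1 / (2 * δ)) := by field_simp
    _ ≤ _ := by linarith

/-- Powers of `n` are absorbed by geometric factors. -/
lemma exists_sq_mul_pow_le {θ : ℝ} (h0 : 0 < θ) (h1 : θ < 1) (q : ℕ) :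
    ∃ B : ℝ, 0 < B ∧ ∀ n : ℕ, 0 < n → (n : ℝ) ^ 2 * θ ^ n ≤ B / ((n : ℝ) ^ q) ^ 2 := by
  have ht := tendsto_pow_const_mul_const_pow_of_abs_lt_one (2 * q + 2) (r := θ)
    (by rwa [abs_of_pos h0])
  obtain ⟨B, hB⟩ := ht.bddAbove_range
  refine ⟨max B 1, by positivity, fun n hn => ?_⟩
  have hn' : (0 : ℝ) < n := by exact_mod_cast hn
  rw [le_div_iff₀ (by positivity)]
  calc _ = (n : ℝ) ^ (2 * q + 2) * θ ^ n := by ring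
    _ ≤ B := hB ⟨n, rfl⟩
    _ ≤ _ := le_max_left _ _

/-- The theorem in dimension two. The threshold for the scale makes the error of the replacement of
the self-energy by `gain` smaller than `θ^n`, for some `θ < 1`. -/
lemma exists_ansatz (hw : w ≠ 0) :
    ∃ ε₂ : ℕ → ℝ, (∀ n, 0 < ε₂ n) ∧ ∀ q : ℕ,
    ∃ K : ℝ, 0 < K ∧ ∀ p, p = 1 ∨ p = 2 → ∀ n, p + 1 ≤ n → ∀ f : Kernels 2, Centred f →
      (∀ m, sqNorm (f m) ≠ ⊤) → (∀ m, m ≠ p → f m = 0) → ∀ ε, 0 < ε → ε < ε₂ n →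
      ∃ v, IsAnsatzSolution w ε (p + 1) n f v ∧
        (∀ u, IsAnsatzSolution w ε (p + 1) n f u → u = v) ∧
        fockNorm (negSymGenPow (-1 / 2) (-generator w ε v - creation w ε f +
          annihilation w ε (chaosProj (p + 1) (p + 1) v))) ≤
          ENNReal.ofReal (K / (n : ℝ) ^ q) * fockNorm (negSymGenPow (1 / 2) f) := by
  have hγ := sum_sq_pos hw
  obtain ⟨γ, hγd⟩ : ∃ γ, γ = ∑ b, w b ^ 2 := ⟨_, rfl⟩
  rw [← hγd] at hγ
  -- half of the gap between `γ / (1 + γ)` and `1` is left for the replacement errors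
  obtain ⟨θ, hθd⟩ : ∃ θ, θ = (1 + γ / (1 + γ)) / 2 := ⟨_, rfl⟩
  have hθ1 : γ / (1 + γ) < 1 := by rw [div_lt_one (by linarith)]; linarith
  have hθ0 : 0 < γ / (1 + γ) := by positivity
  have hθ : 0 < θ ∧ θ < 1 := ⟨by linarith, by linarith⟩
  choose Cs hCs0 hCs using exists_selfEnergy_sub_gain_le hw
  set η : ℕ → ℝ := fun n => min ((1 - γ / (1 + γ)) / 2) (θ ^ n) with hη
  have hη0 : ∀ n, 0 < η n := fun n => lt_min (by linarith) (pow_pos hθ.1 n)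
  have hS : ∀ n, 0 ≤ ∑ j ∈ Finset.range n, Cs j := fun n =>
    Finset.sum_nonneg fun j _ => (hCs0 j).le
  choose ε₂ hε₂0 hε₂1 hε₂ using fun n => exists_coupling_two_sq_le
    (δ := η n / (1 + ∑ j ∈ Finset.range n, Cs j)) (div_pos (hη0 n) (by linarith [hS n]))
  obtain ⟨C, hC0, hC⟩ := exists_coupling_sum_le (d := 2) le_rfl
  obtain ⟨M, hM⟩ : ∃ M, M = 4 * ‖vconst 2‖ ^ 2 * C * γ := ⟨_, rfl⟩
  have hM0 : 0 ≤ M := by rw [hM]; positivity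
  refine ⟨ε₂, hε₂0, fun q => ?_⟩
  obtain ⟨B, hB0, hB⟩ := exists_sq_mul_pow_le hθ.1 hθ.2 q
  have hθ3 : 0 < (θ ^ 3)⁻¹ := inv_pos.2 (pow_pos hθ.1 3)
  -- the summand `1` only makes the constant positive
  refine ⟨Real.sqrt (2 * M * (1 + γ ^ 2 + M) * (θ ^ 3)⁻¹ * B + 1), by positivity, ?_⟩
  intro p hp n hpn f hf hfs hfp ε hε hεn
  have hε1 : ε ≤ 1 / 4 := hεn.le.trans (hε₂1 n)
  have hCε := hC ε hε (by linarith) (fun _ => by linarith)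
  choose T hT hT' hTn using fun m => exists_creation_clm w hε hCε hC0.le m
  -- by the choice of the threshold, the replacement error is at most `η n ≤ θ ^ n`
  have herr : ∀ m, m < n → ∀ y : (Fin m → Fin 2 → ℤ) → ℂ, SymMZ y →
      sqNorm (fun k => pairAdj (coef w ε hinv hinv) (fun k => (((1 + gain w ε k)⁻¹ : ℝ) : ℂ) *
        pairOp (coef w ε hinv hinv) y k) k - (gain w ε k : ℂ) * y k) ≤
      ENNReal.ofReal (η n ^ 2) * sqNorm y := by
    intro m hm y hy
    refine (hCs m ε hε hε1 y hy).trans ?_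
    gcongr
    · have := (hCs0 m).le; positivity
    calc Cs m * coupling 2 ε ^ 2
        ≤ (1 + ∑ j ∈ Finset.range n, Cs j) * (η n / (1 + ∑ j ∈ Finset.range n, Cs j)) := by
          gcongr
          · linarith [hS n]
          · have := Finset.single_le_sum (fun j _ => (hCs0 j).le) (Finset.mem_range.2 hm)
            linarith
          · exact hε₂ n ε hε hεn
      _ = η n := by
          have := hS n
          field_simp
  have hYex : ∀ m, ∃ y : chaos 2 m, (y.1 : _ → ℂ) = dualNrm (creation w ε f) m := by
    intro m
    cases m with
    | zero =>
      refine ⟨0, ?_⟩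
      funext k
      rw [dualNrm_zero_left]
      rfl
    | succ m => exact exists_chaos_creation hε hCε hf (hfs m)
  choose Y hY using hYex
  have hY0 : ∀ m, m ≠ p + 1 → Y m = 0 := by
    intro m hm
    apply Subtype.ext
    apply lp.ext
    rw [hY]
    funext k
    cases m with
    | zero => rw [dualNrm_zero_left]; rfl
    | succ m => rw [dualNrm, creation_eq_zero (hfp m (by omega)), Pi.zero_apply, mul_zero]; rfl
  obtain ⟨x, h0, hx⟩ := exists_ansatz_recursion hw hε hT hY0 hpn
  have hsol : IsAnsatzSolution w ε (p + 1) n f (ofNrm fun m => (x m).1) :=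
    isAnsatzSolution_ofNrm hfp hpn h0 fun m hm k => by rw [hx m hm k, hY]
  refine ⟨_, hsol, fun u hu => hu.unique hsol hpn, ?_⟩
  have hn0 : (0 : ℝ) < n := by exact_mod_cast (by omega : 0 < n)
  have hn1 : (1 : ℝ) ≤ n := by exact_mod_cast (by omega : 1 ≤ n)
  have hp2 : (p : ℝ) ≤ 2 := by rcases hp with rfl | rfl <;> norm_num
  have hdec : ∀ m, p + 1 ≤ m → m ≤ n → ‖x m‖ ^ 2 ≤ θ ^ (m - (p + 1)) * ‖Y (p + 1)‖ ^ 2 := by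
    intro m h1 h2
    refine (ansatz_decay hw hε hε1 hT hT' hY0 hpn (h0 p (Or.inl (Nat.lt_succ_self p))) hx (hη0 n).le
      herr h1 h2).trans ?_
    rw [← hγd]
    have h3 : η n ≤ (1 - γ / (1 + γ)) / 2 := min_le_left _ _
    have h4 := hη0 n
    gcongr
    linarith
  have hxn : ‖x n‖ ^ 2 ≤ (θ ^ 3)⁻¹ * θ ^ n * ‖Y (p + 1)‖ ^ 2 := by
    refine (hdec n hpn le_rfl).trans ?_
    gcongr
    rw [inv_mul_eq_div, le_div_iff₀ (pow_pos hθ.1 3), ← pow_add]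
    exact pow_le_pow_of_le_one hθ.1.le hθ.2.le (by rcases hp with rfl | rfl <;> omega)
  have hθ3inv : 1 ≤ (θ ^ 3)⁻¹ := one_le_inv₀ (pow_pos hθ.1 3) |>.2 (pow_le_one₀ hθ.1.le hθ.2.le)
  obtain ⟨R, hRd⟩ : ∃ R, R = (1 + γ ^ 2 + M) * n * ((θ ^ 3)⁻¹ * θ ^ n) := ⟨_, rfl⟩
  have hθn := pow_pos hθ.1 n
  have hR0 : 0 ≤ R := by rw [hRd]; positivity
  have hnrm : ∀ m, nrm (ofNrm fun m => ((x m).1 : _ → ℂ)) m = (x m).1 :=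
    nrm_ofNrm (fun m => (x m).2) (by rw [h0 0 (by omega)]; rfl)
  obtain ⟨r1, r2, r3, r4⟩ := hsol.residual hw hε hfp hpn rfl
  simp only [hnrm] at r2 r3 r4
  obtain ⟨D, hD⟩ : ∃ D, D = dualNrm (-generator w ε (ofNrm fun m => ((x m).1 : _ → ℂ)) -
    creation w ε f + annihilation w ε (chaosProj (p + 1) (p + 1)
      (ofNrm fun m => ((x m).1 : _ → ℂ)))) := ⟨_, rfl⟩
  rw [← hD] at r1 r2 r3 r4
  have hle : ∀ {m m' : ℕ} {c : ℝ} (_ : 0 ≤ c) (y : chaos 2 m) (y' : chaos 2 m'),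
      c * ‖y‖ ^ 2 ≤ R * ‖y'‖ ^ 2 →
      ENNReal.ofReal c * sqNorm y.1 ≤ ENNReal.ofReal R * sqNorm y'.1 := by
    intro m m' c hc y y' h
    rw [sqNorm_coe, sqNorm_coe, ← ENNReal.ofReal_mul hc, ← ENNReal.ofReal_mul hR0]
    exact ENNReal.ofReal_le_ofReal h
  have hbound : ∀ m, sqNorm (D m) ≤ ENNReal.ofReal R * sqNorm (Y (p + 1)).1 := by
    intro m
    by_cases h1 : m < p + 1 ∨ n + 1 < m
    · rw [r1 m h1]
      simp [sqNorm]
    rcases lt_trichotomy m n with h2 | rfl | h2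
    · rw [r2 m (by omega) h2]
      refine (herr m h2 (x m).1 (x m).2).trans (hle (sq_nonneg _) _ _ ?_)
      have h3 : η n ≤ θ ^ n := min_le_right _ _
      have h4 : ‖x m‖ ^ 2 ≤ ‖Y (p + 1)‖ ^ 2 :=
        (hdec m (by omega) h2.le).trans (mul_le_of_le_one_left (sq_nonneg _)
          (pow_le_one₀ hθ.1.le hθ.2.le))
      have h5 : η n ^ 2 ≤ R := by
        have h6 := (hη0 n).le
        calc η n ^ 2 ≤ (θ ^ n) ^ 2 := by gcongr
          _ = θ ^ n * θ ^ n := sq _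
          _ ≤ 1 * θ ^ n := by gcongr; exact pow_le_one₀ hθ.1.le hθ.2.le
          _ = (1 + 0 + 0) * 1 * (1 * θ ^ n) := by ring
          _ ≤ R := by rw [hRd]; gcongr; positivity
      gcongr
    · rw [r3]
      have h3 : sqNorm (fun k => -((gain w ε k : ℂ) * (x m).1 k)) ≤
          ENNReal.ofReal (γ ^ 2) * sqNorm (x m).1 := by
        refine (sqNorm_mono (g := fun k => (γ : ℂ) * (x m).1 k) fun k => ?_).trans (le_of_eq ?_)
        · rw [norm_neg, norm_mul, norm_mul, Complex.norm_real, Complex.norm_real, Real.norm_eq_abs,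
            Real.norm_eq_abs, abs_of_nonneg (gain_nonneg hw hε k), abs_of_nonneg hγ.le]
          gcongr
          rw [hγd]
          exact gain_le hw hε hε1 k
        · rw [sqNorm_const_mul, ← ofReal_norm, Complex.norm_real, Real.norm_eq_abs,
            abs_of_nonneg hγ.le, ENNReal.ofReal_pow hγ.le]
      refine h3.trans (hle (sq_nonneg _) _ _ ?_)
      calc γ ^ 2 * ‖x m‖ ^ 2 ≤ γ ^ 2 * ((θ ^ 3)⁻¹ * θ ^ m * ‖Y (p + 1)‖ ^ 2) := by gcongr
        _ = (0 + γ ^ 2 + 0) * 1 * ((θ ^ 3)⁻¹ * θ ^ m) * ‖Y (p + 1)‖ ^ 2 := by ring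
        _ ≤ R * ‖Y (p + 1)‖ ^ 2 := by rw [hRd]; gcongr; norm_num
    · obtain rfl : m = n + 1 := by omega
      rw [r4]
      have h3 : sqNorm (fun k => -pairOp (coef w ε hinv hinv) (x n).1 k) =
          sqNorm (pairOp (coef w ε hinv hinv) (x n).1) := by simp only [sqNorm, enorm_neg]
      rw [h3]
      refine (sqNorm_pairOp_hinv_le hε hCε hC0.le _).trans ?_
      rw [← hγd, ← hM]
      refine hle (by positivity) _ _ ?_
      calc M * n * ‖x n‖ ^ 2 ≤ M * n * ((θ ^ 3)⁻¹ * θ ^ n * ‖Y (p + 1)‖ ^ 2) := by gcongr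
        _ = (0 + 0 + M) * n * ((θ ^ 3)⁻¹ * θ ^ n) * ‖Y (p + 1)‖ ^ 2 := by ring
        _ ≤ R * ‖Y (p + 1)‖ ^ 2 := by rw [hRd]; gcongr; norm_num; positivity
  have hY2 : sqNorm (Y (p + 1)).1 ≤ ENNReal.ofReal (M * p) * sqNorm (nrm f p) := by
    rw [hY, dualNrm_creation hf, hM, hγd]
    exact sqNorm_pairOp_hinv_le hε hCε hC0.le _
  refine fockNorm_le_of_tsum_le ?_
  rw [tsum_sqNorm_nrm hfp, ← hD]
  rw [tsum_eq_sum (s := Finset.Icc (p + 1) (n + 1)) fun m hm => by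
    rw [Finset.mem_Icc] at hm
    rw [r1 m (by omega)]
    simp [sqNorm]]
  calc _ ≤ ∑ _m ∈ Finset.Icc (p + 1) (n + 1), ENNReal.ofReal R * sqNorm (Y (p + 1)).1 :=
        Finset.sum_le_sum fun m _ => hbound m
    _ = ((n + 1 - p : ℕ) : ℝ≥0∞) * (ENNReal.ofReal R * sqNorm (Y (p + 1)).1) := by
        rw [Finset.sum_const, Nat.card_Icc, nsmul_eq_mul]
        congr 2
        omega
    _ ≤ (n : ℝ≥0∞) * (ENNReal.ofReal R * (ENNReal.ofReal (M * p) * sqNorm (nrm f p))) := by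
        gcongr
        rcases hp with rfl | rfl <;> omega
    _ = ENNReal.ofReal (n * R * (M * p)) * sqNorm (nrm f p) := by
        rw [ENNReal.ofReal_mul (p := n * R) (by positivity), ENNReal.ofReal_mul (p := n) hn0.le,
          ENNReal.ofReal_natCast]
        ring
    _ ≤ _ := by
        rw [← ENNReal.ofReal_pow (by positivity)]
        gcongr
        rw [div_pow, Real.sq_sqrt (by positivity)]
        calc n * R * (M * p) ≤ n * R * (M * 2) := by gcongr
          _ = 2 * M * (1 + γ ^ 2 + M) * (θ ^ 3)⁻¹ * (n ^ 2 * θ ^ n) := by rw [hRd]; ring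
          _ ≤ 2 * M * (1 + γ ^ 2 + M) * (θ ^ 3)⁻¹ * (B / ((n : ℝ) ^ q) ^ 2) := by
              gcongr
              exact hB n (by omega)
          _ ≤ _ := by
              rw [← mul_div_assoc]
              gcongr
              linarith

end Conclusion

end Burgers

end

theorem theorem2p8 (d : ℕ) (hd : 2 ≤ d) (w : Fin d → ℝ) (hw : w ≠ 0) :
    ∃ εd : ℕ → ℝ, (∀ n, 0 < εd n) ∧ (3 ≤ d → ∀ n, εd n = 1) ∧
      ∀ k : ℕ, ∃ C : ℝ, 0 < C ∧
        ∀ i : ℕ, i = 2 ∨ i = 3 → ∀ n : ℕ, i ≤ n →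
        ∀ φ ψ : (Fin d → ℝ) → ℂ, Burgers.IsTestFunction φ → Burgers.IsTestFunction ψ →
        ∀ ε : ℝ, 0 < ε → ε < εd n → Burgers.AdmissibleScale d ε →
          ∃ v : Burgers.Kernels d,
            Burgers.IsApproxSolution w ε i n (Burgers.testInput φ ψ (i - 1)) v ∧
            (∀ u : Burgers.Kernels d,
              Burgers.IsApproxSolution w ε i n (Burgers.testInput φ ψ (i - 1)) u → u = v) ∧
            Burgers.fockNorm (Burgers.negSymGenPow (-1 / 2)
                (-Burgers.generator w ε v
                  - Burgers.creation w ε (Burgers.testInput φ ψ (i - 1))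
                  + Burgers.annihilation w ε (Burgers.chaosProj i i v))) ≤
              ENNReal.ofReal (C / (n : ℝ) ^ k) *
                Burgers.fockNorm
                  (Burgers.negSymGenPow (1 / 2) (Burgers.testInput φ ψ (i - 1))) := by
  have hzero : ∀ (φ ψ : (Fin d → ℝ) → ℂ) (p m : ℕ), m ≠ p → Burgers.testInput φ ψ p m = 0 :=
    fun φ ψ p m hm => by funext k; simp [Burgers.testInput, hm]
  rcases Nat.lt_or_ge 2 d with h3 | h2
  · refine ⟨fun _ => 1, fun _ => one_pos, fun _ _ => rfl, fun q => ?_⟩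
    obtain ⟨K, hK0, hK⟩ := Burgers.exists_truncated h3 w q
    refine ⟨K, hK0, fun i hi n hin φ ψ hφ hψ ε hε hε1 _ => ?_⟩
    obtain ⟨p, rfl⟩ : ∃ p, i = p + 1 := ⟨i - 1, by omega⟩
    have hp : p = 1 ∨ p = 2 := by omega
    simp only [Burgers.IsApproxSolution, if_neg (by omega : ¬ d = 2), Nat.add_sub_cancel]
    exact hK p hp n hin _ ⟨fun m => (Burgers.testInput_symMZ hφ hψ hp m).1, hzero φ ψ p 0 (by omega)⟩
      (fun m => (Burgers.testInput_symMZ hφ hψ hp m).2) (hzero φ ψ p) ε hε hε1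
  · obtain rfl : d = 2 := by omega
    obtain ⟨ε₂, hε₂, hq⟩ := Burgers.exists_ansatz hw
    refine ⟨ε₂, hε₂, fun h => absurd h (by norm_num), fun q => ?_⟩
    obtain ⟨K, hK0, hK⟩ := hq q
    refine ⟨K, hK0, fun i hi n hin φ ψ hφ hψ ε hε hε1 _ => ?_⟩
    obtain ⟨p, rfl⟩ : ∃ p, i = p + 1 := ⟨i - 1, by omega⟩
    have hp : p = 1 ∨ p = 2 := by omega
    simp only [Burgers.IsApproxSolution, if_true, Nat.add_sub_cancel]
    exact hK p hp n hin _ ⟨fun m => (Burgers.testInput_symMZ hφ hψ hp m).1, hzero φ ψ p 0 (by omega)⟩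
      (fun m => (Burgers.testInput_symMZ hφ hψ hp m).2) (hzero φ ψ p) ε hε hε1
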